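/- Graphs are finite, undirected and loopless and may contain parallel edges. A $k$-edge-colored graph is a graph $G=(V,E)$ with a map $c\colon E\to[k]$; write $E_i=c^{-1}(i)$. A set $F\subseteq E$ is \emph{properly colored} if any two distinct edges of $F$ sharing an endpoint have different colors, and it is a \emph{forest with bundles} if its support graph (the simple graph obtained from $F$ by replacing each class of parallel edges by a single edge) is a forest. In the Maximum-size Properly Colored Forest with Bundles problem one looks for a properly colored forest with bundles $F\subseteq E$ of maximum size $|F|$; let $\mathrm{OPT}(G)$ be this maximum. \textbf{Theorem.} There is a single algorithm (a program for a random access machine whose arithmetic operations are addition and truncated subtraction, counted at unit cost), running in time polynomial in $|V|+|E|$, which for every $k$ and every $k$-edge-colored graph $G=(V,E)$ returns a set $F\subseteq E$ such that, for some choice of a maximum matching $M_i\subseteq E_i$ for each color $i\in[k]$, $F$ is a maximum-size forest with bundles contained in $M_1\cup\dots\cup M_k$. The set $F$ is a properly colored forest with bundles satisfying $|F|\ge\tfrac34\,\mathrm{OPT}(G)$ if $k=2$, and a properly colored forest with bundles satisfying $|F|\ge\tfrac12\,\mathrm{OPT}(G)$ if $k=3$. Moreover, for $k=2$ and $k=3$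 these guarantees hold for every choice of the maximum matchings $M_i\subseteq E_i$ and of the maximum-size forest with bundles $F\subseteq M_1\cup\dots\cup M_k$. -/

import Mathlib

/-- A loopless undirected multigraph with vertex set `V` and edge set `E`, together with an
edge-coloring with `k` colors.  Edge `e` joins `fst e` and `snd e`; the order of the two
endpoints is irrelevant to all notions below. -/
structure EdgeColoredGraph (V : Type*) (E : Type*) (k : ℕ) where
  fst : E → V
  snd : E → V
  fst_ne_snd : ∀ e, fst e ≠ snd e
  color : E → Fin k

namespace EdgeColoredGraph

variable {V : Type*} {E : Type*} {k : ℕ}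

/-- `v` is an endpoint of `e`. -/
def Incident (G : EdgeColoredGraph V E k) (e : E) (v : V) : Prop :=
  G.fst e = v ∨ G.snd e = v

/-- `e` has endpoints `u` and `v`. -/
def Joins (G : EdgeColoredGraph V E k) (e : E) (u v : V) : Prop :=
  (G.fst e = u ∧ G.snd e = v) ∨ (G.fst e = v ∧ G.snd e = u)

/-- The support graph of `F`: every bundle of parallel edges of `F` becomes a single edge. -/
def supp (G : EdgeColoredGraph V E k) (F : Finset E) : SimpleGraph V :=
  SimpleGraph.fromRel fun u v => ∃ e ∈ F, G.Joins e u v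

/-- `F` is a forest with bundles: its support graph is a forest. -/
def IsForestWithBundles (G : EdgeColoredGraph V E k) (F : Finset E) : Prop :=
  (G.supp F).IsAcyclic

/-- Any two distinct adjacent edges of `F` have distinct colors.  Parallel edges are adjacent. -/
def IsProperlyColored (G : EdgeColoredGraph V E k) (F : Finset E) : Prop :=
  ∀ e ∈ F, ∀ f ∈ F, e ≠ f → (∃ v, G.Incident e v ∧ G.Incident f v) → G.color e ≠ G.color f

/-- Every vertex is an endpoint of at most one edge of `M`. -/
def IsMatching (G : EdgeColoredGraph V E k) (M : Finset E) : Prop :=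
  ∀ v, ∀ e ∈ M, ∀ f ∈ M, G.Incident e v → G.Incident f v → e = f

/-- The set of edges of color `i`. -/
def colorClass [Fintype E] (G : EdgeColoredGraph V E k) (i : Fin k) : Finset E :=
  Finset.univ.filter fun e => G.color e = i

/-- `M` is a maximum-size matching contained in `A`. -/
def IsMaximumMatchingIn (G : EdgeColoredGraph V E k) (A M : Finset E) : Prop :=
  M ⊆ A ∧ G.IsMatching M ∧ ∀ N ⊆ A, G.IsMatching N → N.card ≤ M.card

/-- `F` is a maximum-size forest with bundles contained in `A`. -/
def IsMaximumForestWithBundlesIn (G : EdgeColoredGraph V E k) (A F : Finset E) : Prop :=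
  F ⊆ A ∧ G.IsForestWithBundles F ∧ ∀ H ⊆ A, G.IsForestWithBundles H → H.card ≤ F.card

/-- `F` is a possible result of the following procedure: choose a maximum matching in each color
class, then choose a maximum-size forest with bundles in the union of these matchings. -/
def IsMatchingUnionOutput [Fintype E] [DecidableEq E] (G : EdgeColoredGraph V E k)
    (F : Finset E) : Prop :=
  ∃ M : Fin k → Finset E, (∀ i, G.IsMaximumMatchingIn (G.colorClass i) (M i)) ∧
    G.IsMaximumForestWithBundlesIn (Finset.univ.biUnion M) F

/-- `F` is a properly colored forest with bundles whose size is at least `α` times the size of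
every (hence of a maximum-size) properly colored forest with bundles. -/
def IsApproxSolution (G : EdgeColoredGraph V E k) (α : ℚ) (F : Finset E) : Prop :=
  (G.IsProperlyColored F ∧ G.IsForestWithBundles F) ∧
    ∀ O : Finset E, G.IsProperlyColored O → G.IsForestWithBundles O →
      α * (O.card : ℚ) ≤ (F.card : ℚ)

end EdgeColoredGraph

/-!
A random access machine with structured control flow.  Its storage consists of arrays of natural
numbers, of which a program mentions only finitely many by name.  The arithmetic operations are
addition and truncated subtraction (no multiplication), so that in `t` steps the bit lengths of
the stored numbers grow by `O(t)` only: running times are polynomially related to those of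
Turing machines.
-/
namespace Ram

/-- `s a i` is the content of cell `i` of array `a`. -/
abbrev Store := ℕ → ℕ → ℕ

/-- Arithmetic expressions; `read a i` is the content of cell `i` of array `a`. -/
inductive Expr where
  | const (c : ℕ)
  | read (a : ℕ) (i : Expr)
  | add (x y : Expr)
  | sub (x y : Expr)

/-- The value of an expression. -/
def Expr.eval (s : Store) : Expr → ℕ
  | .const c => c
  | .read a i => s a (i.eval s)
  | .add x y => x.eval s + y.eval s
  | .sub x y => x.eval s - y.eval s

/-- The number of elementary steps needed to evaluate an expression. -/
def Expr.cost : Expr → ℕ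
  | .const _ => 1
  | .read _ i => i.cost + 1
  | .add x y => x.cost + y.cost + 1
  | .sub x y => x.cost + y.cost + 1

/-- Programs: `write a i x` stores `x` in cell `i` of array `a`; `branch b p q` runs `p` if
`b ≠ 0` and `q` otherwise; `loop b p` runs `p` as long as `b ≠ 0`. -/
inductive Program where
  | skip
  | write (a : ℕ) (i x : Expr)
  | seq (p q : Program)
  | branch (b : Expr) (p q : Program)
  | loop (b : Expr) (p : Program)

/-- The store after writing `x` to cell `i` of array `a`. -/
def Store.write (s : Store) (a i x : ℕ) : Store :=
  Function.update s a (Function.update (s a) i x)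

/-- `Exec p s t s'`: started in the store `s`, the program `p` halts in the store `s'` after
exactly `t` elementary steps. -/
inductive Exec : Program → Store → ℕ → Store → Prop
  | skip (s : Store) : Exec .skip s 1 s
  | write (a : ℕ) (i x : Expr) (s : Store) :
      Exec (.write a i x) s (i.cost + x.cost + 1) (s.write a (i.eval s) (x.eval s))
  | seq {p q : Program} {s s' s'' : Store} {t t' : ℕ} :
      Exec p s t s' → Exec q s' t' s'' → Exec (.seq p q) s (t + t') s''
  | branch_true {b : Expr} {p q : Program} {s s' : Store} {t : ℕ} :
      b.eval s ≠ 0 → Exec p s t s' → Exec (.branch b p q) s (b.cost + t + 1) s'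
  | branch_false {b : Expr} {p q : Program} {s s' : Store} {t : ℕ} :
      b.eval s = 0 → Exec q s t s' → Exec (.branch b p q) s (b.cost + t + 1) s'
  | loop_true {b : Expr} {p : Program} {s s' s'' : Store} {t t' : ℕ} :
      b.eval s ≠ 0 → Exec p s t s' → Exec (.loop b p) s' t' s'' →
        Exec (.loop b p) s (b.cost + t + t' + 1) s''
  | loop_false {b : Expr} {p : Program} {s : Store} :
      b.eval s = 0 → Exec (.loop b p) s (b.cost + 1) s

end Ram

namespace EdgeColoredGraph

/-- The initial store for a graph with vertices `0, …, n - 1`, edges `0, …, m - 1` and colors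
`0, …, k - 1`.  Array `0` starts with `n, m, k`; cell `j` of the arrays `1`, `2`, `3` contains the
two endpoints and the color of edge `j`; all other cells are `0`. -/
def inputStore {n m k : ℕ} (G : EdgeColoredGraph (Fin n) (Fin m) k) : Ram.Store := fun a j =>
  match a with
  | 0 => if j = 0 then n else if j = 1 then m else if j = 2 then k else 0
  | 1 => if h : j < m then (G.fst ⟨j, h⟩ : ℕ) else 0
  | 2 => if h : j < m then (G.snd ⟨j, h⟩ : ℕ) else 0
  | 3 => if h : j < m then (G.color ⟨j, h⟩ : ℕ) else 0
  | _ => 0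

/-- On input `G`, the program `P` halts after at most `T` steps and returns the edge set `F`:
after halting, the first `m` cells of array `4` contain the indicator vector of `F`. -/
def ReturnsWithin {n m k : ℕ} (P : Ram.Program) (G : EdgeColoredGraph (Fin n) (Fin m) k)
    (T : ℕ) (F : Finset (Fin m)) : Prop :=
  ∃ (t : ℕ) (s : Ram.Store), t ≤ T ∧ Ram.Exec P G.inputStore t s ∧
    ∀ j : Fin m, s 4 j = if j ∈ F then 1 else 0

end EdgeColoredGraph

/-!
Approximation: in a union `A` of maximum matchings of the color classes, a component with `c`
vertices of the maximum forest `F` contains at most `k * ⌊c / 2⌋` edges of `A` and at least `c - 1`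
edges of `F`; if `c = 2`, all these edges are parallel and belong to `F`. Every edge of `A` lies
within a component, so `|A| ≤ 4 / 3 * |F|` for `k = 2` and `|A| ≤ 2 * |F|` for `k = 3`, while a
properly colored set splits into one matching per color and has at most `|A|` edges.

Forest: bundles form the graphic matroid weighted by multiplicity, so it is enough to try them in
order of decreasing multiplicity.

Matchings: the alternating forest of Edmonds, with shrinking of blossoms, *decides* whether a set
`H` of edges contains a matching larger than the matching `M ⊆ H`. It does if an edge joins two
trees. A stuck forest has, below its roots, as many outer as inner nodes; outer blossoms are odd and
are joined only to inner vertices, so that no matching exposes fewer vertices than there are roots.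
Deciding suffices, because no augmenting path has to be traced through the blossoms: delete edges of
`H` outside `M` as long as a larger matching survives. The edges of `H` outside `M`, together with
those disjoint from them, then form a larger matching.

Running time: all loops count up to a bound fixed before the loop starts, hence a polynomial bound
follows by recursion on the program.
-/

/-! ### Matchings and factor-critical sets -/

namespace EdgeColoredGraph

section Matching

variable {V E : Type*} {k : ℕ} {G : EdgeColoredGraph V E k}

theorem Joins.symm {e : E} {u v : V} (h : G.Joins e u v) : G.Joins e v u := Or.symm h

theorem joins_endpoints (e : E) : G.Joins e (G.fst e) (G.snd e) := Or.inl ⟨rfl, rfl⟩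

theorem Joins.incident_iff {e : E} {u v w : V} (h : G.Joins e u v) :
    G.Incident e w ↔ w = u ∨ w = v := by
  unfold Joins Incident at *
  grind

theorem IsMatching.mono {M N : Finset E} (hN : G.IsMatching N) (h : M ⊆ N) : G.IsMatching M :=
  fun v e he f hf => hN v e (h he) f (h hf)

/-- Some matching contained in `H` is larger than `M`. -/
def HasLargerMatching (G : EdgeColoredGraph V E k) (M H : Finset E) : Prop :=
  ∃ N ⊆ H, G.IsMatching N ∧ M.card < N.card

theorem HasLargerMatching.mono {M H H' : Finset E} (h : G.HasLargerMatching M H) (hH : H ⊆ H') :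
    G.HasLargerMatching M H' :=
  h.imp fun _ hN => ⟨hN.1.trans hH, hN.2⟩

/-- Some edge in `H` joins a vertex of `K` to a vertex of `L`. -/
def Linked (G : EdgeColoredGraph V E k) (H : Finset E) (K L : Finset V) : Prop :=
  ∃ e ∈ H, ∃ u ∈ K, ∃ v ∈ L, G.Joins e u v

theorem Linked.symm {H : Finset E} {K L : Finset V} (h : G.Linked H K L) : G.Linked H L K := by
  obtain ⟨e, he, u, hu, v, hv, huv⟩ := h
  exact ⟨e, he, v, hv, u, hu, huv.symm⟩

/-- The set `H` contains a matching larger than `M`, but does not any more after the deletion of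
an edge outside of `M`. -/
def IsPruned [DecidableEq E] (G : EdgeColoredGraph V E k) (M H : Finset E) : Prop :=
  G.HasLargerMatching M H ∧ ∀ e ∈ H, e ∉ M → ¬ G.HasLargerMatching M (H.erase e)

theorem IsPruned.subset_of_isMatching [DecidableEq E] {M H N : Finset E} (h : G.IsPruned M H)
    (hNH : N ⊆ H) (hN : G.IsMatching N) (hlt : M.card < N.card) : H \ M ⊆ N := by
  intro e he
  obtain ⟨heH, heM⟩ := Finset.mem_sdiff.1 he
  by_contra heN
  exact h.2 e heH heM ⟨N, Finset.subset_erase.2 ⟨hNH, heN⟩, hN, hlt⟩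

variable [DecidableEq V]

/-- The set of vertices covered by `N`. -/
def cover (G : EdgeColoredGraph V E k) (N : Finset E) : Finset V :=
  N.biUnion fun e => {G.fst e, G.snd e}

theorem mem_cover {N : Finset E} {v : V} : v ∈ G.cover N ↔ ∃ e ∈ N, G.Incident e v := by
  simp [cover, Incident, eq_comm]

theorem cover_union [DecidableEq E] (M N : Finset E) :
    G.cover (M ∪ N) = G.cover M ∪ G.cover N := Finset.union_biUnion

theorem cover_subset {H N : Finset E} {U : Finset V} (hH : ∀ e ∈ H, G.fst e ∈ U ∧ G.snd e ∈ U)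
    (hN : N ⊆ H) : G.cover N ⊆ U := by
  intro v hv
  obtain ⟨e, he, rfl | rfl⟩ := mem_cover.1 hv
  exacts [(hH e (hN he)).1, (hH e (hN he)).2]

theorem IsMatching.card_cover {N : Finset E} (hN : G.IsMatching N) :
    (G.cover N).card = 2 * N.card := by
  rw [cover, Finset.card_biUnion, Finset.sum_congr rfl fun e _ => Finset.card_pair (G.fst_ne_snd e)]
  · simp [mul_comm]
  · intro e he f hf hef
    refine Finset.disjoint_left.2 fun v hve hvf => hef (hN v e he f hf ?_ ?_)
    · simpa [Incident, eq_comm] using hve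
    · simpa [Incident, eq_comm] using hvf

section Exchange

variable [DecidableEq E] {M H : Finset E}

/-- The edges of `H` outside of `M` together with the edges of `H` that are disjoint from them. -/
def exchange (G : EdgeColoredGraph V E k) (M H : Finset E) : Finset E :=
  H.filter fun e => e ∈ M → G.fst e ∉ G.cover (H \ M) ∧ G.snd e ∉ G.cover (H \ M)

theorem mem_exchange {e : E} : e ∈ G.exchange M H ↔
    e ∈ H ∧ (e ∈ M → ∀ f ∈ H, f ∉ M → ∀ v, G.Incident e v → ¬ G.Incident f v) := by
  simp only [exchange, Finset.mem_filter, mem_cover, Finset.mem_sdiff, Incident]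
  grind

theorem IsPruned.isMatching_exchange (h : G.IsPruned M H) (hM : G.IsMatching M) :
    G.IsMatching (G.exchange M H) := by
  obtain ⟨N, hNH, hN, hlt⟩ := h.1
  have hsub := h.subset_of_isMatching hNH hN hlt
  intro v e he f hf hev hfv
  obtain ⟨heH, he'⟩ := mem_exchange.1 he
  obtain ⟨hfH, hf'⟩ := mem_exchange.1 hf
  by_cases heM : e ∈ M <;> by_cases hfM : f ∈ M
  · exact hM v e heM f hfM hev hfv
  · exact absurd hfv (he' heM f hfH hfM v hev)
  · exact absurd hev (hf' hfM e heH heM v hfv)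
  · exact hN v e (hsub (by simp [heH, heM])) f (hsub (by simp [hfH, hfM])) hev hfv

theorem IsPruned.card_lt_card_exchange (h : G.IsPruned M H) :
    M.card < (G.exchange M H).card := by
  obtain ⟨N, hNH, hN, hlt⟩ := h.1
  refine hlt.trans_le (Finset.card_le_card fun e he => mem_exchange.2 ⟨hNH he, ?_⟩)
  intro heM f hf hfM v hev hfv
  have hfN := h.subset_of_isMatching hNH hN hlt (Finset.mem_sdiff.2 ⟨hf, hfM⟩)
  exact hfM (hN v e he f hfN hev hfv ▸ heM)

end Exchange

variable {H : Finset E}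

/-- Some matching contained in `H` covers exactly the vertices in `Z`. -/
def PerfectOn (G : EdgeColoredGraph V E k) (H : Finset E) (Z : Finset V) : Prop :=
  ∃ N ⊆ H, G.IsMatching N ∧ G.cover N = Z

theorem perfectOn_empty : G.PerfectOn H ∅ :=
  ⟨∅, by simp, by simp [IsMatching], by simp [cover]⟩

theorem Joins.perfectOn_pair {e : E} {u v : V} (h : G.Joins e u v) (he : e ∈ H) :
    G.PerfectOn H {u, v} := by
  refine ⟨{e}, by simpa using he, by simp +contextual [IsMatching], ?_⟩
  ext w
  simp [mem_cover, h.incident_iff]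

theorem PerfectOn.even_card {Z : Finset V} (hZ : G.PerfectOn H Z) : Even Z.card := by
  obtain ⟨N, -, hN, rfl⟩ := hZ
  exact ⟨N.card, by rw [hN.card_cover, two_mul]⟩

theorem IsMatching.exists_of_odd_card {N : Finset E} {K : Finset V} (hN : G.IsMatching N)
    (hK : Odd K.card) :
    (∃ v ∈ K, v ∉ G.cover N) ∨ ∃ e ∈ N, ∃ v ∈ K, ∃ w ∉ K, G.Joins e v w := by
  classical
  by_contra! ⟨hcover, hinside⟩
  refine Nat.not_even_iff_odd.2 hK (PerfectOn.even_card (G := G) (H := N)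
    ⟨N.filter fun e => G.fst e ∈ K, Finset.filter_subset _ _,
      hN.mono (Finset.filter_subset _ _), ?_⟩)
  ext v
  simp only [mem_cover, Finset.mem_filter]
  constructor
  · rintro ⟨e, ⟨he, hfst⟩, rfl | rfl⟩
    · exact hfst
    · by_contra hsnd
      exact hinside e he _ hfst _ hsnd (joins_endpoints e)
  · intro hv
    obtain ⟨e, he, hev⟩ := mem_cover.1 (hcover v hv)
    refine ⟨e, ⟨he, ?_⟩, hev⟩
    rcases hev with rfl | rfl
    · exact hv
    · by_contra hfst
      exact hinside e he _ hv _ hfst (joins_endpoints e).symm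

/-- `K` is factor-critical: every vertex of `K` is missed by a matching in `H` that covers exactly
the other vertices of `K`. -/
def FactorCritical (G : EdgeColoredGraph V E k) (H : Finset E) (K : Finset V) : Prop :=
  ∀ v ∈ K, G.PerfectOn H (K.erase v)

theorem factorCritical_singleton (v : V) : G.FactorCritical H {v} := by
  simp [FactorCritical, perfectOn_empty]

theorem FactorCritical.odd_card {K : Finset V} (hK : G.FactorCritical H K) (hne : K.Nonempty) :
    Odd K.card := by
  obtain ⟨v, hv⟩ := hne
  rw [← Finset.card_erase_add_one hv]
  exact (hK v hv).even_card.add_one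

theorem IsMatching.union [DecidableEq E] {M N : Finset E} (hM : G.IsMatching M)
    (hN : G.IsMatching N) (h : Disjoint (G.cover M) (G.cover N)) : G.IsMatching (M ∪ N) := by
  have apart : ∀ v, ∀ e ∈ M, ∀ f ∈ N, G.Incident e v → ¬ G.Incident f v :=
    fun v e he f hf hev hfv =>
      Finset.disjoint_left.1 h (mem_cover.2 ⟨e, he, hev⟩) (mem_cover.2 ⟨f, hf, hfv⟩)
  intro v e he f hf hev hfv
  rcases Finset.mem_union.1 he with he | he <;> rcases Finset.mem_union.1 hf with hf | hf
  · exact hM v e he f hf hev hfv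
  · exact absurd hfv (apart v e he f hf hev)
  · exact absurd hev (apart v f hf e he hfv)
  · exact hN v e he f hf hev hfv

theorem PerfectOn.union {Z W : Finset V} (hZ : G.PerfectOn H Z) (hW : G.PerfectOn H W)
    (h : Disjoint Z W) : G.PerfectOn H (Z ∪ W) := by
  classical
  obtain ⟨M, hMH, hM, rfl⟩ := hZ
  obtain ⟨N, hNH, hN, rfl⟩ := hW
  exact ⟨M ∪ N, Finset.union_subset hMH hNH, hM.union hN h, cover_union M N⟩

theorem Linked.perfectOn_union {K L : Finset V} (h : G.Linked H K L) (hK : G.FactorCritical H K)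
    (hL : G.FactorCritical H L) (hKL : Disjoint K L) : G.PerfectOn H (K ∪ L) := by
  obtain ⟨e, he, u, hu, v, hv, huv⟩ := h
  have hdisj : ∀ w ∈ K, w ∉ L := fun w hw => Finset.disjoint_left.1 hKL hw
  have hKv := (hK u hu).union (hL v hv)
    (hKL.mono (Finset.erase_subset _ _) (Finset.erase_subset _ _))
  convert hKv.union (huv.perfectOn_pair he) ?_ using 1
  · ext w
    grind
  · refine Finset.disjoint_left.2 fun w => ?_
    grind

variable {ι : Type*} [DecidableEq ι] {K : ι → Finset V}

theorem disjoint_biUnion_of_notMem (hK : Pairwise (Function.onFun Disjoint K)) {i : ι} {l : List ι}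
    (hi : i ∉ l) : Disjoint (K i) (l.toFinset.biUnion K) := by
  refine (Finset.disjoint_biUnion_right _ _ _).2 fun j hj => hK ?_
  rintro rfl
  exact hi (List.mem_toFinset.1 hj)

theorem perfectOn_biUnion_of_isChain (hK : Pairwise (Function.onFun Disjoint K)) :
    ∀ {l : List ι}, (∀ i ∈ l, G.FactorCritical H (K i)) →
      l.IsChain (fun i j => G.Linked H (K i) (K j)) → l.Nodup → Even l.length →
      G.PerfectOn H (l.toFinset.biUnion K)
  | [], _, _, _, _ => by simpa using perfectOn_empty
  | [i], _, _, _, heven => by simp at heven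
  | i :: j :: l, hcrit, hchain, hnodup, heven => by
    have hij : i ≠ j := fun h => by simp [h] at hnodup
    obtain ⟨hi, hj, hl⟩ : i ∉ l ∧ j ∉ l ∧ l.Nodup := by
      simp only [List.nodup_cons, List.mem_cons, not_or] at hnodup
      exact ⟨hnodup.1.2, hnodup.2⟩
    have hpair : G.PerfectOn H (K i ∪ K j) :=
      (List.isChain_cons_cons.1 hchain).1.perfectOn_union (hcrit i (by simp)) (hcrit j (by simp))
        (hK hij)
    have hrest : G.PerfectOn H (l.toFinset.biUnion K) :=
      perfectOn_biUnion_of_isChain hK (fun i hi => hcrit i (by simp [hi])) hchain.tail.tail hl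
        (by simpa [Nat.even_add_one] using heven)
    convert hpair.union hrest (Finset.disjoint_union_left.2
      ⟨disjoint_biUnion_of_notMem hK hi, disjoint_biUnion_of_notMem hK hj⟩) using 1
    simp [Finset.union_assoc]

theorem perfectOn_biUnion_erase (hK : Pairwise (Function.onFun Disjoint K)) {i : ι} {l : List ι}
    (hcrit : ∀ j ∈ i :: l, G.FactorCritical H (K j))
    (hchain : l.IsChain fun i j => G.Linked H (K i) (K j)) (hnodup : (i :: l).Nodup)
    (heven : Even l.length) {v : V} (hv : v ∈ K i) :
    G.PerfectOn H (((i :: l).toFinset.biUnion K).erase v) := by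
  have hdisj : Disjoint (K i) (l.toFinset.biUnion K) :=
    disjoint_biUnion_of_notMem hK (List.nodup_cons.1 hnodup).1
  have hrest : G.PerfectOn H (l.toFinset.biUnion K) :=
    perfectOn_biUnion_of_isChain hK (fun j hj => hcrit j (by simp [hj])) hchain
      (List.nodup_cons.1 hnodup).2 heven
  convert (hcrit i (by simp) v hv).union hrest (hdisj.mono_left (Finset.erase_subset _ _)) using 1
  rw [List.toFinset_cons, Finset.biUnion_insert, Finset.erase_union_distrib,
    Finset.erase_eq_of_notMem (Finset.disjoint_left.1 hdisj hv)]

theorem factorCritical_biUnion_of_cycle (hK : Pairwise (Function.onFun Disjoint K)) {i : ι}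
    {l : List ι} (hcrit : ∀ j ∈ i :: l, G.FactorCritical H (K j))
    (hcycle : (i :: l ++ [i]).IsChain fun i j => G.Linked H (K i) (K j)) (hnodup : (i :: l).Nodup)
    (heven : Even l.length) : G.FactorCritical H ((i :: l).toFinset.biUnion K) := by
  intro v hv
  obtain ⟨j, hj, hvj⟩ := Finset.mem_biUnion.1 hv
  rcases List.mem_cons.1 (List.mem_toFinset.1 hj) with rfl | hj
  · exact perfectOn_biUnion_erase hK hcrit hcycle.tail.left_of_append hnodup heven hvj
  · -- Rotate the cycle so that it starts with the class of `v`.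
    obtain ⟨l₁, l₂, rfl⟩ := List.append_of_mem hj
    have hperm : (j :: (l₂ ++ i :: l₁)).Perm (i :: (l₁ ++ j :: l₂)) := by
      grind
    have hchain : (l₂ ++ i :: l₁).IsChain fun i j => G.Linked H (K i) (K j) := by
      have hsplit : ((i :: l₁) ++ j :: (l₂ ++ [i])).IsChain fun i j => G.Linked H (K i) (K j) := by
        simpa using hcycle
      exact List.isChain_split.2 ⟨(List.isChain_split.1 hsplit).2.tail, hsplit.left_of_append⟩
    rw [← List.toFinset_eq_of_perm _ _ hperm]
    exact perfectOn_biUnion_erase hK (fun j hj => hcrit j (hperm.mem_iff.1 hj)) hchain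
      (hperm.nodup_iff.2 hnodup) (by grind) hvj

end Matching

end EdgeColoredGraph

/-! ### The search forest -/

/-- The data of Edmonds' search for an augmenting path. Every vertex lies in a blossom, named by its
`base`; a *node* is a vertex with `base v = v`. The nodes form an alternating forest: `status` is
`0` for nodes outside the forest, `1` for outer and `2` for inner nodes, `parent y` is the outer end
of the edge through which the inner node `y` was reached, and `depth` grows along the forest.
Exposed vertices are their own `mate`. Shrinking a blossom changes only `base`, so `status` is
meaningful at nodes only. -/
structure SearchState (V : Type*) where
  mate : V → V
  base : V → V
  parent : V → V
  status : V → ℕ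
  depth : V → ℕ

namespace SearchState

variable {V : Type*}

/-- `v` lies in an outer blossom. -/
def IsOuter (S : SearchState V) (v : V) : Prop := S.status (S.base v) = 1

variable [DecidableEq V]

/-- The blossom with base `b`. -/
def blossom (S : SearchState V) (vs : Finset V) (b : V) : Finset V := vs.filter (S.base · = b)

/-- Hang the free vertex `y` and its mate below the blossom of `x`. -/
def grow (S : SearchState V) (x y : V) : SearchState V where
  mate := S.mate
  base := S.base
  parent := Function.update S.parent y x
  status := Function.update (Function.update S.status y 2) (S.mate y) 1
  depth := Function.update S.depth (S.mate y) (S.depth (S.base x) + 1)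

/-- Shrink the blossoms with bases in `L` into the one with base `b`. -/
def merge (S : SearchState V) (vs : Finset V) (L : List V) (b : V) : SearchState V :=
  { S with base := fun v => if v ∈ vs ∧ S.base v ∈ L then b else S.base v }

/-- The number of free vertices plus the number of blossoms, which every change of the forest
decreases. -/
def potential (S : SearchState V) (vs : Finset V) : ℕ :=
  (vs.filter (S.status · = 0)).card + (vs.filter fun v => S.base v = v).card

theorem mem_blossom {S : SearchState V} {vs : Finset V} {b v : V} :
    v ∈ S.blossom vs b ↔ v ∈ vs ∧ S.base v = b := Finset.mem_filter

theorem mem_blossom_self {S : SearchState V} {vs : Finset V} {v : V} (hv : v ∈ vs)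
    (hnode : S.base v = v) : v ∈ S.blossom vs v := mem_blossom.2 ⟨hv, hnode⟩

theorem pairwise_disjoint_blossom (S : SearchState V) (vs : Finset V) :
    Pairwise (Function.onFun Disjoint (S.blossom vs)) := by
  intro a b hab
  refine Finset.disjoint_left.2 fun v hva hvb => hab ?_
  rw [← (mem_blossom.1 hva).2, (mem_blossom.1 hvb).2]

theorem blossom_merge_self (S : SearchState V) (vs : Finset V) (L : List V) (b : V) :
    (S.merge vs L b).blossom vs b = (b :: L).toFinset.biUnion (S.blossom vs) := by
  ext v
  simp only [blossom, merge, Finset.mem_filter, Finset.mem_biUnion, List.mem_toFinset,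
    List.mem_cons]
  grind

theorem blossom_merge_of_ne {S : SearchState V} {vs : Finset V} {L : List V} {b c : V} (hcb : c ≠ b)
    (hc : c ∉ L) : (S.merge vs L b).blossom vs c = S.blossom vs c := by
  ext v
  simp only [blossom, merge, Finset.mem_filter]
  grind

theorem potential_le (S : SearchState V) (vs : Finset V) : S.potential vs ≤ 2 * vs.card := by
  have := vs.card_filter_le (S.status · = 0)
  have := vs.card_filter_le fun v => S.base v = v
  unfold potential
  omega

theorem potential_grow_lt {S : SearchState V} {vs : Finset V} {x y : V} (hy : y ∈ vs)
    (hfree : S.status y = 0) : (S.grow x y).potential vs < S.potential vs := by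
  refine Nat.add_lt_add_right (Finset.card_lt_card ?_) _
  refine Finset.ssubset_iff_of_subset (fun v => ?_) |>.2 ⟨y, by simp [hy, hfree], ?_⟩ <;>
    simp only [grow, Finset.mem_filter, Function.update_apply] <;> grind

theorem isOuter_grow {S : SearchState V} {x y v : V} (hy : S.status y = 0)
    (hv : S.IsOuter v) : (S.grow x y).IsOuter v := by
  simp only [grow, Function.update_apply, IsOuter] at *
  grind

theorem depth_grow_base {S : SearchState V} {x y v : V}
    (hmate : S.status (S.mate y) = 0) (hv : S.IsOuter v) :
    (S.grow x y).depth (S.base v) = S.depth (S.base v) := by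
  simp only [grow, Function.update_apply, IsOuter] at *
  grind

theorem potential_merge_lt {S : SearchState V} {vs : Finset V} {L : List V} {b v : V} (hv : v ∈ L)
    (hvs : v ∈ vs) (hnode : S.base v = v) (hb : b ∉ L) (hbase : S.base b = b) :
    (S.merge vs L b).potential vs < S.potential vs := by
  refine Nat.add_lt_add_left (Finset.card_lt_card ?_) _
  refine Finset.ssubset_iff_of_subset (fun w hw => ?_) |>.2 ⟨v, ?_, ?_⟩
  · grind [merge]
  · simp [hvs, hnode]
  · grind [merge]

end SearchState

namespace EdgeColoredGraph

section Search

variable {V E : Type*} {k : ℕ} {G : EdgeColoredGraph V E k} {vs : Finset V} {M H : Finset E}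
  {mate : V → V}

/-- `mate` exchanges the ends of every edge of `M` and fixes the vertices of `vs` exposed by `M`. -/
structure IsMate (G : EdgeColoredGraph V E k) (vs : Finset V) (M : Finset E) (mate : V → V) :
    Prop where
  mem : ∀ v ∈ vs, mate v ∈ vs
  mate_mate : ∀ v ∈ vs, mate (mate v) = v
  joins : ∀ v ∈ vs, mate v ≠ v → ∃ e ∈ M, G.Joins e v (mate v)
  of_mem : ∀ e ∈ M, mate (G.fst e) = G.snd e ∧ mate (G.snd e) = G.fst e

theorem isMate_empty (h : ∀ v ∈ vs, mate v = v) : IsMate G vs ∅ mate :=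
  ⟨fun v hv => by rwa [h v hv], fun v hv => by rw [h v hv, h v hv],
    fun v hv h' => absurd (h v hv) h', by simp⟩

theorem IsMate.insert [DecidableEq V] [DecidableEq E] (hmate : IsMate G vs M mate) {e : E}
    (he : e ∉ M) (hM : G.IsMatching (insert e M)) (hfst : G.fst e ∈ vs) (hsnd : G.snd e ∈ vs) :
    IsMate G vs (insert e M)
      (Function.update (Function.update mate (G.fst e) (G.snd e)) (G.snd e) (G.fst e)) := by
  have hdisjoint : ∀ f ∈ M, ∀ v, G.Incident e v → ¬ G.Incident f v := fun f hf v hev hfv =>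
    he (hM v e (by simp) f (by simp [hf]) hev hfv ▸ hf)
  have hexposed : ∀ v ∈ vs, G.Incident e v → mate v = v := by
    intro v hv hev
    by_contra hmv
    obtain ⟨f, hf, hjoins⟩ := hmate.joins v hv hmv
    exact hdisjoint f hf v hev (hjoins.incident_iff.2 (Or.inl rfl))
  have hmate_fst := hexposed _ hfst (Or.inl rfl)
  have hmate_snd := hexposed _ hsnd (Or.inr rfl)
  have hmem := hmate.mem
  have hmate_mate := hmate.mate_mate
  constructor
  · simp only [Function.update_apply]
    grind
  · simp only [Function.update_apply]
    grind
  · intro v hv hmv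
    simp only [Function.update_apply] at hmv ⊢
    split_ifs at hmv ⊢ with hv₂ hv₁
    · exact ⟨e, by simp, Or.inr ⟨rfl, hv₂.symm⟩⟩
    · exact ⟨e, by simp, Or.inl ⟨hv₁.symm, rfl⟩⟩
    · obtain ⟨f, hf, hjoins⟩ := hmate.joins v hv hmv
      exact ⟨f, by simp [hf], hjoins⟩
  · intro f hf
    simp only [Function.update_apply]
    rcases Finset.mem_insert.1 hf with rfl | hf
    · simp [G.fst_ne_snd f]
    · have h₁ := hdisjoint f hf _ (Or.inl rfl)
      have h₂ := hdisjoint f hf _ (Or.inr rfl)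
      simp only [Incident, not_or] at h₁ h₂
      simp only [h₁, h₂, if_false, hmate.of_mem f hf, and_self]

variable [DecidableEq V]

theorem IsMate.mem_cover_iff (hmate : IsMate G vs M mate) {v : V} (hv : v ∈ vs) :
    v ∈ G.cover M ↔ mate v ≠ v := by
  refine ⟨fun h => ?_, fun h => ?_⟩
  · obtain ⟨e, he, rfl | rfl⟩ := mem_cover.1 h
    · exact (hmate.of_mem e he).1 ▸ (G.fst_ne_snd e).symm
    · exact (hmate.of_mem e he).2 ▸ G.fst_ne_snd e
  · obtain ⟨e, he, hjoins⟩ := hmate.joins v hv h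
    exact mem_cover.2 ⟨e, he, hjoins.incident_iff.2 (Or.inl rfl)⟩

/-- Inside `Z` take the given perfect matching, outside keep `M`. -/
theorem IsMate.hasLargerMatching (hmate : IsMate G vs M mate) (hM : G.IsMatching M) (hMH : M ⊆ H)
    {Z : Finset V} (hZ : G.PerfectOn H Z) (hclosed : ∀ v ∈ Z, mate v ∈ Z) {r : V}
    (hr : r ∈ Z) (hexp : mate r = r) (hrvs : r ∈ vs) :
    G.HasLargerMatching M H := by
  classical
  obtain ⟨N, hNH, hN, rfl⟩ := hZ
  set O := M.filter fun e => G.fst e ∉ G.cover N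
  have hO_apart : Disjoint (G.cover N) (G.cover O) := by
    refine Finset.disjoint_left.2 fun v hvN hvO => ?_
    obtain ⟨e, he, rfl | rfl⟩ := mem_cover.1 hvO
    · exact (Finset.mem_filter.1 he).2 hvN
    · have := hclosed _ hvN
      rw [(hmate.of_mem e (Finset.mem_filter.1 he).1).2] at this
      exact (Finset.mem_filter.1 he).2 this
  have hcover : G.cover M ⊆ (G.cover N).erase r ∪ G.cover O := by
    intro v hv
    obtain ⟨e, he, hev⟩ := mem_cover.1 hv
    rw [Finset.mem_union, Finset.mem_erase]
    by_cases heN : G.fst e ∈ G.cover N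
    · refine Or.inl ⟨?_, ?_⟩
      · rintro rfl
        exact (hmate.mem_cover_iff hrvs).1 hv hexp
      · rcases hev with rfl | rfl
        · exact heN
        · exact (hmate.of_mem e he).1 ▸ hclosed _ heN
    · exact Or.inr (mem_cover.2 ⟨e, Finset.mem_filter.2 ⟨he, heN⟩, hev⟩)
  have hOM : G.IsMatching O := hM.mono (Finset.filter_subset _ _)
  have hNO : G.IsMatching (N ∪ O) := hN.union hOM hO_apart
  refine ⟨N ∪ O, Finset.union_subset hNH ((Finset.filter_subset _ _).trans hMH), hNO, ?_⟩
  have hcard := (Finset.card_le_card hcover).trans (Finset.card_union_le _ _)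
  have herase := Finset.card_erase_lt_of_mem hr
  have hunion : (G.cover (N ∪ O)).card = (G.cover N).card + (G.cover O).card := by
    rw [cover_union, Finset.card_union_of_disjoint hO_apart]
  have := hNO.card_cover
  have := hM.card_cover
  omega

/-- The invariant of the search for a matching in `H` larger than `M`. -/
structure IsSearchForest (G : EdgeColoredGraph V E k) (vs : Finset V) (M H : Finset E)
    (S : SearchState V) : Prop where
  isMate : IsMate G vs M S.mate
  base_mem : ∀ v ∈ vs, S.base v ∈ vs
  base_base : ∀ v ∈ vs, S.base (S.base v) = S.base v
  isOuter_of_base_ne : ∀ v ∈ vs, S.base v ≠ v → S.IsOuter v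
  factorCritical : ∀ b ∈ vs, S.base b = b → G.FactorCritical H (S.blossom vs b)
  base_mate_of_base_ne : ∀ v ∈ vs, S.base v ≠ v → S.base (S.mate v) = S.base v
  base_mate : ∀ v ∈ vs, S.base v = v → S.base (S.mate v) = S.mate v
  exposed : ∀ v ∈ vs, S.mate v = v → S.base v = v ∧ S.status v = 1 ∧ S.depth v = 0
  status_mate_of_outer : ∀ v ∈ vs, S.base v = v → S.status v = 1 → S.mate v ≠ v →
    S.status (S.mate v) = 2
  status_mate_of_inner : ∀ v ∈ vs, S.base v = v → S.status v = 2 → S.status (S.mate v) = 1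
  status_mate_of_free : ∀ v ∈ vs, S.base v = v → S.status v = 0 → S.status (S.mate v) = 0
  parent : ∀ v ∈ vs, S.base v = v → S.status v = 2 →
    S.parent v ∈ vs ∧ S.IsOuter (S.parent v) ∧ (∃ e ∈ H, G.Joins e v (S.parent v)) ∧
      S.depth (S.base (S.parent v)) < S.depth (S.mate v)
  status_le : ∀ v ∈ vs, S.status v ≤ 2

theorem IsMate.isSearchForest {S : SearchState V} (hmate : IsMate G vs M S.mate)
    (hbase : ∀ v ∈ vs, S.base v = v)
    (hstatus : ∀ v ∈ vs, S.status v = if S.mate v = v then 1 else 0)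
    (hdepth : ∀ v ∈ vs, S.depth v = 0) : IsSearchForest G vs M H S where
  isMate := hmate
  base_mem v hv := (hbase v hv).symm ▸ hv
  base_base v hv := by rw [hbase v hv, hbase v hv]
  isOuter_of_base_ne v hv h := absurd (hbase v hv) h
  factorCritical b hb _ := by
    convert factorCritical_singleton b
    ext v
    grind [SearchState.mem_blossom]
  base_mate_of_base_ne v hv h := absurd (hbase v hv) h
  base_mate v hv _ := hbase _ (hmate.mem v hv)
  exposed v hv h := ⟨hbase v hv, by rw [hstatus v hv, if_pos h], hdepth v hv⟩
  status_mate_of_outer v hv := by grind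
  status_mate_of_inner v hv := by grind
  status_mate_of_free v hv := by grind [hmate.mem v hv, hmate.mate_mate v hv]
  parent v hv := by grind
  status_le v hv := by grind

namespace IsSearchForest

variable {S : SearchState V}

theorem base_eq_of_not_isOuter (h : IsSearchForest G vs M H S) {v : V} (hv : v ∈ vs)
    (hv' : ¬ S.IsOuter v) : S.base v = v := by
  by_contra hne
  exact hv' (h.isOuter_of_base_ne v hv hne)

theorem mate_mem (h : IsSearchForest G vs M H S) {v : V} (hv : v ∈ vs) : S.mate v ∈ vs :=
  h.isMate.mem v hv

theorem mate_mate (h : IsSearchForest G vs M H S) {v : V} (hv : v ∈ vs) : S.mate (S.mate v) = v :=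
  h.isMate.mate_mate v hv

theorem mate_eq_self_of_depth_eq_zero (h : IsSearchForest G vs M H S) {v : V} (hv : v ∈ vs)
    (hnode : S.base v = v) (hstatus : S.status v = 1) (hdepth : S.depth v = 0) : S.mate v = v := by
  by_contra hne
  have hinner := h.status_mate_of_outer v hv hnode hstatus hne
  have hlt := (h.parent _ (h.mate_mem hv) (h.base_mate v hv hnode) hinner).2.2.2
  rw [h.mate_mate hv] at hlt
  omega

theorem base_eq_and_status_eq_zero (h : IsSearchForest G vs M H S) {y : V} (hy : y ∈ vs)
    (hfree : S.status (S.base y) = 0) :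
    S.base y = y ∧ S.status y = 0 ∧ S.status (S.mate y) = 0 := by
  have hnode := h.base_eq_of_not_isOuter hy (by simp [SearchState.IsOuter, hfree])
  rw [hnode] at hfree
  exact ⟨hnode, hfree, h.status_mate_of_free y hy hnode hfree⟩

theorem parent_grow (h : IsSearchForest G vs M H S) {e : E} (he : e ∈ H) {x y : V} (hx : x ∈ vs)
    (hy : y ∈ vs) (hjoins : G.Joins e x y) (houter : S.IsOuter x)
    (hfree : S.status (S.base y) = 0) {v : V} (hv : v ∈ vs) (hnode : S.base v = v)
    (hinner : (S.grow x y).status v = 2) :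
    (S.grow x y).parent v ∈ vs ∧ (S.grow x y).IsOuter ((S.grow x y).parent v) ∧
      (∃ e ∈ H, G.Joins e v ((S.grow x y).parent v)) ∧
      (S.grow x y).depth (S.base ((S.grow x y).parent v)) < (S.grow x y).depth (S.mate v) := by
  obtain ⟨-, hy₀, hmy₀⟩ := h.base_eq_and_status_eq_zero hy hfree
  by_cases hvy : v = y
  · subst hvy
    have hparent : (S.grow x v).parent v = x := by simp [SearchState.grow]
    rw [hparent, SearchState.depth_grow_base hmy₀ houter]
    exact ⟨hx, SearchState.isOuter_grow hy₀ houter, ⟨e, he, hjoins.symm⟩,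
      by simp [SearchState.grow]⟩
  · have hmvy : S.mate v ≠ S.mate y := fun heq =>
      hvy (by rw [← h.mate_mate hv, heq, h.mate_mate hy])
    have hparent : (S.grow x y).parent v = S.parent v := by simp [SearchState.grow, hvy]
    have hdepth : (S.grow x y).depth (S.mate v) = S.depth (S.mate v) := by
      simp [SearchState.grow, hmvy]
    have hstatus : S.status v = 2 := by
      simp only [SearchState.grow, Function.update_apply] at hinner
      grind
    obtain ⟨hp, hpo, hedge, hlt⟩ := h.parent v hv hnode hstatus
    rw [hparent, hdepth, SearchState.depth_grow_base hmy₀ hpo]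
    exact ⟨hp, SearchState.isOuter_grow hy₀ hpo, hedge, hlt⟩

theorem grow (h : IsSearchForest G vs M H S) {e : E} (he : e ∈ H) {x y : V} (hx : x ∈ vs)
    (hy : y ∈ vs) (hjoins : G.Joins e x y) (houter : S.IsOuter x)
    (hfree : S.status (S.base y) = 0) : IsSearchForest G vs M H (S.grow x y) := by
  obtain ⟨hnode, hy₀, hmy₀⟩ := h.base_eq_and_status_eq_zero hy hfree
  have hne : S.mate y ≠ y := fun heq => by simp [(h.exposed y hy heq).2.1] at hy₀
  have hmmy := h.mate_mate hy
  constructor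
  case isMate => exact h.isMate
  case base_mem => exact h.base_mem
  case base_base => exact h.base_base
  case isOuter_of_base_ne =>
    exact fun v hv hb => SearchState.isOuter_grow hy₀ (h.isOuter_of_base_ne v hv hb)
  case factorCritical => exact h.factorCritical
  case base_mate_of_base_ne => exact h.base_mate_of_base_ne
  case base_mate => exact h.base_mate
  case exposed =>
    intro v hv hv'
    have := h.exposed v hv hv'
    simp only [SearchState.grow, Function.update_apply]
    grind
  case status_mate_of_outer | status_mate_of_inner | status_mate_of_free =>
    intro v hv hb
    have := h.status_mate_of_outer v hv hb
    have := h.status_mate_of_inner v hv hb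
    have := h.status_mate_of_free v hv hb
    have := h.mate_mate hv
    simp only [SearchState.grow, Function.update_apply]
    grind
  case parent => exact fun v hv => h.parent_grow he hx hy hjoins houter hfree hv
  case status_le =>
    intro v hv
    have := h.status_le v hv
    simp only [SearchState.grow, Function.update_apply]
    grind

end IsSearchForest

variable {S : SearchState V}

/-- The blossoms `a`, `L` and `b` form a walk that consists of two paths in the search forest,
descending to `a` and `b`, and of one further edge in the middle; `L` is a union of pairs of matched
nodes. -/
structure SearchWalk (G : EdgeColoredGraph V E k) (vs : Finset V) (H : Finset E)
    (S : SearchState V) (a : V) (L : List V) (b : V) : Prop where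
  left : a ∈ vs ∧ S.base a = a ∧ S.status a = 1
  right : b ∈ vs ∧ S.base b = b ∧ S.status b = 1
  chain : (a :: (L ++ [b])).IsChain fun u v => G.Linked H (S.blossom vs u) (S.blossom vs v)
  nodup : L.Nodup
  even : Even L.length
  left_notMem : a ∉ L
  right_notMem : b ∉ L
  node : ∀ v ∈ L, v ∈ vs ∧ S.base v = v ∧ S.mate v ≠ v ∧ S.mate v ∈ L
  depth_le : ∀ v ∈ L, S.status v = 1 → S.depth a ≤ S.depth v ∧ S.depth b ≤ S.depth v

namespace SearchWalk

variable {a b : V} {L : List V}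

theorem symm (w : SearchWalk G vs H S a L b) : SearchWalk G vs H S b L.reverse a where
  left := w.right
  right := w.left
  chain := by
    have := (List.isChain_reverse.2 (w.chain.imp fun _ _ h => h.symm))
    simpa [Function.flip_def] using this
  nodup := List.nodup_reverse.2 w.nodup
  even := by simpa using w.even
  left_notMem := by simpa using w.right_notMem
  right_notMem := by simpa using w.left_notMem
  node v hv := by simpa using w.node v (List.mem_reverse.1 hv)
  depth_le v hv hs := (w.depth_le v (List.mem_reverse.1 hv) hs).symm

end SearchWalk

namespace IsSearchForest

theorem searchWalk_nil (h : IsSearchForest G vs M H S) {e : E} (he : e ∈ H) {x y : V}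
    (hx : x ∈ vs) (hy : y ∈ vs) (hjoins : G.Joins e x y) (hxo : S.IsOuter x) (hyo : S.IsOuter y) :
    SearchWalk G vs H S (S.base x) [] (S.base y) where
  left := ⟨h.base_mem x hx, h.base_base x hx, hxo⟩
  right := ⟨h.base_mem y hy, h.base_base y hy, hyo⟩
  chain := by
    simpa using ⟨e, he, x, SearchState.mem_blossom.2 ⟨hx, rfl⟩, y,
      SearchState.mem_blossom.2 ⟨hy, rfl⟩, hjoins⟩
  nodup := List.nodup_nil
  even := Even.zero
  left_notMem := List.not_mem_nil
  right_notMem := List.not_mem_nil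
  node v hv := absurd hv List.not_mem_nil
  depth_le v hv := absurd hv List.not_mem_nil

theorem searchWalk_climb (h : IsSearchForest G vs M H S) (hMH : M ⊆ H) {a b : V} {L : List V}
    (w : SearchWalk G vs H S a L b) (hab : a ≠ b) (hdepth : S.depth b ≤ S.depth a)
    (hroot : S.mate a ≠ a) :
    SearchWalk G vs H S (S.base (S.parent (S.mate a))) (S.mate a :: a :: L) b := by
  obtain ⟨ha, hanode, houter⟩ := w.left
  have hm := h.mate_mem ha
  have hmm := h.mate_mate ha
  have hmnode := h.base_mate a ha hanode
  have hinner := h.status_mate_of_outer a ha hanode houter hroot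
  obtain ⟨hp, hpo, ⟨e, he, hep⟩, hlt⟩ := h.parent _ hm hmnode hinner
  rw [hmm] at hlt
  obtain ⟨f, hf, hfa⟩ := h.isMate.joins a ha hroot
  have hmL : S.mate a ∉ L := fun hmem => w.left_notMem (hmm ▸ (w.node _ hmem).2.2.2)
  have hstatus_b := w.right.2.2
  refine ⟨⟨h.base_mem _ hp, h.base_base _ hp, hpo⟩, w.right, ?_, ?_, ?_, ?_, ?_, ?_, ?_⟩
  · have hma := SearchState.mem_blossom_self hm hmnode
    exact .cons_cons ⟨e, he, _, SearchState.mem_blossom.2 ⟨hp, rfl⟩, _, hma, hep.symm⟩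
      (.cons_cons ⟨f, hMH hf, _, hma, _, SearchState.mem_blossom_self ha hanode, hfa.symm⟩ w.chain)
  · simp [hroot, hmL, w.left_notMem, w.nodup]
  · simpa [Nat.even_add_one] using w.even
  · simp only [List.mem_cons, not_or]
    refine ⟨fun heq => ?_, fun heq => ?_, fun hmem => ?_⟩
    · have := hpo
      rw [SearchState.IsOuter, heq] at this
      omega
    · rw [heq] at hlt
      exact lt_irrefl _ hlt
    · have := (w.depth_le _ hmem hpo).1
      omega
  · simp only [List.mem_cons, not_or]
    refine ⟨fun heq => ?_, hab.symm, w.right_notMem⟩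
    rw [heq] at hstatus_b
    omega
  · have := w.node
    grind
  · have := w.depth_le
    grind

theorem base_merge_eq_self_iff {b : V} {L : List V} (w : SearchWalk G vs H S b L b) {v : V}
    (hv : v ∈ vs) : (S.merge vs L b).base v = v ↔ S.base v = v ∧ v ∉ L := by
  have := w.left.2.1
  have := w.left_notMem
  have := fun v hv => (w.node v hv).2.1
  simp only [SearchState.merge]
  grind

theorem isOuter_merge {b : V} {L : List V} (w : SearchWalk G vs H S b L b) {v : V}
    (hv : S.IsOuter v) : (S.merge vs L b).IsOuter v := by
  simp only [SearchState.IsOuter, SearchState.merge]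
  split
  exacts [w.left.2.2, hv]

theorem factorCritical_blossom_merge (h : IsSearchForest G vs M H S) {b : V} {L : List V}
    (w : SearchWalk G vs H S b L b) {c : V} (hc : c ∈ vs) (hnode : S.base c = c) (hcL : c ∉ L) :
    G.FactorCritical H ((S.merge vs L b).blossom vs c) := by
  by_cases hcb : c = b
  · rw [hcb, SearchState.blossom_merge_self]
    refine factorCritical_biUnion_of_cycle (S.pairwise_disjoint_blossom vs) (fun v hv => ?_)
      w.chain (List.nodup_cons.2 ⟨w.left_notMem, w.nodup⟩) w.even
    rcases List.mem_cons.1 hv with rfl | hv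
    · exact h.factorCritical v w.left.1 w.left.2.1
    · exact h.factorCritical v (w.node v hv).1 (w.node v hv).2.1
  · rw [SearchState.blossom_merge_of_ne hcb hcL]
    exact h.factorCritical c hc hnode

theorem base_merge_mate (h : IsSearchForest G vs M H S) {b : V} {L : List V}
    (w : SearchWalk G vs H S b L b) {v : V} (hv : v ∈ vs) (hne : (S.merge vs L b).base v ≠ v) :
    (S.merge vs L b).base (S.mate v) = (S.merge vs L b).base v := by
  simp only [SearchState.merge, hv, h.mate_mem hv]
  by_cases hold : S.base v = v
  · have hvL : v ∈ L := by
      simpa [hold] using mt (base_merge_eq_self_iff w hv).2 hne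
    rw [h.base_mate v hv hold, hold, if_pos (by simpa using (w.node v hvL).2.2.2),
      if_pos (by simpa using hvL)]
  · rw [h.base_mate_of_base_ne v hv hold]

theorem depth_base_merge_le {b : V} {L : List V} (w : SearchWalk G vs H S b L b) {v : V}
    (hv : S.IsOuter v) : S.depth ((S.merge vs L b).base v) ≤ S.depth (S.base v) := by
  have := fun hmem => (w.depth_le _ hmem hv).1
  grind [SearchState.merge]

theorem merge (h : IsSearchForest G vs M H S) {b : V} {L : List V} (w : SearchWalk G vs H S b L b) :
    IsSearchForest G vs M H (S.merge vs L b) := by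
  have hbase : ∀ v ∈ vs, (S.merge vs L b).base v = if S.base v ∈ L then b else S.base v :=
    fun v hv => by simp [SearchState.merge, hv]
  have hnode := fun v (hv : v ∈ vs) => base_merge_eq_self_iff w hv
  have hleft := w.left
  constructor
  case isMate => exact h.isMate
  case base_mem | base_base =>
    have := h.base_mem
    have := h.base_base
    grind
  case isOuter_of_base_ne =>
    intro v hv hne
    by_cases hold : S.base v = v
    · rw [SearchState.IsOuter, hbase v hv, hold, if_pos (by grind)]
      exact hleft.2.2
    · exact isOuter_merge w (h.isOuter_of_base_ne v hv hold)
  case factorCritical =>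
    intro c hc hc'
    obtain ⟨hold, hcL⟩ := (hnode c hc).1 hc'
    exact h.factorCritical_blossom_merge w hc hold hcL
  case base_mate_of_base_ne => exact fun v hv => h.base_merge_mate w hv
  case base_mate =>
    intro v hv hv'
    obtain ⟨hold, hvL⟩ := (hnode v hv).1 hv'
    refine (hnode _ (h.mate_mem hv)).2 ⟨h.base_mate v hv hold, fun hmem => hvL ?_⟩
    exact h.mate_mate hv ▸ (w.node _ hmem).2.2.2
  case exposed =>
    intro v hv hexp
    have := h.exposed v hv hexp
    have := fun v hv => (w.node v hv).2
    simp only [hnode v hv]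
    grind [SearchState.merge]
  case status_mate_of_outer =>
    exact fun v hv hv' => h.status_mate_of_outer v hv ((hnode v hv).1 hv').1
  case status_mate_of_inner =>
    exact fun v hv hv' => h.status_mate_of_inner v hv ((hnode v hv).1 hv').1
  case status_mate_of_free =>
    exact fun v hv hv' => h.status_mate_of_free v hv ((hnode v hv).1 hv').1
  case parent =>
    intro v hv hv' hs
    obtain ⟨hp, hpo, hedge, hlt⟩ := h.parent v hv ((hnode v hv).1 hv').1 hs
    exact ⟨hp, isOuter_merge w hpo, hedge, (depth_base_merge_le w hpo).trans_lt hlt⟩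
  case status_le => exact h.status_le

theorem hasLargerMatching (h : IsSearchForest G vs M H S) (hM : G.IsMatching M) (hMH : M ⊆ H)
    {a b : V} {L : List V} (w : SearchWalk G vs H S a L b) (hab : a ≠ b) (ha : S.mate a = a)
    (hb : S.mate b = b) : G.HasLargerMatching M H := by
  set K := a :: (L ++ [b]) with hK
  have hnode : ∀ v ∈ K, v ∈ vs ∧ S.base v = v ∧ S.mate v ∈ K := by
    have := w.node
    have := w.left
    have := w.right
    grind
  have hperfect : G.PerfectOn H (K.toFinset.biUnion (S.blossom vs)) := by
    refine perfectOn_biUnion_of_isChain (S.pairwise_disjoint_blossom vs)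
      (fun v hv => h.factorCritical v (hnode v hv).1 (hnode v hv).2.1) w.chain ?_ ?_
    · have := w.nodup
      have := w.left_notMem
      have := w.right_notMem
      grind
    · have := w.even
      grind
  refine h.isMate.hasLargerMatching hM hMH hperfect (fun v hv => ?_) (r := a) ?_ ha w.left.1
  · obtain ⟨c, hc, hvc⟩ := Finset.mem_biUnion.1 hv
    obtain ⟨hvs, rfl⟩ := SearchState.mem_blossom.1 hvc
    rw [List.mem_toFinset] at hc
    refine Finset.mem_biUnion.2 ⟨S.base (S.mate v), ?_,
      SearchState.mem_blossom.2 ⟨h.mate_mem hvs, rfl⟩⟩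
    rw [List.mem_toFinset]
    by_cases hv : S.base v = v
    · rw [h.base_mate v hvs hv]
      exact (hnode v (hv ▸ hc)).2.2
    · rwa [h.base_mate_of_base_ne v hvs hv]
  · exact Finset.mem_biUnion.2 ⟨a, by simp [hK], SearchState.mem_blossom_self w.left.1 w.left.2.1⟩

theorem card_outer_le (h : IsSearchForest G vs M H S) {N : Finset E} (hN : G.IsMatching N)
    (hmem : ∀ e ∈ N, ∀ x y, G.Joins e x y → y ∈ vs)
    (hstuck : ∀ e ∈ N, ∀ x y, G.Joins e x y → S.IsOuter x →
      S.base x = S.base y ∨ S.status (S.base y) = 2) :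
    (vs.filter fun v => S.base v = v ∧ S.status v = 1).card ≤
      (vs \ G.cover N).card + (vs.filter fun v => S.base v = v ∧ S.status v = 2).card := by
  classical
  refine le_trans ?_ (Finset.card_union_le _ _)
  refine Finset.card_le_card_of_forall_subsingleton
    (fun b v => S.base v = b ∨ ∃ e ∈ N, ∃ u, G.Joins e u v ∧ S.base u = b) ?_ ?_
  · intro b hb
    obtain ⟨hbvs, hnode, houter⟩ : b ∈ vs ∧ S.base b = b ∧ S.status b = 1 := by simpa using hb
    have hodd := (h.factorCritical b hbvs hnode).odd_card
      ⟨b, SearchState.mem_blossom_self hbvs hnode⟩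
    rcases hN.exists_of_odd_card hodd with ⟨v, hv, hexp⟩ | ⟨e, he, u, hu, v, hv, huv⟩
    · rw [SearchState.mem_blossom] at hv
      exact ⟨v, by simp [hv.1, hexp], Or.inl hv.2⟩
    · rw [SearchState.mem_blossom] at hu hv
      have hvvs := hmem e he u v huv
      refine ⟨v, ?_, Or.inr ⟨e, he, u, huv, hu.2⟩⟩
      have hinner : S.status (S.base v) = 2 :=
        (hstuck e he u v huv (by rw [SearchState.IsOuter, hu.2, houter])).resolve_left
          fun heq => hv ⟨hvvs, by rw [← heq, hu.2]⟩
      have hvnode : S.base v = v :=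
        h.base_eq_of_not_isOuter hvvs (by simp [SearchState.IsOuter, hinner])
      rw [hvnode] at hinner
      simp [hvvs, hvnode, hinner]
  · intro v hv b ⟨hb, hbv⟩ c ⟨hc, hcv⟩
    have hunique : ∀ e ∈ N, ∀ u, G.Joins e u v → ∀ f ∈ N, ∀ u', G.Joins f u' v → u = u' := by
      intro e he u hu f hf u' hu'
      have := hN v e he f hf (hu.incident_iff.2 (Or.inr rfl)) (hu'.incident_iff.2 (Or.inr rfl))
      subst this
      unfold Joins at hu hu'
      grind
    have hcovered : (∃ e ∈ N, ∃ u, G.Joins e u v) → v ∈ G.cover N := fun ⟨e, he, u, hu⟩ =>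
      mem_cover.2 ⟨e, he, hu.incident_iff.2 (Or.inr rfl)⟩
    simp only [Finset.mem_union, Finset.mem_sdiff, Finset.mem_filter] at hv hb hc
    grind

/-- If every edge leaving an outer blossom leads to an inner vertex, the search has failed and the
deficiency version of Berge's inequality certifies that `M` is maximum. -/
theorem card_le_of_stuck (h : IsSearchForest G vs M H S) (hM : G.IsMatching M) (hMH : M ⊆ H)
    (hH : ∀ e ∈ H, G.fst e ∈ vs ∧ G.snd e ∈ vs)
    (hstuck : ∀ e ∈ H, ∀ x y, G.Joins e x y → S.IsOuter x →
      S.base x = S.base y ∨ S.status (S.base y) = 2) {N : Finset E} (hNH : N ⊆ H)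
    (hN : G.IsMatching N) : N.card ≤ M.card := by
  have houter := h.card_outer_le hN (fun e he x y hxy => by
      rcases hxy with ⟨-, rfl⟩ | ⟨rfl, -⟩
      exacts [(hH e (hNH he)).2, (hH e (hNH he)).1])
    fun e he => hstuck e (hNH he)
  have hsub : (vs.filter fun v => S.base v = v ∧ S.status v = 2) ∪ (vs \ G.cover M) ⊆ vs :=
    Finset.union_subset (Finset.filter_subset _ _) Finset.sdiff_subset
  have hinner : ((vs.filter fun v => S.base v = v ∧ S.status v = 2) ∪ (vs \ G.cover M)).card ≤
      (vs.filter fun v => S.base v = v ∧ S.status v = 1).card := by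
    refine Finset.card_le_card_of_injOn S.mate (fun v hv => ?_) (fun u hu v hv huv => ?_)
    · rcases Finset.mem_union.1 hv with hv | hv
      · obtain ⟨hvs, hnode, hstatus⟩ := Finset.mem_filter.1 hv
        simp [h.mate_mem hvs, h.base_mate v hvs hnode, h.status_mate_of_inner v hvs hnode hstatus]
      · obtain ⟨hvs, hexp⟩ := Finset.mem_sdiff.1 hv
        have hroot : S.mate v = v := by simpa [h.isMate.mem_cover_iff hvs] using hexp
        simp [hroot, hvs, h.exposed v hvs hroot]
    · rw [← h.mate_mate (hsub hu), huv, h.mate_mate (hsub hv)]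
  rw [Finset.card_union_of_disjoint] at hinner
  · have := Finset.card_sdiff_add_card_eq_card (cover_subset hH hMH)
    have := Finset.card_sdiff_add_card_eq_card (cover_subset hH hNH)
    rw [hM.card_cover] at *
    rw [hN.card_cover] at *
    omega
  · refine Finset.disjoint_left.2 fun v hv hexp => ?_
    obtain ⟨hvs, -, hstatus⟩ := Finset.mem_filter.1 hv
    have hroot : S.mate v = v := by
      simpa [h.isMate.mem_cover_iff hvs, hvs] using hexp
    have := (h.exposed v hvs hroot).2.1
    omega

end IsSearchForest

end Search

end EdgeColoredGraph

/-! ### Counting loops -/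

namespace Ram

theorem Store.write_self (s : Store) (a i x : ℕ) :
    s.write a i x a = Function.update (s a) i x := by
  simp [Store.write]

theorem Store.write_of_ne (s : Store) {a b : ℕ} (i x : ℕ) (h : b ≠ a) :
    s.write a i x b = s b := by
  simp [Store.write, h]

attribute [simp] Expr.eval Store.write_self Store.write_of_ne

namespace Expr

/-- The value of a scalar, stored in cell `0` of its own array. -/
abbrev var (a : ℕ) : Expr := .read a (.const 0)

/-- Negation of a truth value; truth is represented by `1` and falsehood by `0`. -/
def not (x : Expr) : Expr := .sub (.const 1) x

/-- The truth value of `x ≤ y`. -/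
def le (x y : Expr) : Expr := not (.sub x y)

/-- The truth value of `x = y`. -/
def eq (x y : Expr) : Expr := not (.add (.sub x y) (.sub y x))

/-- Conjunction of truth values. -/
def and (x y : Expr) : Expr := not (.add (not x) (not y))

@[simp] theorem eval_not (s : Store) (x : Expr) :
    x.not.eval s = if x.eval s = 0 then 1 else 0 := by
  simp only [not, eval]
  split_ifs <;> omega

@[simp] theorem eval_le (s : Store) (x y : Expr) :
    (x.le y).eval s = if x.eval s ≤ y.eval s then 1 else 0 := by
  simp only [le, eval_not, eval, Nat.sub_eq_zero_iff_le]

@[simp] theorem eval_eq (s : Store) (x y : Expr) :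
    (x.eq y).eval s = if x.eval s = y.eval s then 1 else 0 := by
  simp only [eq, eval_not, eval]
  exact if_congr (by omega) rfl rfl

@[simp] theorem eval_and (s : Store) (x y : Expr) :
    (x.and y).eval s = if x.eval s ≠ 0 ∧ y.eval s ≠ 0 then 1 else 0 := by
  simp only [and, eval_not, eval]
  split_ifs <;> simp_all

end Expr

/-- Programs all of whose loops are counting loops: `loop c b p` runs `p` with the values
`0, 1, …` of the counter in cell `0` of array `c`, as many times as cell `b` of array `0` says. -/
inductive Cmd where
  | skip
  | write (a : ℕ) (i x : Expr)
  | seq (p q : Cmd)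
  | ite (b : Expr) (p q : Cmd)
  | loop (c b : ℕ) (p : Cmd)

namespace Cmd

/-- The store before the `i`-th iteration of a counting loop with body `f`. -/
def iterate (f : Store → Store) (c : ℕ) (s : Store) : ℕ → Store
  | 0 => s.write c 0 0
  | i + 1 => (f (iterate f c s i)).write c 0 (i + 1)

/-- The store after running a program. -/
def run : Cmd → Store → Store
  | skip, s => s
  | write a i x, s => s.write a (i.eval s) (x.eval s)
  | seq p q, s => q.run (p.run s)
  | ite b p q, s => if b.eval s ≠ 0 then p.run s else q.run s
  | loop c b p, s => iterate p.run c s (s 0 b)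

/-- The arrays to which a program writes. -/
def writes : Cmd → List ℕ
  | skip => []
  | write a _ _ => [a]
  | seq p q => p.writes ++ q.writes
  | ite _ p q => p.writes ++ q.writes
  | loop c _ p => c :: p.writes

/-- Loop bounds and active loop counters are not written to. -/
def WF : Cmd → Prop
  | skip => True
  | write a _ _ => a ≠ 0
  | seq p q => p.WF ∧ q.WF
  | ite _ p q => p.WF ∧ q.WF
  | loop c _ p => c ≠ 0 ∧ c ∉ p.writes ∧ p.WF

instance decidableWF : ∀ p : Cmd, Decidable p.WF
  | .skip => isTrue trivial
  | .write a _ _ => inferInstanceAs (Decidable (a ≠ 0))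
  | .seq p q => @instDecidableAnd _ _ (decidableWF p) (decidableWF q)
  | .ite _ p q => @instDecidableAnd _ _ (decidableWF p) (decidableWF q)
  | .loop c _ p => @instDecidableAnd _ _ (inferInstanceAs (Decidable (c ≠ 0)))
      (@instDecidableAnd _ _ (inferInstanceAs (Decidable (c ∉ p.writes))) (decidableWF p))

/-- The translation of the body of a counting loop together with its test. -/
def compileLoop (c b : ℕ) (p : Program) : Program :=
  .loop (.sub (.read 0 (.const b)) (.var c))
    (.seq p (.write c (.const 0) (.add (.var c) (.const 1))))

/-- The translation to programs of the random access machine. -/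
def compile : Cmd → Program
  | skip => .skip
  | write a i x => .write a i x
  | seq p q => .seq p.compile q.compile
  | ite b p q => .branch b p.compile q.compile
  | loop c b p => .seq (.write c (.const 0) (.const 0)) (compileLoop c b p.compile)

/-- A bound on the running time in terms of a bound on the contents of array `0`. -/
noncomputable def time : Cmd → Polynomial ℕ
  | skip => 1
  | write _ i x => .C (i.cost + x.cost + 1)
  | seq p q => p.time + q.time
  | ite b p q => .C (b.cost + 1) + p.time + q.time
  | loop _ _ p => 9 + .X * (p.time + 12)

theorem iterate_of_ne {f : Store → Store} {c a : ℕ} {s : Store} (hac : a ≠ c)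
    (hf : ∀ s, f s a = s a) (i : ℕ) : iterate f c s i a = s a := by
  induction i with
  | zero => simp [iterate, hac]
  | succ i ih => simp [iterate, hac, hf, ih]

theorem iterate_counter {f : Store → Store} {c : ℕ} {s : Store} (i : ℕ) :
    iterate f c s i c 0 = i := by
  cases i <;> simp [iterate]

theorem run_of_notMem {p : Cmd} {a : ℕ} (h : a ∉ p.writes) (s : Store) : p.run s a = s a := by
  induction p generalizing s with
  | skip => rfl
  | write b i x => simp_all [writes, run]
  | seq p q hp hq => simp_all [writes, run]
  | ite b p q hp hq =>
    simp only [writes, List.mem_append, not_or] at h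
    simp only [run]
    split_ifs
    exacts [hp h.1 s, hq h.2 s]
  | loop c b p hp =>
    simp only [writes, List.mem_cons, not_or] at h
    exact iterate_of_ne h.1 (hp h.2) _

theorem WF.zero_notMem_writes {p : Cmd} (h : p.WF) : 0 ∉ p.writes := by
  induction p with
  | skip => simp [writes]
  | write b i x => simp_all [writes, WF, eq_comm]
  | seq p q hp hq => simp_all [writes, WF]
  | ite b p q hp hq => simp_all [writes, WF]
  | loop c b p hp => simp_all [writes, WF, eq_comm]

theorem exec_compileLoop {c b : ℕ} {p : Cmd} (hwf : (loop c b p).WF) {T : ℕ} {s : Store}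
    (hp : ∀ s', s' 0 = s 0 → ∃ t ≤ T, Exec p.compile s' t (p.run s')) :
    ∀ r i, i + r = s 0 b → ∃ t ≤ 6 + r * (T + 12),
      Exec (compileLoop c b p.compile) (iterate p.run c s i) t (iterate p.run c s (s 0 b)) := by
  obtain ⟨hc, hcp, hwf⟩ := hwf
  have hzero : ∀ i, iterate p.run c s i 0 = s 0 :=
    iterate_of_ne hc.symm (run_of_notMem hwf.zero_notMem_writes)
  intro r
  induction r with
  | zero =>
    rintro i rfl
    refine ⟨_, ?_, Exec.loop_false ?_⟩
    · simp [Expr.cost]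
    · simp [iterate_counter, hzero]
  | succ r ih =>
    intro i hi
    obtain ⟨t', ht', hrest⟩ := ih (i + 1) (by omega)
    obtain ⟨t, ht, hbody⟩ := hp (iterate p.run c s i) (hzero i)
    have hcount := Exec.write c (.const 0) (.add (.var c) (.const 1)) (p.run (iterate p.run c s i))
    simp only [Expr.eval, run_of_notMem hcp, iterate_counter] at hcount
    refine ⟨_, ?_, .loop_true ?_ (.seq hbody hcount) hrest⟩
    · simp only [Expr.cost]
      rw [add_mul]
      omega
    · simp only [Expr.eval, iterate_counter, hzero]
      omega

theorem exec {p : Cmd} (h : p.WF) {B : ℕ} {s : Store} (hs : ∀ b, s 0 b ≤ B) :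
    ∃ t ≤ p.time.eval B, Exec p.compile s t (p.run s) := by
  induction p generalizing s with
  | skip => exact ⟨1, by simp [time], .skip s⟩
  | write b i x => exact ⟨_, by simp [time], .write b i x s⟩
  | seq p q hp hq =>
    obtain ⟨t, ht, hp⟩ := hp h.1 hs
    obtain ⟨t', ht', hq⟩ := hq h.2 (s := p.run s)
      (by rwa [run_of_notMem h.1.zero_notMem_writes])
    exact ⟨_, by simpa [time] using add_le_add ht ht', .seq hp hq⟩
  | ite b p q hp hq =>
    by_cases hb : b.eval s = 0
    · obtain ⟨t, ht, hq⟩ := hq h.2 hs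
      have := Exec.branch_false (p := p.compile) hb hq
      refine ⟨_, ?_, by simpa [run, compile, hb] using this⟩
      simp only [time, Polynomial.eval_add, Polynomial.eval_C]
      omega
    · obtain ⟨t, ht, hp⟩ := hp h.1 hs
      have := Exec.branch_true (q := q.compile) hb hp
      refine ⟨_, ?_, by simpa [run, compile, hb] using this⟩
      simp only [time, Polynomial.eval_add, Polynomial.eval_C]
      omega
  | loop c b p hp =>
    obtain ⟨t, ht, hloop⟩ := exec_compileLoop h (s := s)
      (fun s' hs' => hp h.2.2 (s := s') (by rwa [hs'])) (s 0 b) 0 (by omega)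
    refine ⟨_, ?_, .seq (.write c (.const 0) (.const 0) s) hloop⟩
    have := Nat.mul_le_mul_right (p.time.eval B + 12) (hs b)
    simp only [time, Expr.cost, Polynomial.eval_add, Polynomial.eval_mul, Polynomial.eval_X,
      Polynomial.eval_ofNat]
    omega

section LoopRules

variable {c b : ℕ} {p : Cmd} {s : Store}

theorem run_loop (I : ℕ → Store → Prop) (h0 : I 0 (s.write c 0 0))
    (hstep : ∀ i s', i < s 0 b → s' c 0 = i → (∀ a ∉ (loop c b p).writes, s' a = s a) →
      I i s' → I (i + 1) ((p.run s').write c 0 (i + 1))) :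
    I (s 0 b) ((loop c b p).run s) := by
  have key : ∀ i ≤ s 0 b, I i (iterate p.run c s i) := by
    intro i
    induction i with
    | zero => exact fun _ => h0
    | succ i ih =>
      intro hi
      refine hstep i _ hi (iterate_counter i) (fun a ha => ?_) (ih (by omega))
      simp only [writes, List.mem_cons, not_or] at ha
      exact iterate_of_ne ha.1 (run_of_notMem ha.2) i
  exact key _ le_rfl

/-- A loop whose `i`-th iteration writes at most to cell `i` of the array `a`. -/
theorem run_loop_apply {a : ℕ} (f : ℕ → ℕ) (hac : a ≠ c)
    (hstep : ∀ s', s' c 0 < s 0 b → (∀ d ∉ (loop c b p).writes, s' d = s d) →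
      s' a (s' c 0) = s a (s' c 0) →
      p.run s' a = Function.update (s' a) (s' c 0) (f (s' c 0))) (j : ℕ) :
    (loop c b p).run s a j = if j < s 0 b then f j else s a j := by
  refine run_loop (fun i s' => ∀ j, s' a j = if j < i then f j else s a j) (by simp [hac]) ?_ j
  rintro i s' hi rfl hframe hinv j
  rw [Store.write_of_ne _ _ _ hac, hstep s' hi hframe (by simp [hinv]), Function.update_apply]
  grind

/-- A loop that makes progress until it has reached its goal. -/
theorem run_loop_until (I Q : Store → Prop) (potential : Store → ℕ) (h0 : I (s.write c 0 0))
    (hbound : potential (s.write c 0 0) < s 0 b)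
    (hstep : ∀ i s', (∀ a ∉ (loop c b p).writes, s' a = s a) → I s' →
      Q ((p.run s').write c 0 i) ∨
        I ((p.run s').write c 0 i) ∧ potential ((p.run s').write c 0 i) < potential s')
    (hdone : ∀ i s', (∀ a ∉ (loop c b p).writes, s' a = s a) → Q s' →
      Q ((p.run s').write c 0 i)) :
    Q ((loop c b p).run s) := by
  have := run_loop (c := c) (b := b) (p := p) (s := s)
    (fun i s' => Q s' ∨ I s' ∧ potential s' + i ≤ potential (s.write c 0 0))
    (Or.inr ⟨h0, le_rfl⟩) ?_
  · exact this.resolve_right fun h => by have := h.2; omega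
  · rintro i s' - - hframe (hQ | h)
    · exact Or.inl (hdone _ s' hframe hQ)
    · refine (hstep (i + 1) s' hframe h.1).imp_right fun h' => ⟨h'.1, ?_⟩
      have := h.2
      have := h'.2
      omega

end LoopRules

end Cmd

end Ram

/-! ### The search program -/

namespace Ram

/- The arrays of the search program. Cells `0`, `1`, `2` of array `0` hold the numbers of vertices,
edges and rounds. -/
notation "VERTICES" => 0
notation "EDGES" => 1
notation "ROUNDS" => 2

notation "FST" => 1
notation "SND" => 2
notation "COLOR" => 3

notation "MAT" => 7
notation "SUB" => 8

notation "MATE" => 10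
notation "BASE" => 11
notation "PARENT" => 12
notation "STATUS" => 13
notation "DEPTH" => 14
notation "MARK" => 15

notation "SOURCE" => 16
notation "TARGET" => 17
notation "LEFT" => 18
notation "RIGHT" => 19
notation "LARGER" => 20

notation "VTX" => 30
notation "STEP" => 31
notation "EDGE" => 32
notation "SWEEP" => 33

notation:65 p:66 ";;" q:65 => Cmd.seq p q

open EdgeColoredGraph

/-- The state of the search for a larger matching. -/
def Store.search (s : Store) : SearchState ℕ := ⟨s MATE, s BASE, s PARENT, s STATUS, s DEPTH⟩

namespace Cmd

/-- Move the outer node `p` of the walk to the next outer node towards its root. -/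
def climb (p : ℕ) : Cmd :=
  .write MARK (.var p) (.const 1) ;;
  .write MARK (.read MATE (.var p)) (.const 1) ;;
  .write p (.const 0) (.read BASE (.read PARENT (.read MATE (.var p))))

/-- Move the deeper end of the walk, unless the walk is closed or the end is a root. -/
def climbDeeper : Cmd :=
  .ite (.eq (.var LEFT) (.var RIGHT)) .skip
    (.ite (.le (.read DEPTH (.var RIGHT)) (.read DEPTH (.var LEFT)))
      (.ite (.eq (.read MATE (.var LEFT)) (.var LEFT)) .skip (climb LEFT))
      (.ite (.eq (.read MATE (.var RIGHT)) (.var RIGHT)) .skip (climb RIGHT)))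

/-- Extend the walk until it is closed or connects two roots. -/
def walk : Cmd := .loop STEP ROUNDS climbDeeper

/-- Remove the marks left by the previous walk. -/
def clearMarks : Cmd := .loop VTX VERTICES (.write MARK (.var VTX) (.const 0))

/-- Shrink the closed walk through `LEFT`. -/
def shrink : Cmd :=
  .loop VTX VERTICES
    (.ite (.read MARK (.read BASE (.var VTX))) (.write BASE (.var VTX) (.var LEFT)) .skip)

/-- Handle an edge between two outer blossoms. -/
def blossom : Cmd :=
  clearMarks ;;
  .write LEFT (.const 0) (.read BASE (.var SOURCE)) ;;
  .write RIGHT (.const 0) (.read BASE (.var TARGET)) ;;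
  walk ;;
  .ite (.eq (.var LEFT) (.var RIGHT)) shrink (.write LARGER (.const 0) (.const 1))

/-- Handle an edge from an outer to a free vertex. -/
def grow : Cmd :=
  .write PARENT (.var TARGET) (.var SOURCE) ;;
  .write STATUS (.var TARGET) (.const 2) ;;
  .write STATUS (.read MATE (.var TARGET)) (.const 1) ;;
  .write DEPTH (.read MATE (.var TARGET))
    (.add (.read DEPTH (.read BASE (.var SOURCE))) (.const 1))

/-- Handle the edge from `SOURCE` to `TARGET`. -/
def extend : Cmd :=
  .ite (.and (.not (.var LARGER)) (.eq (.read STATUS (.read BASE (.var SOURCE))) (.const 1)))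
    (.ite (.eq (.read STATUS (.read BASE (.var TARGET))) (.const 0)) grow
      (.ite (.and (.eq (.read STATUS (.read BASE (.var TARGET))) (.const 1))
          (.not (.eq (.read BASE (.var SOURCE)) (.read BASE (.var TARGET)))))
        blossom .skip))
    .skip

/-- Handle the edge `EDGE` in both directions. -/
def scanEdge : Cmd :=
  .ite (.read SUB (.var EDGE))
    (.write SOURCE (.const 0) (.read FST (.var EDGE)) ;;
     .write TARGET (.const 0) (.read SND (.var EDGE)) ;;
     extend ;;
     .write SOURCE (.const 0) (.read SND (.var EDGE)) ;;
     .write TARGET (.const 0) (.read FST (.var EDGE)) ;;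
     extend)
    .skip

/-- One round of the search: handle all edges in `SUB`. -/
def sweep : Cmd := .loop EDGE EDGES scanEdge

/-- Make every vertex exposed and a blossom of its own. -/
def resetVertices : Cmd :=
  .loop VTX VERTICES
    (.write MATE (.var VTX) (.var VTX) ;;
     .write BASE (.var VTX) (.var VTX) ;;
     .write DEPTH (.var VTX) (.const 0))

/-- Write the edges of the matching `MAT` to the array `MATE`. -/
def loadMates : Cmd :=
  .loop EDGE EDGES
    (.ite (.read MAT (.var EDGE))
      (.write MATE (.read FST (.var EDGE)) (.read SND (.var EDGE)) ;;
       .write MATE (.read SND (.var EDGE)) (.read FST (.var EDGE)))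
      .skip)

/-- Make the exposed vertices outer and all other vertices free. -/
def markRoots : Cmd :=
  .loop VTX VERTICES (.write STATUS (.var VTX) (.eq (.read MATE (.var VTX)) (.var VTX)))

/-- Set up the search forest in which the vertices exposed by the matching `MAT` are the roots. -/
def initSearch : Cmd :=
  resetVertices ;; loadMates ;; markRoots ;; .write LARGER (.const 0) (.const 0)

/-- Decide whether some matching in `SUB` is larger than the matching `MAT`. -/
def search : Cmd := initSearch ;; .loop SWEEP ROUNDS sweep

section Walk

variable {m k : ℕ} {G : EdgeColoredGraph ℕ (Fin m) k} {n : ℕ} {M H : Finset (Fin m)} {s : Store}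
  {p q : ℕ}

/-- A nontrivial walk of the search forest, given by its ends and the marks on its other nodes. -/
def HasWalk (G : EdgeColoredGraph ℕ (Fin m) k) (n : ℕ) (H : Finset (Fin m)) (p q : ℕ)
    (s : Store) : Prop :=
  ∃ L, SearchWalk G (Finset.range n) H s.search (s p 0) L (s q 0) ∧
    (L = [] → s p 0 ≠ s q 0) ∧ ∀ v ∈ Finset.range n, s MARK v ≠ 0 ↔ v ∈ L

theorem HasWalk.symm (h : HasWalk G n H p q s) : HasWalk G n H q p s := by
  obtain ⟨L, w, hnil, hmark⟩ := h
  exact ⟨L.reverse, w.symm, fun h => (hnil (List.reverse_eq_nil_iff.1 h)).symm,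
    fun v hv => by rw [hmark v hv, List.mem_reverse]⟩

/-- The number of vertices that the walk has not met. -/
def unmarked (n : ℕ) (s : Store) : ℕ := ((Finset.range n).filter (s MARK · = 0)).card

theorem search_run_climb (hp : p = LEFT ∨ p = RIGHT) : ((climb p).run s).search = s.search := by
  rcases hp with rfl | rfl <;> simp [climb, run, Store.search]

theorem run_climb (hS : IsSearchForest G (Finset.range n) M H s.search) (hMH : M ⊆ H)
    (hpq : p = LEFT ∧ q = RIGHT ∨ p = RIGHT ∧ q = LEFT) (hwalk : HasWalk G n H p q s)
    (hne : s p 0 ≠ s q 0) (hdepth : s DEPTH (s q 0) ≤ s DEPTH (s p 0))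
    (hroot : s MATE (s p 0) ≠ s p 0) :
    HasWalk G n H p q ((climb p).run s) ∧ unmarked n ((climb p).run s) < unmarked n s := by
  obtain ⟨L, w, -, hmark⟩ := hwalk
  have hp : s p 0 ∈ Finset.range n := w.left.1
  have hmark' : ((climb p).run s) MARK =
      Function.update (Function.update (s MARK) (s p 0) 1) (s MATE (s p 0)) 1 := by
    rcases hpq with ⟨rfl, rfl⟩ | ⟨rfl, rfl⟩ <;> simp [climb, run]
  have hend : ((climb p).run s) p 0 = s BASE (s PARENT (s MATE (s p 0))) ∧
      ((climb p).run s) q 0 = s q 0 := by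
    rcases hpq with ⟨rfl, rfl⟩ | ⟨rfl, rfl⟩ <;> simp [climb, run]
  constructor
  · refine ⟨s MATE (s p 0) :: s p 0 :: L, ?_, by simp, fun v hv => ?_⟩
    · rw [search_run_climb (hpq.imp And.left And.left), hend.1, hend.2]
      exact hS.searchWalk_climb hMH w hne hdepth hroot
    · simp only [hmark', Function.update_apply, List.mem_cons, ← hmark v hv]
      split_ifs <;> simp_all
  · refine Finset.card_lt_card (Finset.ssubset_iff_of_subset (fun v => ?_) |>.2 ⟨s p 0, ?_, ?_⟩)
    · simp only [hmark', Finset.mem_filter, Function.update_apply]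
      grind
    · exact Finset.mem_filter.2 ⟨hp, not_not.1 fun h => w.left_notMem ((hmark _ hp).1 h)⟩
    · simp [hmark', Function.update_apply]

/-- A walk that cannot be extended: it is closed, or both ends are exposed. -/
def WalkDone (s : Store) : Prop :=
  s LEFT 0 = s RIGHT 0 ∨ s MATE (s LEFT 0) = s LEFT 0 ∧ s MATE (s RIGHT 0) = s RIGHT 0

theorem run_climbDeeper (hS : IsSearchForest G (Finset.range n) M H s.search) (hMH : M ⊆ H)
    (hwalk : HasWalk G n H LEFT RIGHT s) :
    WalkDone s ∧ climbDeeper.run s = s ∨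
      HasWalk G n H LEFT RIGHT (climbDeeper.run s) ∧
        (climbDeeper.run s).search = s.search ∧ unmarked n (climbDeeper.run s) < unmarked n s := by
  by_cases hne : s LEFT 0 = s RIGHT 0
  · exact Or.inl ⟨Or.inl hne, by simp [climbDeeper, run, hne]⟩
  obtain ⟨L, w, -⟩ := id hwalk
  obtain ⟨hl, hlnode, hlout⟩ := w.left
  obtain ⟨hr, hrnode, hrout⟩ := w.right
  have hlroot := hS.mate_eq_self_of_depth_eq_zero hl hlnode hlout
  have hrroot := hS.mate_eq_self_of_depth_eq_zero hr hrnode hrout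
  have hldepth := fun h => (hS.exposed _ hl h).2.2
  have hrdepth := fun h => (hS.exposed _ hr h).2.2
  simp only [Store.search] at hlroot hrroot hldepth hrdepth
  rcases le_or_gt (s DEPTH (s RIGHT 0)) (s DEPTH (s LEFT 0)) with hdepth | hdepth
  · by_cases hroot : s MATE (s LEFT 0) = s LEFT 0
    · refine Or.inl ⟨Or.inr ⟨hroot, hrroot ?_⟩, by simp [climbDeeper, run, hne, hdepth, hroot]⟩
      have := hldepth hroot
      omega
    · have hrun : climbDeeper.run s = (climb LEFT).run s := by
        simp [climbDeeper, run, hne, hdepth, hroot]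
      obtain ⟨hwalk', hlt⟩ := run_climb hS hMH (Or.inl ⟨rfl, rfl⟩) hwalk hne hdepth hroot
      rw [hrun]
      exact Or.inr ⟨hwalk', search_run_climb (Or.inl rfl), hlt⟩
  · have hroot : s MATE (s RIGHT 0) ≠ s RIGHT 0 := fun h => by have := hrdepth h; omega
    have hrun : climbDeeper.run s = (climb RIGHT).run s := by
      simp [climbDeeper, run, hne, hdepth.not_ge, hroot]
    obtain ⟨hwalk', hlt⟩ :=
      run_climb hS hMH (Or.inr ⟨rfl, rfl⟩) hwalk.symm (Ne.symm hne) hdepth.le hroot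
    rw [hrun]
    exact Or.inr ⟨hwalk'.symm, search_run_climb (Or.inr rfl), hlt⟩

theorem run_walk (hrounds : n < s 0 ROUNDS)
    (hS : IsSearchForest G (Finset.range n) M H s.search) (hMH : M ⊆ H)
    (hwalk : HasWalk G n H LEFT RIGHT s) :
    HasWalk G n H LEFT RIGHT (walk.run s) ∧ WalkDone (walk.run s) := by
  refine run_loop_until (fun s' => s'.search = s.search ∧ HasWalk G n H LEFT RIGHT s')
    (fun s' => HasWalk G n H LEFT RIGHT s' ∧ WalkDone s') (unmarked n) ⟨rfl, hwalk⟩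
    ?_ (fun i s' _ ⟨hsearch, hwalk'⟩ => ?_) (fun i s' _ ⟨hwalk', hdone⟩ => ?_)
  · refine lt_of_le_of_lt ((Finset.card_filter_le _ _).trans ?_) hrounds
    rw [Finset.card_range]
  · rcases run_climbDeeper (hsearch ▸ hS) hMH hwalk' with ⟨hdone, hrun⟩ | ⟨hwalk'', hs, hlt⟩
    · rw [hrun]
      exact Or.inl ⟨hwalk', hdone⟩
    · exact Or.inr ⟨⟨hs.trans hsearch, hwalk''⟩, hlt⟩
  · have hidle : climbDeeper.run s' = s' := by
      rcases hdone with h | ⟨hl, hr⟩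
      · simp [climbDeeper, run, h]
      · simp [climbDeeper, run, hl, hr]
    rw [hidle]
    exact ⟨hwalk', hdone⟩

theorem run_clearMarks {v : ℕ} (hv : v < s 0 VERTICES) : clearMarks.run s MARK v = 0 := by
  rw [clearMarks, run_loop_apply (fun _ => 0) (by decide) (by simp [run]), if_pos hv]

theorem search_run_shrink {L : List ℕ} (hn : s 0 VERTICES = n)
    (hS : IsSearchForest G (Finset.range n) M H s.search)
    (hmark : ∀ v ∈ Finset.range n, s MARK v ≠ 0 ↔ v ∈ L) :
    (shrink.run s).search = s.search.merge (Finset.range n) L (s LEFT 0) := by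
  have hbase : shrink.run s BASE = (s.search.merge (Finset.range n) L (s LEFT 0)).base := by
    funext v
    rw [shrink, run_loop_apply
      (fun v => if s MARK (s BASE v) ≠ 0 then s LEFT 0 else s BASE v) (by decide) ?_ v, hn]
    · by_cases hv : v ∈ Finset.range n
      · have hiff : s MARK (s BASE v) ≠ 0 ↔ s.search.base v ∈ L := hmark _ (hS.base_mem v hv)
        simp only [hiff, SearchState.merge, hv, Finset.mem_range.1 hv, true_and, if_true]
        rfl
      · simp only [SearchState.merge, hv, mt Finset.mem_range.2 hv, false_and, if_false]
        rfl
    · intro s' _ hframe hcell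
      have hmarks : s' MARK = s MARK := hframe _ (by decide)
      have hleft : s' LEFT = s LEFT := hframe _ (by decide)
      by_cases h : s MARK (s BASE (s' VTX 0)) = 0
      · have hidle : Function.update (s' BASE) (s' VTX 0) (s BASE (s' VTX 0)) = s' BASE := by
          rw [← hcell, Function.update_eq_self]
        simp [run, hmarks, hcell, h, hidle]
      · simp [run, hmarks, hleft, hcell, h]
  simp only [Store.search, SearchState.merge] at hbase ⊢
  congr 1 <;> first | exact hbase | exact run_of_notMem (by decide) s

end Walk

end Cmd

end Ram

namespace Ram

open EdgeColoredGraph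

/-- The store encodes the graph with vertices `0, …, n - 1` and edges `0, …, m - 1`, and array `0`
bounds the number of rounds of a search. -/
structure Encodes {m k : ℕ} (G : EdgeColoredGraph ℕ (Fin m) k) (n : ℕ) (s : Store) : Prop where
  vertices : s 0 VERTICES = n
  edges : s 0 EDGES = m
  rounds : s 0 ROUNDS = 2 * n + 1
  fst : ∀ e : Fin m, s FST e = G.fst e
  snd : ∀ e : Fin m, s SND e = G.snd e
  color : ∀ e : Fin m, s COLOR e = G.color e
  fst_lt : ∀ e, G.fst e < n
  snd_lt : ∀ e, G.snd e < n

theorem Encodes.congr {m k n : ℕ} {G : EdgeColoredGraph ℕ (Fin m) k} {s s' : Store} {l : List ℕ}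
    (hG : Encodes G n s) (hs : ∀ a ∉ l, s' a = s a) (hl : ∀ a ≤ 3, a ∉ l) : Encodes G n s' where
  vertices := by rw [hs _ (hl 0 (by decide)), hG.vertices]
  edges := by rw [hs _ (hl 0 (by decide)), hG.edges]
  rounds := by rw [hs _ (hl 0 (by decide)), hG.rounds]
  fst := by rw [hs _ (hl FST (by decide))]; exact hG.fst
  snd := by rw [hs _ (hl SND (by decide))]; exact hG.snd
  color := by rw [hs _ (hl COLOR (by decide))]; exact hG.color
  fst_lt := hG.fst_lt
  snd_lt := hG.snd_lt

/-- The edge set with the given indicator vector. -/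
def marked (m : ℕ) (a : ℕ → ℕ) : Finset (Fin m) := Finset.univ.filter (a · ≠ 0)

theorem mem_marked {m : ℕ} {a : ℕ → ℕ} {e : Fin m} : e ∈ marked m a ↔ a e ≠ 0 := by
  simp [marked]

namespace Cmd

variable {m k : ℕ} {G : EdgeColoredGraph ℕ (Fin m) k} {n : ℕ} {M H : Finset (Fin m)}
  {s s' : Store} {P : Prop}

/-- The invariant of the search program. -/
structure IsSearching (G : EdgeColoredGraph ℕ (Fin m) k) (n : ℕ) (M H : Finset (Fin m))
    (s : Store) : Prop where
  forest : IsSearchForest G (Finset.range n) M H s.search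
  larger : s LARGER 0 ≠ 0 → G.HasLargerMatching M H

/-- The search has succeeded, or the edge from `x` to `y` does not extend the search forest. -/
def Settled (s : Store) (x y : ℕ) : Prop :=
  s LARGER 0 ≠ 0 ∨ (s.search.IsOuter x →
    s.search.base x = s.search.base y ∨ s.search.status (s.search.base y) = 2)

/-- From `s` to `s'` the search has succeeded or changed the forest. -/
def Progress (n : ℕ) (s s' : Store) : Prop :=
  s' LARGER 0 ≠ 0 ∨
    s'.search.potential (Finset.range n) < s.search.potential (Finset.range n)

/-- The two stores are in the same stage of the search. -/
def SameSearch (s s' : Store) : Prop := s'.search = s.search ∧ s' LARGER = s LARGER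

theorem SameSearch.of_frame {l : List ℕ} (hs : ∀ a ∉ l, s' a = s a)
    (hl : ∀ a ∈ [MATE, BASE, PARENT, STATUS, DEPTH, LARGER], a ∉ l) : SameSearch s s' := by
  simp only [List.forall_mem_cons] at hl
  simp only [SameSearch, Store.search, hs _ hl.1, hs _ hl.2.1, hs _ hl.2.2.1, hs _ hl.2.2.2.1,
    hs _ hl.2.2.2.2.1, hs _ hl.2.2.2.2.2.1, and_self]

theorem IsSearching.congr (h : IsSearching G n M H s) (hs : SameSearch s s') :
    IsSearching G n M H s' :=
  ⟨hs.1.symm ▸ h.forest, fun hl => h.larger (hs.2 ▸ hl)⟩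

/-- The store in which the walk consists of the edge from `SOURCE` to `TARGET` only. -/
def startWalk (s : Store) : Store :=
  ((clearMarks.run s).write LEFT 0 (s BASE (s SOURCE 0))).write RIGHT 0 (s BASE (s TARGET 0))

theorem run_blossom_eq : blossom.run s =
    if (walk.run (startWalk s)) LEFT 0 = (walk.run (startWalk s)) RIGHT 0 then
      shrink.run (walk.run (startWalk s)) else (walk.run (startWalk s)).write LARGER 0 1 := by
  have hframe : ∀ a ∈ [SOURCE, TARGET, BASE], clearMarks.run s a = s a := fun a ha =>
    run_of_notMem (by revert a; decide) s
  simp only [List.forall_mem_cons] at hframe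
  simp only [blossom, run, startWalk, Expr.eval, Expr.eval_eq, hframe, ne_eq, Store.write_of_ne,
    Nat.reduceEqDiff, not_false_eq_true]
  split_ifs <;> simp_all

theorem startWalk_of_notMem {a : ℕ} (ha : a ∉ [VTX, MARK, LEFT, RIGHT]) :
    startWalk s a = s a := by
  simp only [List.mem_cons, List.not_mem_nil, or_false, not_or] at ha
  rw [startWalk, Store.write_of_ne _ _ _ ha.2.2.2, Store.write_of_ne _ _ _ ha.2.2.1,
    run_of_notMem (by simp [clearMarks, writes, ha])]

theorem hasWalk_startWalk (hn : s 0 VERTICES = n)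
    (hS : IsSearchForest G (Finset.range n) M H s.search) {e : Fin m} (he : e ∈ H)
    (hx : s SOURCE 0 ∈ Finset.range n) (hy : s TARGET 0 ∈ Finset.range n)
    (hjoins : G.Joins e (s SOURCE 0) (s TARGET 0))
    (hxo : s.search.IsOuter (s SOURCE 0)) (hyo : s.search.IsOuter (s TARGET 0))
    (hne : s.search.base (s SOURCE 0) ≠ s.search.base (s TARGET 0)) :
    HasWalk G n H LEFT RIGHT (startWalk s) := by
  have hleft : startWalk s LEFT 0 = s.search.base (s SOURCE 0) := by
    simp [startWalk, Store.search]
  have hright : startWalk s RIGHT 0 = s.search.base (s TARGET 0) := by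
    simp [startWalk, Store.search]
  refine ⟨[], ?_, fun _ => by rwa [hleft, hright], fun v hv => ?_⟩
  · rw [(SameSearch.of_frame (fun a => startWalk_of_notMem) (by decide)).1, hleft, hright]
    exact hS.searchWalk_nil he hx hy hjoins hxo hyo
  · have : clearMarks.run s MARK v = 0 := run_clearMarks (hn.symm ▸ Finset.mem_range.1 hv)
    simp [startWalk, this]

theorem run_shrink (hn : s 0 VERTICES = n) (hS : IsSearching G n M H s)
    (hwalk : HasWalk G n H LEFT RIGHT s) (hclosed : s LEFT 0 = s RIGHT 0) :
    IsSearching G n M H (shrink.run s) ∧ Progress n s (shrink.run s) := by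
  obtain ⟨L, w, hnil, hmark⟩ := hwalk
  obtain ⟨v, hv⟩ := List.exists_mem_of_ne_nil L fun h => hnil h hclosed
  have hsearch := search_run_shrink hn hS.forest hmark
  rw [← hclosed] at w
  refine ⟨⟨hsearch ▸ hS.forest.merge w, ?_⟩, Or.inr (hsearch ▸ ?_)⟩
  · rw [run_of_notMem (by decide)]
    exact hS.larger
  · exact SearchState.potential_merge_lt hv (w.node v hv).1 (w.node v hv).2.1 w.left_notMem
      w.left.2.1

theorem run_blossom (hn : s 0 VERTICES = n) (hrounds : n < s 0 ROUNDS) (hM : G.IsMatching M)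
    (hMH : M ⊆ H) (hS : IsSearching G n M H s) {e : Fin m} (he : e ∈ H)
    (hx : s SOURCE 0 ∈ Finset.range n) (hy : s TARGET 0 ∈ Finset.range n)
    (hjoins : G.Joins e (s SOURCE 0) (s TARGET 0))
    (hxo : s.search.IsOuter (s SOURCE 0)) (hyo : s.search.IsOuter (s TARGET 0))
    (hne : s.search.base (s SOURCE 0) ≠ s.search.base (s TARGET 0)) :
    IsSearching G n M H (blossom.run s) ∧ Progress n s (blossom.run s) := by
  have hframe : ∀ a ∉ [VTX, MARK, LEFT, RIGHT, STEP], walk.run (startWalk s) a = s a := by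
    intro a ha
    simp only [List.mem_cons, List.not_mem_nil, or_false, not_or] at ha
    rw [run_of_notMem (by simp [walk, climbDeeper, climb, writes, ha]),
      startWalk_of_notMem (by simp [ha])]
  have hsame : SameSearch s (startWalk s) :=
    SameSearch.of_frame (fun a => startWalk_of_notMem) (by decide)
  have hsame' : SameSearch s (walk.run (startWalk s)) := SameSearch.of_frame hframe (by decide)
  obtain ⟨hwalk, hdone⟩ := run_walk
    (by rwa [startWalk_of_notMem (by decide)]) (hS.congr hsame).forest hMH
    (hasWalk_startWalk hn hS.forest he hx hy hjoins hxo hyo hne)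
  rw [run_blossom_eq]
  split_ifs with hclosed
  · obtain ⟨hS', hprogress⟩ := run_shrink (by rw [hframe 0 (by decide), hn])
      (hS.congr hsame') hwalk hclosed
    refine ⟨hS', ?_⟩
    rwa [Progress, hsame'.1] at hprogress
  · obtain ⟨hl, hr⟩ := hdone.resolve_left hclosed
    obtain ⟨L, w, -⟩ := hwalk
    have hlarger := (hS.congr hsame').forest.hasLargerMatching hM hMH w hclosed hl hr
    exact ⟨⟨by simpa [Store.search] using (hS.congr hsame').forest, fun _ => hlarger⟩,
      Or.inl (by simp)⟩

theorem search_run_grow :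
    (grow.run s).search = s.search.grow (s SOURCE 0) (s TARGET 0) := by
  simp [grow, run, Store.search, SearchState.grow]

theorem run_extend (hn : s 0 VERTICES = n) (hrounds : n < s 0 ROUNDS) (hM : G.IsMatching M)
    (hMH : M ⊆ H) (hS : IsSearching G n M H s) {e : Fin m} (he : e ∈ H)
    (hx : s SOURCE 0 ∈ Finset.range n) (hy : s TARGET 0 ∈ Finset.range n)
    (hjoins : G.Joins e (s SOURCE 0) (s TARGET 0)) :
    Settled s (s SOURCE 0) (s TARGET 0) ∧ extend.run s = s ∨
      ¬ Settled s (s SOURCE 0) (s TARGET 0) ∧ IsSearching G n M H (extend.run s) ∧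
        Progress n s (extend.run s) := by
  have hle : s STATUS (s BASE (s TARGET 0)) ≤ 2 :=
    hS.forest.status_le _ (hS.forest.base_mem _ hy)
  by_cases hset : Settled s (s SOURCE 0) (s TARGET 0)
  · refine Or.inl ⟨hset, ?_⟩
    simp only [Settled, SearchState.IsOuter, Store.search] at hset
    rcases hset with h | h
    · simp [extend, run, h]
    · by_cases houter : s STATUS (s BASE (s SOURCE 0)) = 1
      · rcases h houter with h | h
        · simp [extend, run, ← h, houter]
        · simp [extend, run, h, houter]
      · simp [extend, run, houter]
  · refine Or.inr ⟨hset, ?_⟩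
    simp only [Settled, not_or, not_not, Classical.not_imp] at hset
    obtain ⟨hlarger, houter, hne, hinner⟩ := hset
    have houter' : s STATUS (s BASE (s SOURCE 0)) = 1 := houter
    by_cases hfree : s STATUS (s BASE (s TARGET 0)) = 0
    · have hrun : extend.run s = grow.run s := by simp [extend, run, hlarger, houter', hfree]
      rw [hrun]
      have hnode := hS.forest.base_eq_of_not_isOuter hy
        (by simp [SearchState.IsOuter, Store.search, hfree])
      refine ⟨⟨search_run_grow ▸ hS.forest.grow he hx hy hjoins houter hfree, fun h => ?_⟩,
        Or.inr (search_run_grow ▸ SearchState.potential_grow_lt hy (hnode ▸ hfree))⟩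
      rw [run_of_notMem (by decide)] at h
      exact absurd hlarger h
    · have houter'' : s STATUS (s BASE (s TARGET 0)) = 1 := by
        change s STATUS (s BASE (s TARGET 0)) ≠ 2 at hinner
        omega
      have hrun : extend.run s = blossom.run s := by
        have hne' : s BASE (s SOURCE 0) ≠ s BASE (s TARGET 0) := hne
        simp [extend, run, hlarger, houter', houter'', hne']
      rw [hrun]
      exact run_blossom hn hrounds hM hMH hS he hx hy hjoins houter houter'' hne

/-- Started in `s`, the search has arrived in `s'`: either nothing has happened and `P` holds, or
`P` has failed and progress has been made. -/
def Tracks (n : ℕ) (s : Store) (P : Prop) (s' : Store) : Prop :=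
  P ∧ SameSearch s s' ∨ ¬ P ∧ Progress n s s'

theorem Tracks.congr {s'' : Store} (h : Tracks n s P s') (hs : SameSearch s' s'') :
    Tracks n s P s'' := by
  simpa [Tracks, SameSearch, Progress, hs.1, hs.2] using h

theorem Tracks.run_extend (hG : Encodes G n s') (hM : G.IsMatching M) (hMH : M ⊆ H)
    (hS : IsSearching G n M H s') {e : Fin m} (he : e ∈ H) {x y : ℕ} (hx : s' SOURCE 0 = x)
    (hy : s' TARGET 0 = y) (hjoins : G.Joins e x y) (h : Tracks n s P s') :
    IsSearching G n M H (extend.run s') ∧ Tracks n s (P ∧ Settled s x y) (extend.run s') := by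
  subst hx hy
  have hends : s' SOURCE 0 ∈ Finset.range n ∧ s' TARGET 0 ∈ Finset.range n := by
    simp only [Finset.mem_range]
    rcases hjoins with ⟨hx, hy⟩ | ⟨hx, hy⟩ <;> rw [← hx, ← hy]
    exacts [⟨hG.fst_lt e, hG.snd_lt e⟩, ⟨hG.snd_lt e, hG.fst_lt e⟩]
  have hrounds : n < s' 0 ROUNDS := by
    rw [hG.rounds]
    omega
  have hsettled : SameSearch s s' → (Settled s (s' SOURCE 0) (s' TARGET 0) ↔
      Settled s' (s' SOURCE 0) (s' TARGET 0)) := fun hs => by simp only [Settled, hs.1, hs.2]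
  rcases Cmd.run_extend hG.vertices hrounds hM hMH hS he hends.1 hends.2 hjoins with
    ⟨hset, hrun⟩ | ⟨hset, hS', hprogress⟩
  · rw [hrun]
    refine ⟨hS, h.imp (fun ⟨hP, hs⟩ => ⟨⟨hP, (hsettled hs).2 hset⟩, hs⟩) fun ⟨hP, hpr⟩ => ?_⟩
    exact ⟨fun hP' => hP hP'.1, hpr⟩
  · refine ⟨hS', Or.inr ?_⟩
    rcases h with ⟨-, hs⟩ | ⟨hP, hlarger | hlt⟩
    · refine ⟨fun hP' => hset ((hsettled hs).1 hP'.2), ?_⟩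
      rwa [Progress, ← hs.1]
    · exact absurd (Or.inl hlarger) hset
    · exact ⟨fun hP' => hP hP'.1, hprogress.imp_right fun hlt' => hlt'.trans hlt⟩

/-- The edge `e` does not extend the search forest in either direction. -/
def EdgeSettled (G : EdgeColoredGraph ℕ (Fin m) k) (s : Store) (e : Fin m) : Prop :=
  Settled s (G.fst e) (G.snd e) ∧ Settled s (G.snd e) (G.fst e)

theorem EdgeSettled.congr {e : Fin m} (h : EdgeSettled G s e) (hs : SameSearch s s') :
    EdgeSettled G s' e := by
  simpa only [EdgeSettled, Settled, hs.1, hs.2] using h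

theorem Tracks.run_scanEdge (hG : Encodes G n s') (hM : G.IsMatching M) (hMH : M ⊆ H)
    (hS : IsSearching G n M H s') {e : Fin m} (he : e ∈ H) (hsub : s' SUB e ≠ 0)
    (hedge : s' EDGE 0 = e) (h : Tracks n s P s') :
    IsSearching G n M H (scanEdge.run s') ∧
      Tracks n s (P ∧ EdgeSettled G s e) (scanEdge.run s') := by
  set s₁ := (s'.write SOURCE 0 (G.fst e)).write TARGET 0 (G.snd e)
  set s₂ := ((extend.run s₁).write SOURCE 0 (G.snd e)).write TARGET 0 (G.fst e)
  have hframe : ∀ a ∉ [SOURCE, TARGET], s₁ a = s' a := by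
    simp +contextual [s₁]
  have hframe' : ∀ a ∉ [SOURCE, TARGET], s₂ a = extend.run s₁ a := by
    simp +contextual [s₂]
  have hG₁ : Encodes G n s₁ := hG.congr hframe (by decide)
  have hG' : Encodes G n (extend.run s₁) := hG₁.congr
    (l := extend.writes) (fun a ha => run_of_notMem ha _) (by decide)
  have hrun : scanEdge.run s' = extend.run s₂ := by
    have h : ∀ a ∈ [FST, SND, EDGE], extend.run s₁ a = s' a := fun a ha => by
      rw [run_of_notMem (by revert a; decide), hframe a (by revert a; decide)]
    simp only [List.forall_mem_cons] at h
    have := hG.fst e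
    have := hG.snd e
    simp_all [scanEdge, run, s₁, s₂]
  have hs₁ : SameSearch s' s₁ := .of_frame hframe (by decide)
  have hs₂ : SameSearch (extend.run s₁) s₂ := .of_frame hframe' (by decide)
  obtain ⟨hS', h'⟩ := Tracks.run_extend hG₁ hM hMH (hS.congr hs₁) he (by simp [s₁])
    (by simp [s₁]) (Or.inl ⟨rfl, rfl⟩) (h.congr hs₁)
  have := Tracks.run_extend (hG'.congr hframe' (by decide)) hM hMH (hS'.congr hs₂) he
    (by simp [s₂]) (by simp [s₂]) (Or.inr ⟨rfl, rfl⟩) (h'.congr hs₂)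
  rwa [hrun, EdgeSettled, ← and_assoc]

theorem run_sweep (hG : Encodes G n s) (hM : G.IsMatching M) (hMH : M ⊆ marked m (s SUB))
    (hS : IsSearching G n M (marked m (s SUB)) s) :
    IsSearching G n M (marked m (s SUB)) (sweep.run s) ∧
      Tracks n s (∀ e ∈ marked m (s SUB), EdgeSettled G s e) (sweep.run s) := by
  have := run_loop (c := EDGE) (b := EDGES) (p := scanEdge) (s := s)
    (fun i s' => IsSearching G n M (marked m (s SUB)) s' ∧
      Tracks n s (∀ e ∈ marked m (s SUB), e < i → EdgeSettled G s e) s') ?_ ?_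
  · rw [hG.edges] at this
    simpa [sweep] using this
  · have hs : SameSearch s (s.write EDGE 0 0) := by simp [SameSearch, Store.search]
    exact ⟨hS.congr hs, Or.inl ⟨by simp, hs⟩⟩
  · rintro i s' hi hc hframe ⟨hS', h⟩
    have hs : SameSearch (scanEdge.run s') ((scanEdge.run s').write EDGE 0 (i + 1)) := by
      simp [SameSearch, Store.search]
    have hG' : Encodes G n s' := hG.congr hframe (by decide)
    have hsub : s' SUB = s SUB := hframe _ (by decide)
    rw [hG.edges] at hi
    suffices IsSearching G n M (marked m (s SUB)) (scanEdge.run s') ∧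
        Tracks n s (∀ e ∈ marked m (s SUB), e < i + 1 → EdgeSettled G s e) (scanEdge.run s') from
      ⟨this.1.congr hs, this.2.congr hs⟩
    have hsucc : (∀ e ∈ marked m (s SUB), e < i + 1 → EdgeSettled G s e) ↔
        (∀ e ∈ marked m (s SUB), e < i → EdgeSettled G s e) ∧
          (⟨i, hi⟩ ∈ marked m (s SUB) → EdgeSettled G s ⟨i, hi⟩) := by
      grind [Fin.ext_iff]
    rw [hsucc]
    by_cases he : ⟨i, hi⟩ ∈ marked m (s SUB)
    · have hmem : s' SUB i ≠ 0 := by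
        rw [hsub]
        exact mem_marked.1 he
      simpa [he] using Tracks.run_scanEdge hG' hM hMH hS' he hmem hc h
    · have : s SUB i = 0 := by simpa [mem_marked] using he
      have hidle : scanEdge.run s' = s' := by simp [scanEdge, run, hc, hsub, this]
      simpa [he, hidle] using ⟨hS', h⟩

end Cmd

end Ram

namespace Ram.Cmd

open EdgeColoredGraph

variable {m k : ℕ} {G : EdgeColoredGraph ℕ (Fin m) k} {n : ℕ} {M H : Finset (Fin m)}
  {s s' : Store}

theorem run_resetVertices {v : ℕ} (hv : v < s 0 VERTICES) :
    resetVertices.run s MATE v = v ∧ resetVertices.run s BASE v = v ∧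
      resetVertices.run s DEPTH v = 0 := by
  refine run_loop (fun i s' => ∀ v < i, s' MATE v = v ∧ s' BASE v = v ∧ s' DEPTH v = 0)
    (by simp) (fun i s' _ hc _ hI v hv => ?_) v hv
  have := hI v
  simp only [run, Expr.eval, hc, ne_eq, Nat.reduceEqDiff, not_false_eq_true, Store.write_of_ne,
    Store.write_self, Function.update_apply]
  grind

theorem run_loadMates (hG : Encodes G n s) (hM : G.IsMatching (marked m (s MAT)))
    (hmate : ∀ v < n, s MATE v = v) :
    IsMate G (Finset.range n) (marked m (s MAT)) (loadMates.run s MATE) := by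
  have := run_loop (c := EDGE) (b := EDGES) (s := s)
    (p := .ite (.read MAT (.var EDGE))
      (.write MATE (.read FST (.var EDGE)) (.read SND (.var EDGE)) ;;
       .write MATE (.read SND (.var EDGE)) (.read FST (.var EDGE))) .skip)
    (fun i s' => IsMate G (Finset.range n) ((marked m (s MAT)).filter (· < i)) (s' MATE)) ?_ ?_
  · rwa [hG.edges, Finset.filter_true_of_mem fun e _ => e.2] at this
  · simpa using isMate_empty fun v hv => hmate v (Finset.mem_range.1 hv)
  · intro i s' hi hc hframe hI
    rw [hG.edges] at hi
    have hG' : Encodes G n s' := hG.congr hframe (by decide)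
    have hmat : s' MAT = s MAT := hframe _ (by decide)
    by_cases hi' : s MAT i = 0
    · have hfilter : (marked m (s MAT)).filter (fun e : Fin m => (e : ℕ) < i + 1) =
          (marked m (s MAT)).filter (fun e : Fin m => (e : ℕ) < i) := by
        ext e
        simp only [Finset.mem_filter, mem_marked]
        grind
      rw [hfilter]
      simpa [run, hc, hmat, hi'] using hI
    · have hfilter : (marked m (s MAT)).filter (fun e : Fin m => (e : ℕ) < i + 1) =
          insert ⟨i, hi⟩ ((marked m (s MAT)).filter (fun e : Fin m => (e : ℕ) < i)) := by
        ext e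
        simp only [Finset.mem_filter, mem_marked, Finset.mem_insert, Fin.ext_iff]
        grind
      have hfst := hG'.fst ⟨i, hi⟩
      have hsnd := hG'.snd ⟨i, hi⟩
      have := hI.insert (e := ⟨i, hi⟩) (by simp) (hfilter ▸ hM.mono (Finset.filter_subset _ _))
        (Finset.mem_range.2 (hG.fst_lt _)) (Finset.mem_range.2 (hG.snd_lt _))
      rw [hfilter]
      simpa [run, hc, hmat, hi', hfst, hsnd] using this

theorem run_markRoots {v : ℕ} (hv : v < s 0 VERTICES) :
    markRoots.run s STATUS v = if s MATE v = v then 1 else 0 := by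
  rw [markRoots, run_loop_apply (fun v => if s MATE v = v then 1 else 0) (by decide) ?_ v,
    if_pos hv]
  intro s' _ hframe _
  have hmate : s' MATE = s MATE := hframe _ (by decide)
  simp [run, hmate]

theorem run_initSearch (hG : Encodes G n s) (hM : G.IsMatching (marked m (s MAT))) :
    IsSearching G n (marked m (s MAT)) H (initSearch.run s) := by
  set s₁ := resetVertices.run s
  set s₂ := loadMates.run s₁ with hs₂
  set s₃ := markRoots.run s₂ with hs₃
  have hG₁ : Encodes G n s₁ := hG.congr (fun a ha => run_of_notMem ha s) (by decide)
  have hG₂ : Encodes G n s₂ := hG₁.congr (fun a ha => run_of_notMem ha s₁) (by decide)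
  have hreset : ∀ v ∈ Finset.range n, s₁ MATE v = v ∧ s₁ BASE v = v ∧ s₁ DEPTH v = 0 :=
    fun v hv => run_resetVertices (hG.vertices.symm ▸ Finset.mem_range.1 hv)
  have hmat : s₁ MAT = s MAT := run_of_notMem (by decide) s
  have hmate : IsMate G (Finset.range n) (marked m (s MAT)) (s₂ MATE) :=
    hmat ▸ run_loadMates hG₁ (hmat ▸ hM) fun v hv => (hreset v (Finset.mem_range.2 hv)).1
  have hframe : ∀ a ∈ [MATE], s₃ a = s₂ a := fun a ha =>
    run_of_notMem (by revert a; decide) s₂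
  have hframe' : ∀ a ∈ [BASE, DEPTH], s₃ a = s₁ a := fun a ha => by
    rw [hs₃, run_of_notMem (by revert a; decide), hs₂, run_of_notMem (by revert a; decide)]
  simp only [List.forall_mem_cons] at hframe hframe'
  have hrun : initSearch.run s = s₃.write LARGER 0 0 := rfl
  refine ⟨IsMate.isSearchForest ?_ ?_ ?_ ?_, by simp [hrun]⟩ <;>
    simp only [hrun, Store.search, ne_eq, Nat.reduceEqDiff, not_false_eq_true,
      Store.write_of_ne, hframe, hframe']
  · exact hmate
  · exact fun v hv => (hreset v hv).2.1
  · exact fun v hv => run_markRoots (hG₂.vertices.symm ▸ Finset.mem_range.1 hv)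
  · exact fun v hv => (hreset v hv).2.2

theorem card_le_of_edgeSettled (hG : Encodes G n s) (hM : G.IsMatching M) (hMH : M ⊆ H)
    (hS : IsSearchForest G (Finset.range n) M H s.search) (hlarger : s LARGER 0 = 0)
    (hset : ∀ e ∈ H, EdgeSettled G s e) {N : Finset (Fin m)} (hNH : N ⊆ H)
    (hN : G.IsMatching N) : N.card ≤ M.card := by
  refine hS.card_le_of_stuck hM hMH (fun e _ => by simp [hG.fst_lt, hG.snd_lt]) ?_ hNH hN
  rintro e he x y (⟨rfl, rfl⟩ | ⟨rfl, rfl⟩)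
  exacts [(hset e he).1.resolve_left (not_not.2 hlarger),
    (hset e he).2.resolve_left (not_not.2 hlarger)]

theorem run_searchLoop (hG : Encodes G n s) (hM : G.IsMatching M)
    (hMH : M ⊆ marked m (s SUB)) (hS : IsSearching G n M (marked m (s SUB)) s) :
    IsSearching G n M (marked m (s SUB)) ((loop SWEEP ROUNDS sweep).run s) ∧
      ∀ e ∈ marked m (s SUB), EdgeSettled G ((loop SWEEP ROUNDS sweep).run s) e := by
  have hsame : ∀ (s' : Store) (i : ℕ), SameSearch s' (s'.write SWEEP 0 i) := fun s' i => by
    simp [SameSearch, Store.search]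
  have hsweep : ∀ s', (∀ a ∉ (loop SWEEP ROUNDS sweep).writes, s' a = s a) →
      IsSearching G n M (marked m (s SUB)) s' →
      IsSearching G n M (marked m (s SUB)) (sweep.run s') ∧
        Tracks n s' (∀ e ∈ marked m (s SUB), EdgeSettled G s' e) (sweep.run s') := by
    intro s' hframe hS'
    have hsub : s' SUB = s SUB := hframe _ (by decide)
    have := run_sweep (hG.congr hframe (by decide)) hM (hsub ▸ hMH) (hsub ▸ hS')
    rwa [hsub] at this
  refine run_loop_until (IsSearching G n M (marked m (s SUB)))
    (fun s' => IsSearching G n M (marked m (s SUB)) s' ∧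
      ∀ e ∈ marked m (s SUB), EdgeSettled G s' e)
    (fun s' => s'.search.potential (Finset.range n)) (hS.congr (hsame _ _)) ?_ ?_ ?_
  · have := SearchState.potential_le (S := (s.write SWEEP 0 0).search) (vs := Finset.range n)
    rw [Finset.card_range] at this
    rw [hG.rounds]
    omega
  · intro i s' hframe hS'
    obtain ⟨hS'', ⟨hP, hs⟩ | ⟨-, hlarger | hlt⟩⟩ := hsweep s' hframe hS'
    · exact Or.inl ⟨hS''.congr (hsame _ _), fun e he => ((hP e he).congr hs).congr (hsame _ _)⟩
    · exact Or.inl ⟨hS''.congr (hsame _ _), fun _ _ =>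
        EdgeSettled.congr ⟨Or.inl hlarger, Or.inl hlarger⟩ (hsame _ _)⟩
    · exact Or.inr ⟨hS''.congr (hsame _ _), by rwa [(hsame _ _).1]⟩
  · intro i s' hframe ⟨hS', hP⟩
    obtain ⟨hS'', ⟨-, hs⟩ | ⟨hP', -⟩⟩ := hsweep s' hframe hS'
    · exact ⟨hS''.congr (hsame _ _), fun e he => ((hP e he).congr hs).congr (hsame _ _)⟩
    · exact absurd hP hP'

theorem run_search (hG : Encodes G n s) (hM : G.IsMatching (marked m (s MAT)))
    (hsub : marked m (s MAT) ⊆ marked m (s SUB)) :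
    search.run s LARGER 0 ≠ 0 ↔
      G.HasLargerMatching (marked m (s MAT)) (marked m (s SUB)) := by
  have hG' : Encodes G n (initSearch.run s) :=
    hG.congr (fun a ha => run_of_notMem ha s) (by decide)
  have hsub' : initSearch.run s SUB = s SUB := run_of_notMem (by decide) s
  obtain ⟨hS, hset⟩ := run_searchLoop hG' hM (hsub' ▸ hsub) (run_initSearch hG hM)
  rw [hsub'] at hS hset
  refine ⟨hS.larger, fun ⟨N, hNH, hN, hlt⟩ hlarger => hlt.not_ge ?_⟩
  exact card_le_of_edgeSettled (hG'.congr (fun a ha => run_of_notMem ha _) (by decide)) hM hsub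
    hS.forest hlarger hset hNH hN

end Ram.Cmd

/-! ### The matching program -/

namespace Ram

notation "UNION" => 5
notation "ACTIVE" => 6

notation "PRUNED" => 34
notation "TRY" => 35
notation "PICKED" => 36

theorem marked_update_zero {m : ℕ} {a : ℕ → ℕ} {e : Fin m} :
    marked m (Function.update a e 0) = (marked m a).erase e := by
  ext f
  simp only [mem_marked, Finset.mem_erase, Function.update_apply]
  grind

namespace Cmd

open EdgeColoredGraph

/-- Delete the edge `PRUNED` from `SUB` if `SUB` still contains a matching larger than `MAT`. -/
def tryDelete : Cmd :=
  .write SUB (.var PRUNED) (.const 0) ;;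
  search ;;
  .ite (.var LARGER) .skip (.write SUB (.var PRUNED) (.const 1))

/-- Try to delete the edge `PRUNED` if it lies in `SUB` but not in `MAT`. -/
def pruneStep : Cmd :=
  .ite (.and (.read SUB (.var PRUNED)) (.not (.read MAT (.var PRUNED)))) tryDelete .skip

/-- Delete edges from `SUB` as long as `SUB` contains a matching larger than `MAT`. -/
def prune : Cmd := .loop PRUNED EDGES pruneStep

/-- Mark the vertices covered by the edges of `SUB` that are not in `MAT`. -/
def markCover : Cmd :=
  clearMarks ;;
  .loop EDGE EDGES
    (.ite (.and (.read SUB (.var EDGE)) (.not (.read MAT (.var EDGE))))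
      (.write MARK (.read FST (.var EDGE)) (.const 1) ;;
       .write MARK (.read SND (.var EDGE)) (.const 1))
      .skip)

/-- Replace `MAT` by the exchanged edge set of `MAT` and `SUB`. -/
def exchange : Cmd :=
  markCover ;;
  .loop EDGE EDGES
    (.write MAT (.var EDGE)
      (.and (.read SUB (.var EDGE))
        (.not (.and (.read MAT (.var EDGE))
          (.add (.read MARK (.read FST (.var EDGE))) (.read MARK (.read SND (.var EDGE))))))))

/-- Replace `SUB` by `ACTIVE`. -/
def copyActive : Cmd := .loop EDGE EDGES (.write SUB (.var EDGE) (.read ACTIVE (.var EDGE)))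

/-- Replace the matching `MAT` by a larger one within `ACTIVE` if there is one. -/
def improve : Cmd := copyActive ;; search ;; .ite (.var LARGER) (prune ;; exchange) .skip

/-- Compute a maximum matching within `ACTIVE`. -/
def maximize : Cmd :=
  .loop EDGE EDGES (.write MAT (.var EDGE) (.const 0)) ;; .loop TRY EDGES improve

/-- Activate the edges with the color of the edge `PICKED`. -/
def activate : Cmd :=
  .loop EDGE EDGES
    (.write ACTIVE (.var EDGE) (.eq (.read COLOR (.var EDGE)) (.read COLOR (.var PICKED))))

/-- Replace the active edges of `UNION` by the active edges of `MAT`. -/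
def replaceActive : Cmd :=
  .loop EDGE EDGES
    (.ite (.read ACTIVE (.var EDGE)) (.write UNION (.var EDGE) (.read MAT (.var EDGE))) .skip)

/-- Compute the union of maximum matchings of all colors. -/
def collect : Cmd := .loop PICKED EDGES (activate ;; maximize ;; replaceActive)

variable {m k : ℕ} {G : EdgeColoredGraph ℕ (Fin m) k} {n : ℕ} {s : Store}

theorem run_tryDelete (hG : Encodes G n s) (hM : G.IsMatching (marked m (s MAT)))
    (hMH : marked m (s MAT) ⊆ marked m (s SUB)) {e : Fin m} (hpruned : s PRUNED 0 = e)
    (heH : e ∈ marked m (s SUB)) (heM : e ∉ marked m (s MAT)) :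
    G.HasLargerMatching (marked m (s MAT)) ((marked m (s SUB)).erase e) ∧
        marked m (tryDelete.run s SUB) = (marked m (s SUB)).erase e ∨
      ¬ G.HasLargerMatching (marked m (s MAT)) ((marked m (s SUB)).erase e) ∧
        marked m (tryDelete.run s SUB) = marked m (s SUB) := by
  set s₁ := s.write SUB e 0 with hs₁
  have hpruned₁ : s₁ PRUNED 0 = e := hpruned
  have hsub : marked m (s₁ SUB) = (marked m (s SUB)).erase e := by
    rw [hs₁, Store.write_self, marked_update_zero]
  have hmat : s₁ MAT = s MAT := by simp [hs₁]
  have hsearch := run_search (s := s₁) (hG.congr (l := [SUB]) (by simp +contextual [hs₁])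
    (by decide)) (hmat ▸ hM) (by rw [hmat, hsub]; exact Finset.subset_erase.2 ⟨hMH, heM⟩)
  have hframe : ∀ a ∈ [SUB, PRUNED], search.run s₁ a = s₁ a := fun a ha =>
    run_of_notMem (by revert a; decide) s₁
  simp only [List.forall_mem_cons] at hframe
  rw [hmat, hsub] at hsearch
  rw [← hsearch]
  by_cases hlarger : search.run s₁ LARGER 0 = 0
  · refine Or.inr ⟨not_not.2 hlarger, ?_⟩
    have hrun : tryDelete.run s SUB = Function.update (s₁ SUB) e 1 := by
      simp [tryDelete, run, hpruned, ← hs₁, hlarger, hframe, hpruned₁]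
    ext f
    rw [hrun, hs₁, Store.write_self, mem_marked, mem_marked]
    by_cases hfe : f = e
    · simpa [hfe] using mem_marked.1 heH
    · simp [Fin.val_ne_of_ne hfe]
  · refine Or.inl ⟨hlarger, ?_⟩
    have hrun : tryDelete.run s SUB = s₁ SUB := by
      simp [tryDelete, run, hpruned, ← hs₁, hlarger, hframe]
    rw [hrun, hsub]

theorem run_pruneStep (hG : Encodes G n s) (hM : G.IsMatching (marked m (s MAT)))
    (hMH : marked m (s MAT) ⊆ marked m (s SUB))
    (hlarger : G.HasLargerMatching (marked m (s MAT)) (marked m (s SUB)))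
    {e : Fin m} (hpruned : s PRUNED 0 = e) :
    marked m (s MAT) ⊆ marked m (pruneStep.run s SUB) ∧
      marked m (pruneStep.run s SUB) ⊆ marked m (s SUB) ∧
      G.HasLargerMatching (marked m (s MAT)) (marked m (pruneStep.run s SUB)) ∧
      (e ∈ marked m (pruneStep.run s SUB) → e ∉ marked m (s MAT) →
        ¬ G.HasLargerMatching (marked m (s MAT)) ((marked m (pruneStep.run s SUB)).erase e)) := by
  by_cases hcond : s SUB e ≠ 0 ∧ s MAT e = 0
  · have hrun : pruneStep.run s = tryDelete.run s := by simp [pruneStep, run, hpruned, hcond]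
    have heM : e ∉ marked m (s MAT) := by simp [mem_marked, hcond.2]
    rw [hrun]
    rcases run_tryDelete hG hM hMH hpruned (mem_marked.2 hcond.1) heM with ⟨h, hrun⟩ | ⟨h, hrun⟩ <;>
      rw [hrun]
    · exact ⟨Finset.subset_erase.2 ⟨hMH, heM⟩, Finset.erase_subset _ _, h,
        fun he => absurd he (Finset.notMem_erase _ _)⟩
    · exact ⟨hMH, subset_rfl, hlarger, fun _ _ => h⟩
  · have hrun : pruneStep.run s = s := by
      rcases not_and_or.1 hcond with h | h <;> simp [pruneStep, run, hpruned, h]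
    rw [hrun]
    refine ⟨hMH, subset_rfl, hlarger, fun he heM => ?_⟩
    exact absurd ⟨mem_marked.1 he, not_not.1 (mem_marked.not.1 heM)⟩ hcond

theorem run_prune (hG : Encodes G n s) (hM : G.IsMatching (marked m (s MAT)))
    (hMH : marked m (s MAT) ⊆ marked m (s SUB))
    (hlarger : G.HasLargerMatching (marked m (s MAT)) (marked m (s SUB))) :
    G.IsPruned (marked m (s MAT)) (marked m (prune.run s SUB)) ∧
      marked m (prune.run s SUB) ⊆ marked m (s SUB) := by
  set M := marked m (s MAT) with hM_def
  have := run_loop (c := PRUNED) (b := EDGES) (s := s) (p := pruneStep)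
    (fun i s' => M ⊆ marked m (s' SUB) ∧ marked m (s' SUB) ⊆ marked m (s SUB) ∧
      G.HasLargerMatching M (marked m (s' SUB)) ∧ ∀ e ∈ marked m (s' SUB), e < i → e ∉ M →
        ¬ G.HasLargerMatching M ((marked m (s' SUB)).erase e)) ?_ ?_
  · rw [hG.edges] at this
    exact ⟨⟨this.2.2.1, fun e he => this.2.2.2 e he e.2⟩, this.2.1⟩
  · simpa using ⟨hMH, hlarger⟩
  · rintro i s' hi hc hframe ⟨hMH', hsub, hlarger', hpruned⟩
    rw [hG.edges] at hi
    have hmat : s' MAT = s MAT := hframe _ (by decide)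
    obtain ⟨hMH'', hsub', hlarger'', hi'⟩ := run_pruneStep (hG.congr hframe (by decide))
      (hmat ▸ hM) (hmat ▸ hMH') (hmat ▸ hlarger') (e := ⟨i, hi⟩) hc
    rw [hmat, ← hM_def] at hMH'' hlarger'' hi'
    rw [Store.write_of_ne _ _ _ (by decide)]
    refine ⟨hMH'', hsub'.trans hsub, hlarger'', fun e he hei heM => ?_⟩
    rcases Nat.lt_succ_iff_lt_or_eq.1 hei with hei | rfl
    · exact fun h => hpruned e (hsub' he) hei heM (h.mono (Finset.erase_subset_erase _ hsub'))
    · exact hi' he heM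

theorem run_markCover (hG : Encodes G n s) {v : ℕ} (hv : v < n) :
    markCover.run s MARK v ≠ 0 ↔ v ∈ G.cover (marked m (s SUB) \ marked m (s MAT)) := by
  set s₁ := clearMarks.run s
  have hframe₁ : ∀ a ∉ clearMarks.writes, s₁ a = s a := fun a ha => run_of_notMem ha s
  have hG₁ : Encodes G n s₁ := hG.congr hframe₁ (by decide)
  have := run_loop (c := EDGE) (b := EDGES) (s := s₁)
    (p := .ite (.and (.read SUB (.var EDGE)) (.not (.read MAT (.var EDGE))))
      (.write MARK (.read FST (.var EDGE)) (.const 1) ;;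
       .write MARK (.read SND (.var EDGE)) (.const 1)) .skip)
    (fun i s' => s' MARK v ≠ 0 ↔
      ∃ e : Fin m, e < i ∧ (s SUB e ≠ 0 ∧ s MAT e = 0) ∧ G.Incident e v) ?_ ?_
  · rw [hG₁.edges] at this
    simpa [mem_cover, mem_marked, markCover, run] using this
  · simpa using run_clearMarks (hG.vertices.symm ▸ hv)
  · intro i s' hi hc hframe hI
    rw [hG₁.edges] at hi
    have hG' : Encodes G n s' := hG₁.congr hframe (by decide)
    have hfst := hG'.fst ⟨i, hi⟩
    have hsnd := hG'.snd ⟨i, hi⟩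
    have hsub : s' SUB = s SUB := by rw [hframe _ (by decide), hframe₁ _ (by decide)]
    have hmat : s' MAT = s MAT := by rw [hframe _ (by decide), hframe₁ _ (by decide)]
    have hsucc : (∃ e : Fin m, (e : ℕ) < i + 1 ∧ (s SUB e ≠ 0 ∧ s MAT e = 0) ∧ G.Incident e v) ↔
        (∃ e : Fin m, (e : ℕ) < i ∧ (s SUB e ≠ 0 ∧ s MAT e = 0) ∧ G.Incident e v) ∨
          (s SUB i ≠ 0 ∧ s MAT i = 0) ∧ G.Incident ⟨i, hi⟩ v := by
      grind [Fin.ext_iff]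
    rw [hsucc, ← hI]
    by_cases hcond : s SUB i ≠ 0 ∧ s MAT i = 0
    · simp [run, hc, hsub, hmat, hcond, hfst, hsnd, Function.update_apply, Incident]
      grind
    · rw [or_iff_left (fun h => hcond h.1)]
      rw [not_and_or] at hcond
      rcases hcond with h | h <;> simp [run, hc, hsub, hmat, h]

theorem run_exchange (hG : Encodes G n s) :
    marked m (exchange.run s MAT) = G.exchange (marked m (s MAT)) (marked m (s SUB)) := by
  set s₁ := markCover.run s with hs₁
  have hframe₁ : ∀ a ∉ markCover.writes, s₁ a = s a := fun a ha => run_of_notMem ha s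
  have hG₁ : Encodes G n s₁ := hG.congr hframe₁ (by decide)
  have hmat : s₁ MAT = s MAT := hframe₁ _ (by decide)
  have hrun : exchange.run s = (loop EDGE EDGES _).run s₁ := rfl
  ext e
  rw [hrun, mem_marked, run_loop_apply (fun e => if s SUB e ≠ 0 ∧
    ¬ (s MAT e ≠ 0 ∧ s₁ MARK (s FST e) + s₁ MARK (s SND e) ≠ 0) then 1 else 0) (by decide) ?_,
    hG₁.edges, if_pos e.2]
  · have hfst := run_markCover hG (hG.fst_lt e)
    have hsnd := run_markCover hG (hG.snd_lt e)
    rw [← hs₁] at hfst hsnd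
    simp only [EdgeColoredGraph.exchange, Finset.mem_filter, ← hfst, ← hsnd, mem_marked, hG.fst,
      hG.snd]
    split_ifs <;> grind
  · intro s' _ hframe hcell
    have hframe' : ∀ a ∈ [SUB, FST, SND], s' a = s a := fun a ha => by
      rw [hframe a (by revert a; decide), hframe₁ a (by revert a; decide)]
    have hmark : s' MARK = s₁ MARK := hframe _ (by decide)
    simp only [List.forall_mem_cons] at hframe'
    simp [run, hframe', hmark, hcell, hmat]

theorem run_copyActive (hG : Encodes G n s) :
    marked m (copyActive.run s SUB) = marked m (s ACTIVE) := by
  ext e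
  rw [mem_marked, mem_marked, copyActive, run_loop_apply (s ACTIVE) (by decide) ?_, hG.edges,
    if_pos e.2]
  intro s' _ hframe _
  have hactive : s' ACTIVE = s ACTIVE := hframe _ (by decide)
  simp [run, hactive]

theorem run_improve (hG : Encodes G n s) (hM : G.IsMatching (marked m (s MAT)))
    (hMA : marked m (s MAT) ⊆ marked m (s ACTIVE)) :
    G.IsMaximumMatchingIn (marked m (s ACTIVE)) (marked m (s MAT)) ∧
        improve.run s MAT = s MAT ∨
      marked m (improve.run s MAT) ⊆ marked m (s ACTIVE) ∧
        G.IsMatching (marked m (improve.run s MAT)) ∧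
        (marked m (s MAT)).card < (marked m (improve.run s MAT)).card := by
  set s₁ := copyActive.run s with hs₁
  set s₂ := search.run s₁ with hs₂
  have hG₁ : Encodes G n s₁ := hG.congr (fun a ha => run_of_notMem ha s) (by decide)
  have hG₂ : Encodes G n s₂ := hG₁.congr (fun a ha => run_of_notMem ha s₁) (by decide)
  have hmat₁ : s₁ MAT = s MAT := run_of_notMem (by decide) s
  have hmat₂ : s₂ MAT = s MAT := (run_of_notMem (by decide) s₁).trans hmat₁
  have hsub₁ : marked m (s₁ SUB) = marked m (s ACTIVE) := run_copyActive hG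
  have hsub₂ : marked m (s₂ SUB) = marked m (s ACTIVE) := by
    rw [← hsub₁, hs₂, run_of_notMem (by decide)]
  have hsearch := run_search hG₁ (hmat₁ ▸ hM) (by rwa [hmat₁, hsub₁])
  rw [hmat₁, hsub₁, ← hs₂] at hsearch
  by_cases hlarger : s₂ LARGER 0 = 0
  · have hrun : improve.run s = s₂ := by simp [improve, run, ← hs₁, ← hs₂, hlarger]
    refine Or.inl ⟨⟨hMA, hM, fun N hN hNM => not_lt.1 fun hlt => ?_⟩, hrun ▸ hmat₂⟩
    exact hsearch.2 ⟨N, hN, hNM, hlt⟩ hlarger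
  · have hrun : improve.run s = exchange.run (prune.run s₂) := by
      simp [improve, run, ← hs₁, ← hs₂, hlarger]
    obtain ⟨hpruned, hsub⟩ := run_prune hG₂ (hmat₂ ▸ hM) (by rwa [hmat₂, hsub₂])
      (by rw [hmat₂, hsub₂]; exact hsearch.1 hlarger)
    have hG₃ : Encodes G n (prune.run s₂) :=
      hG₂.congr (fun a ha => run_of_notMem ha s₂) (by decide)
    have hmat₃ : prune.run s₂ MAT = s MAT := (run_of_notMem (by decide) s₂).trans hmat₂
    rw [hmat₂] at hpruned
    rw [hrun, run_exchange hG₃, hmat₃]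
    exact Or.inr ⟨(Finset.filter_subset _ _).trans (hsub₂ ▸ hsub),
      hpruned.isMatching_exchange hM, hpruned.card_lt_card_exchange⟩

theorem run_maximize (hG : Encodes G n s) :
    G.IsMaximumMatchingIn (marked m (s ACTIVE)) (marked m (maximize.run s MAT)) := by
  set s₁ := (loop EDGE EDGES (.write MAT (.var EDGE) (.const 0))).run s with hs₁
  have hG₁ : Encodes G n s₁ := hG.congr (fun a ha => run_of_notMem ha s) (by decide)
  have hactive : s₁ ACTIVE = s ACTIVE := run_of_notMem (by decide) s
  have hempty : marked m (s₁ MAT) = ∅ := by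
    refine Finset.eq_empty_of_forall_notMem fun e => ?_
    rw [mem_marked, hs₁, run_loop_apply (fun _ => 0) (by decide) (by simp [run]), hG.edges,
      if_pos e.2, not_not]
  -- each improvement adds an edge to the matching, so `m` attempts suffice
  have := run_loop (c := TRY) (b := EDGES) (s := s₁) (p := improve) (fun i s' =>
    marked m (s' MAT) ⊆ marked m (s ACTIVE) ∧ G.IsMatching (marked m (s' MAT)) ∧
      (G.IsMaximumMatchingIn (marked m (s ACTIVE)) (marked m (s' MAT)) ∨
        i ≤ (marked m (s' MAT)).card)) ?_ ?_
  · rw [hG₁.edges] at this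
    obtain ⟨hsub, hM, hmax | hcard⟩ := this
    · exact hmax
    · exact ⟨hsub, hM, fun N _ _ => (Finset.card_le_univ N).trans (by rwa [Fintype.card_fin])⟩
  · rw [Store.write_of_ne _ _ _ (by decide), hempty]
    simp [IsMatching]
  · rintro i s' - - hframe ⟨hsub, hM, h⟩
    have hactive' : s' ACTIVE = s ACTIVE := by rw [hframe _ (by decide), hactive]
    rw [Store.write_of_ne _ _ _ (by decide)]
    rcases run_improve (hG₁.congr hframe (by decide)) hM (by rwa [hactive']) with
      ⟨hmax, hrun⟩ | ⟨hsub', hM', hlt⟩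
    · rw [hrun]
      exact ⟨hsub, hM, Or.inl (hactive' ▸ hmax)⟩
    · refine ⟨hactive' ▸ hsub', hM', Or.inr ?_⟩
      rcases h with hmax | hcard
      · exact absurd (hmax.2.2 _ (hactive' ▸ hsub') hM') hlt.not_ge
      · omega

theorem run_activate (hG : Encodes G n s) {f : Fin m} (hpicked : s PICKED 0 = f) (e : Fin m) :
    activate.run s ACTIVE e = if G.color e = G.color f then 1 else 0 := by
  rw [activate, run_loop_apply (fun e => if s COLOR e = s COLOR f then 1 else 0) (by decide) ?_,
    hG.edges, if_pos e.2]
  · simp only [hG.color, Fin.ext_iff]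
  · intro s' _ hframe _
    have hcolor : s' COLOR = s COLOR := hframe _ (by decide)
    have hpicked' : s' PICKED = s PICKED := hframe _ (by decide)
    simp [run, hcolor, hpicked', hpicked]

theorem run_replaceActive (hG : Encodes G n s) (e : Fin m) :
    replaceActive.run s UNION e = if s ACTIVE e ≠ 0 then s MAT e else s UNION e := by
  rw [replaceActive, run_loop_apply (fun e => if s ACTIVE e ≠ 0 then s MAT e else s UNION e)
    (by decide) ?_, hG.edges, if_pos e.2]
  intro s' _ hframe hcell
  have hactive : s' ACTIVE = s ACTIVE := hframe _ (by decide)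
  have hmat : s' MAT = s MAT := hframe _ (by decide)
  by_cases h : s ACTIVE (s' EDGE 0) = 0
  · simp [run, hactive, h, ← hcell]
  · simp [run, hactive, hmat, h]

theorem run_collectColor (hG : Encodes G n s) {f : Fin m} (hpicked : s PICKED 0 = f) :
    G.IsMaximumMatchingIn (G.colorClass (G.color f))
        ((marked m ((activate ;; maximize ;; replaceActive).run s UNION)).filter
          (G.color · = G.color f)) ∧
      ∀ e : Fin m, G.color e ≠ G.color f →
        (activate ;; maximize ;; replaceActive).run s UNION e = s UNION e := by
  set s₁ := activate.run s with hs₁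
  set s₂ := maximize.run s₁ with hs₂
  have hG₁ : Encodes G n s₁ := hG.congr (fun a ha => run_of_notMem ha s) (by decide)
  have hG₂ : Encodes G n s₂ := hG₁.congr (fun a ha => run_of_notMem ha s₁) (by decide)
  have hactive : ∀ e : Fin m, s₁ ACTIVE e = if G.color e = G.color f then 1 else 0 :=
    run_activate hG hpicked
  have hunion : ∀ e : Fin m, (activate ;; maximize ;; replaceActive).run s UNION e =
      if G.color e = G.color f then s₂ MAT e else s UNION e := by
    intro e
    have hframe : s₂ ACTIVE = s₁ ACTIVE := run_of_notMem (by decide) s₁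
    have hframe' : s₂ UNION = s UNION :=
      (run_of_notMem (by decide) s₁).trans (run_of_notMem (by decide) s)
    have hrun : (activate ;; maximize ;; replaceActive).run s = replaceActive.run s₂ := rfl
    rw [hrun, run_replaceActive hG₂, hframe, hframe', hactive]
    split_ifs <;> simp_all
  refine ⟨?_, fun e he => by rw [hunion, if_neg he]⟩
  have hmax := run_maximize hG₁
  have hclass : marked m (s₁ ACTIVE) = G.colorClass (G.color f) := by
    ext e
    simp [mem_marked, colorClass, hactive]
  rw [hclass] at hmax
  convert hmax using 1
  ext e
  have hcolor : e ∈ marked m (s₂ MAT) → G.color e = G.color f := fun he => by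
    simpa [colorClass] using hmax.1 he
  simp only [Finset.mem_filter, mem_marked, hunion] at hcolor ⊢
  grind

theorem run_collect (hG : Encodes G n s) (i : Fin k) :
    G.IsMaximumMatchingIn (G.colorClass i)
      ((marked m (collect.run s UNION)).filter (G.color · = i)) := by
  have := run_loop (c := PICKED) (b := EDGES) (s := s) (p := activate ;; maximize ;; replaceActive)
    (fun j s' => ∀ f : Fin m, f < j → G.IsMaximumMatchingIn (G.colorClass (G.color f))
      ((marked m (s' UNION)).filter (G.color · = G.color f))) (by simp) ?_
  · rw [hG.edges] at this
    by_cases hi : ∃ f, G.color f = i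
    · obtain ⟨f, rfl⟩ := hi
      exact this f f.2
    · have hempty : G.colorClass i = ∅ := by simpa [colorClass, Finset.filter_eq_empty_iff] using hi
      rw [hempty, Finset.filter_eq_empty_iff.2 fun e _ he => hi ⟨e, he⟩]
      exact ⟨le_rfl, by simp [IsMatching], fun N hN _ => Finset.card_le_card hN⟩
  · intro j s' hj hc hframe hI f hf
    rw [hG.edges] at hj
    obtain ⟨hmax, hunion⟩ := run_collectColor (hG.congr hframe (by decide)) (f := ⟨j, hj⟩) hc
    rw [Store.write_of_ne _ _ _ (by decide)]
    by_cases hcolor : G.color f = G.color ⟨j, hj⟩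
    · rwa [hcolor]
    · have hfilter : (marked m ((activate ;; maximize ;; replaceActive).run s' UNION)).filter
          (G.color · = G.color f) = (marked m (s' UNION)).filter (G.color · = G.color f) := by
        ext e
        simp only [Finset.mem_filter, mem_marked]
        refine and_congr_left fun he => ?_
        rw [hunion e (he ▸ hcolor)]
      rw [hfilter]
      refine hI f (lt_of_le_of_ne (Nat.lt_succ_iff.1 hf) ?_)
      rintro rfl
      exact hcolor rfl

end Cmd

end Ram

/-! ### Forests with bundles -/

namespace EdgeColoredGraph

open SimpleGraph

section Forest

variable {V E : Type*} {k : ℕ} {G : EdgeColoredGraph V E k}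

theorem ncard_edgeSet_exchange {T : SimpleGraph V} (hT : T.edgeSet.Finite) {u v x y : V}
    (huv : T.Adj u v) (hxy : x ≠ y) (h : ¬ (T.deleteEdges {s(u, v)}).Adj x y) :
    (T.deleteEdges {s(u, v)} ⊔ edge x y).edgeSet.ncard = T.edgeSet.ncard := by
  rw [edgeSet_sup, edgeSet_deleteEdges, edgeSet_edge_of_ne hxy, Set.union_singleton,
    Set.ncard_insert_of_notMem (by simpa using h) hT.sdiff,
    Set.ncard_sdiff_singleton_add_one (show s(u, v) ∈ T.edgeSet from huv) hT]

theorem ncard_edgeSet_le_of_reachable {T T' : SimpleGraph V} (hT' : T'.edgeSet.Finite)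
    (hfin : T.edgeSet.Finite) (hT : T.IsAcyclic) (h : ∀ u v, T.Adj u v → T'.Reachable u v) :
    T.edgeSet.ncard ≤ T'.edgeSet.ncard := by
  induction hd : (T.edgeSet \ T'.edgeSet).ncard generalizing T with
  | zero =>
    exact Set.ncard_le_ncard (Set.sdiff_eq_empty.1 ((Set.ncard_eq_zero hfin.sdiff).1 hd)) hT'
  | succ d ih =>
    obtain ⟨e, he⟩ : (T.edgeSet \ T'.edgeSet).Nonempty :=
      (Set.ncard_pos hfin.sdiff).1 (hd ▸ d.succ_pos)
    induction e with
    | _ u v =>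
    obtain ⟨huv, huv'⟩ : T.Adj u v ∧ ¬ T'.Adj u v := he
    -- Removing `uv` splits its tree of `T`; some edge `xy` of `T'` joins the two parts again.
    set T₀ := T.deleteEdges {s(u, v)}
    have hnot : ¬ T₀.Reachable u v := isBridge_iff.1 (isAcyclic_iff_forall_adj_isBridge.1 hT huv)
    obtain ⟨p⟩ := h u v huv
    obtain ⟨⟨⟨x, y⟩, hxy⟩, -, hx, hy⟩ :=
      p.exists_boundary_dart {w | T₀.Reachable u w} (Reachable.refl u) hnot
    have hnxy : ¬ T₀.Reachable x y := fun hr => hy (hx.trans hr)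
    rw [← ncard_edgeSet_exchange hfin huv hxy.ne fun hadj => hnxy hadj.reachable]
    have hedges : (T₀ ⊔ edge x y).edgeSet = insert s(x, y) (T.edgeSet \ {s(u, v)}) := by
      rw [edgeSet_sup, edgeSet_deleteEdges, edgeSet_edge_of_ne hxy.ne, Set.union_singleton]
    refine ih ?_ ((hT.anti (deleteEdges_le _)).sup_edge_of_not_reachable hnxy) ?_ ?_
    · rw [hedges]
      exact hfin.sdiff.insert _
    · intro a b hab
      rw [sup_adj, edge_adj] at hab
      rcases hab with hab | ⟨⟨rfl, rfl⟩ | ⟨rfl, rfl⟩, -⟩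
      exacts [h a b (deleteEdges_le _ hab), hxy.reachable, hxy.reachable.symm]
    · have hdiff : (T₀ ⊔ edge x y).edgeSet \ T'.edgeSet =
          (T.edgeSet \ T'.edgeSet) \ {s(u, v)} := by
        rw [hedges, Set.insert_sdiff_of_mem _ (show s(x, y) ∈ T'.edgeSet from hxy),
          Set.sdiff_sdiff_comm]
      rw [hdiff, Set.ncard_sdiff_singleton_of_mem (by exact ⟨huv, huv'⟩), hd, Nat.add_sub_cancel]

theorem supp_adj {F : Finset E} {u v : V} : (G.supp F).Adj u v ↔ ∃ e ∈ F, G.Joins e u v := by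
  simp only [supp, fromRel_adj]
  constructor
  · rintro ⟨-, ⟨e, he, h⟩ | ⟨e, he, h⟩⟩
    exacts [⟨e, he, h⟩, ⟨e, he, h.symm⟩]
  · rintro ⟨e, he, h⟩
    refine ⟨?_, Or.inl ⟨e, he, h⟩⟩
    rintro rfl
    rcases h with ⟨h1, h2⟩ | ⟨h1, h2⟩ <;> exact G.fst_ne_snd e (h1.trans h2.symm)

theorem supp_mono {F F' : Finset E} (h : F ⊆ F') : G.supp F ≤ G.supp F' := by
  intro u v huv
  obtain ⟨e, he, hj⟩ := supp_adj.1 huv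
  exact supp_adj.2 ⟨e, h he, hj⟩

theorem reachable_of_mem {F : Finset E} {e : E} (he : e ∈ F) :
    (G.supp F).Reachable (G.fst e) (G.snd e) :=
  (supp_adj.2 ⟨e, he, joins_endpoints e⟩).reachable

/-- The pair of endpoints of an edge, which stands for the class of edges parallel to it. -/
def bundle (G : EdgeColoredGraph V E k) (e : E) : Sym2 V := s(G.fst e, G.snd e)

theorem bundle_eq_mk {e : E} {u v : V} : G.bundle e = s(u, v) ↔ G.Joins e u v := by
  simp [bundle, Joins]

theorem edgeSet_supp (F : Finset E) : (G.supp F).edgeSet = G.bundle '' F := by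
  ext b
  induction b with
  | _ u v => simp [supp_adj, bundle_eq_mk]

theorem supp_union_of_bundle_eq [DecidableEq E] {F F' : Finset E} {e : E} (he : e ∈ F')
    (hF' : ∀ f ∈ F', G.bundle f = G.bundle e) :
    G.supp (F ∪ F') = G.supp F ⊔ edge (G.fst e) (G.snd e) := by
  have himage : G.bundle '' F' = {G.bundle e} :=
    Set.eq_singleton_iff_unique_mem.2 ⟨⟨e, he, rfl⟩, by simpa using hF'⟩
  rw [← edgeSet_inj, edgeSet_sup, edgeSet_edge_of_ne (G.fst_ne_snd e), edgeSet_supp, edgeSet_supp,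
    Finset.coe_union, Set.image_union, himage, bundle]

theorem sum_eq_sum_card_filter_le {ι : Type*} {s : Finset ι} {μ : ι → ℕ} {N : ℕ}
    (hN : ∀ b ∈ s, μ b ≤ N) :
    ∑ b ∈ s, μ b = ∑ w ∈ Finset.Icc 1 N, (s.filter (w ≤ μ ·)).card := by
  simp_rw [Finset.card_filter]
  rw [Finset.sum_comm]
  refine Finset.sum_congr rfl fun b hb => ?_
  have hIcc : (Finset.Icc 1 N).filter (· ≤ μ b) = Finset.Icc 1 (μ b) := by
    ext w
    have := hN b hb
    simp only [Finset.mem_filter, Finset.mem_Icc]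
    omega
  rw [← Finset.card_filter, hIcc, Nat.card_Icc, Nat.add_sub_cancel]

theorem relabel_eq_iff_reachable {L : Type*} [DecidableEq L] {comp comp' : V → L}
    {T : SimpleGraph V} {x y : V} (hlabel : ∀ u v, comp u = comp v ↔ T.Reachable u v) (hxy : x ≠ y)
    (hcomp' : ∀ v, comp' v = if comp v = comp x then comp y else comp v) (u v : V) :
    comp' u = comp' v ↔ (T ⊔ edge x y).Reachable u v := by
  have hmono {u v : V} (huv : comp u = comp v) : (T ⊔ edge x y).Reachable u v :=
    ((hlabel u v).1 huv).mono le_sup_left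
  have hedge : (T ⊔ edge x y).Reachable x y :=
    (show (T ⊔ edge x y).Adj x y by simp [edge_adj, hxy]).reachable
  constructor
  · intro huv
    rw [hcomp' u, hcomp' v] at huv
    split_ifs at huv with hu hv hv
    · exact hmono (hu.trans hv.symm)
    · exact (hmono hu).trans (hedge.trans (hmono huv))
    · exact (hmono huv).trans (hedge.symm.trans (hmono hv.symm))
    · exact hmono huv
  · rintro ⟨p⟩
    induction p with
    | nil => rfl
    | @cons a b _ hab _ ih =>
      refine Eq.trans ?_ ih
      rw [hcomp' a, hcomp' b]
      rw [sup_adj, edge_adj] at hab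
      rcases hab with hab | ⟨⟨rfl, rfl⟩ | ⟨rfl, rfl⟩, -⟩
      · rw [(hlabel a b).2 hab.reachable]
      · simp
      · simp

section Greedy

variable [DecidableEq V] {A F : Finset E}

/-- The number of edges of `A` in the bundle `b`. -/
def multiplicity (G : EdgeColoredGraph V E k) (A : Finset E) (b : Sym2 V) : ℕ :=
  (A.filter (G.bundle · = b)).card

/-- The edges of `F` whose bundle has multiplicity at least `w` in `A`. -/
def heavyPart (G : EdgeColoredGraph V E k) (A : Finset E) (w : ℕ) (F : Finset E) :
    Finset E :=
  F.filter fun e => w ≤ G.multiplicity A (G.bundle e)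

theorem mem_heavyPart {w : ℕ} {e : E} :
    e ∈ G.heavyPart A w F ↔ e ∈ F ∧ w ≤ G.multiplicity A (G.bundle e) := by
  simp [heavyPart]

theorem heavyPart_subset {w : ℕ} : G.heavyPart A w F ⊆ F := Finset.filter_subset _ _

/-- The endpoints of `e` are connected by edges of `F` of at least the same multiplicity. -/
def Spanned (G : EdgeColoredGraph V E k) (A F : Finset E) (e : E) : Prop :=
  (G.supp (G.heavyPart A (G.multiplicity A (G.bundle e)) F)).Reachable (G.fst e) (G.snd e)

theorem Spanned.mono {F' : Finset E} {e : E} (h : G.Spanned A F e) (hF : F ⊆ F') :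
    G.Spanned A F' e :=
  Reachable.mono (supp_mono (Finset.filter_subset_filter _ hF)) h

theorem card_le_sum_multiplicity (hFA : F ⊆ A) :
    F.card ≤ ∑ b ∈ F.image G.bundle, G.multiplicity A b := by
  rw [Finset.card_eq_sum_card_image G.bundle F]
  refine Finset.sum_le_sum fun b _ =>
    Finset.card_le_card (Finset.filter_subset_filter _ hFA)

theorem sum_multiplicity_le_card
    (hclosed : ∀ e ∈ F, ∀ f ∈ A, G.bundle f = G.bundle e → f ∈ F) :
    ∑ b ∈ F.image G.bundle, G.multiplicity A b ≤ F.card := by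
  rw [Finset.card_eq_sum_card_image G.bundle F]
  refine Finset.sum_le_sum fun b hb => Finset.card_le_card fun f hf => ?_
  obtain ⟨e, he, rfl⟩ := Finset.mem_image.1 hb
  obtain ⟨hfA, hfe⟩ := Finset.mem_filter.1 hf
  exact Finset.mem_filter.2 ⟨hclosed e he f hfA hfe, hfe⟩

theorem card_bundle_heavyPart_le {H : Finset E} (hHA : H ⊆ A)
    (hH : G.IsForestWithBundles H) (hspan : ∀ e ∈ A, G.Spanned A F e) (w : ℕ) :
    ((G.heavyPart A w H).image G.bundle).card ≤ ((G.heavyPart A w F).image G.bundle).card := by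
  have hcard (X : Finset E) : (X.image G.bundle).card = (G.supp X).edgeSet.ncard := by
    rw [edgeSet_supp, ← Finset.coe_image, Set.ncard_coe_finset]
  have hfin (X : Finset E) : (G.supp X).edgeSet.Finite := by
    rw [edgeSet_supp]
    exact X.finite_toSet.image _
  rw [hcard, hcard]
  refine ncard_edgeSet_le_of_reachable (hfin _) (hfin _) (hH.anti (supp_mono heavyPart_subset))
    fun u v huv => ?_
  obtain ⟨e, he, hj⟩ := supp_adj.1 huv
  obtain ⟨heH, hwe⟩ := mem_heavyPart.1 he
  have hreach : (G.supp (G.heavyPart A w F)).Reachable (G.fst e) (G.snd e) :=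
    Reachable.mono (supp_mono (Finset.monotone_filter_right _ fun f _ hf => hwe.trans hf))
      (hspan e (hHA heH))
  rcases hj with ⟨rfl, rfl⟩ | ⟨rfl, rfl⟩
  exacts [hreach, hreach.symm]

theorem isMaximumForestWithBundlesIn_of_spanned (hFA : F ⊆ A) (hF : G.IsForestWithBundles F)
    (hclosed : ∀ e ∈ F, ∀ f ∈ A, G.bundle f = G.bundle e → f ∈ F)
    (hspan : ∀ e ∈ A, G.Spanned A F e) : G.IsMaximumForestWithBundlesIn A F := by
  classical
  refine ⟨hFA, hF, fun H hHA hH => (card_le_sum_multiplicity (G := G) hHA).trans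
    (le_trans ?_ (sum_multiplicity_le_card hclosed))⟩
  -- Compare the two forests one multiplicity threshold at a time.
  have hN : ∀ b, G.multiplicity A b ≤ A.card := fun b => Finset.card_filter_le _ _
  rw [sum_eq_sum_card_filter_le fun b _ => hN b, sum_eq_sum_card_filter_le fun b _ => hN b]
  refine Finset.sum_le_sum fun w _ => ?_
  simp only [Finset.filter_image]
  exact card_bundle_heavyPart_le hHA hH hspan w

/-- `F` consists of whole bundles of multiplicity at least `w` and is a forest, whose connected
components are labelled by `comp`. -/
structure GreedyForest {L : Type*} (G : EdgeColoredGraph V E k) (A F : Finset E) (comp : V → L)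
    (w : ℕ) : Prop where
  subset : F ⊆ A
  acyclic : G.IsForestWithBundles F
  closed : ∀ e ∈ F, ∀ f ∈ A, G.bundle f = G.bundle e → f ∈ F
  label : ∀ u v, comp u = comp v ↔ (G.supp F).Reachable u v
  level : ∀ e ∈ F, w ≤ G.multiplicity A (G.bundle e)

variable {L : Type*} {comp comp' : V → L} {w : ℕ}

theorem greedyForest_empty (hcomp : Function.Injective comp) : GreedyForest G A ∅ comp w := by
  have hbot : G.supp ∅ = ⊥ := by
    ext u v
    simp [supp_adj]
  refine ⟨by simp, ?_, by simp, fun u v => ?_, by simp⟩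
  · rw [IsForestWithBundles, hbot]
    exact isAcyclic_bot
  · rw [hbot, reachable_bot, hcomp.eq_iff]

theorem GreedyForest.spanned (h : GreedyForest G A F comp w) {e : E}
    (he : G.multiplicity A (G.bundle e) = w) (hcomp : comp (G.fst e) = comp (G.snd e)) :
    G.Spanned A F e := by
  rw [Spanned, heavyPart, Finset.filter_true_of_mem (by rw [he]; exact h.level)]
  exact (h.label _ _).1 hcomp

theorem GreedyForest.mono {w' : ℕ} (h : GreedyForest G A F comp w) (hw : w' ≤ w) :
    GreedyForest G A F comp w' :=
  ⟨h.subset, h.acyclic, h.closed, h.label, fun e he => hw.trans (h.level e he)⟩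

theorem GreedyForest.add [DecidableEq L] (h : GreedyForest G A F comp w) {F' : Finset E} {e : E}
    (heA : e ∈ A) (he : G.multiplicity A (G.bundle e) = w)
    (hcomp : comp (G.fst e) ≠ comp (G.snd e))
    (hF' : ∀ f, f ∈ F' ↔ f ∈ F ∨ f ∈ A ∧ G.bundle f = G.bundle e)
    (hcomp' : ∀ v, comp' v = if comp v = comp (G.fst e) then comp (G.snd e) else comp v) :
    GreedyForest G A F' comp' w := by
  classical
  have hsupp : G.supp F' = G.supp F ⊔ edge (G.fst e) (G.snd e) := by
    have hunion : F' = F ∪ A.filter (G.bundle · = G.bundle e) := by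
      ext f
      rw [hF', Finset.mem_union, Finset.mem_filter]
    rw [hunion]
    exact supp_union_of_bundle_eq (Finset.mem_filter.2 ⟨heA, rfl⟩)
      fun f hf => (Finset.mem_filter.1 hf).2
  refine ⟨fun f hf => ?_, ?_, fun f hf g hg hgf => ?_, fun u v => ?_, fun f hf => ?_⟩
  · exact ((hF' f).1 hf).elim (h.subset ·) And.left
  · rw [IsForestWithBundles, hsupp]
    exact h.acyclic.sup_edge_of_not_reachable fun hr => hcomp ((h.label _ _).2 hr)
  · rw [hF'] at hf ⊢
    exact hf.imp (fun hf => h.closed f hf g hg hgf) fun hf => ⟨hg, hgf.trans hf.2⟩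
  · rw [hsupp]
    exact relabel_eq_iff_reachable h.label (G.fst_ne_snd e) hcomp' u v
  · rcases (hF' f).1 hf with hf | ⟨-, hf⟩
    · exact h.level f hf
    · rw [hf, he]

end Greedy

end Forest

end EdgeColoredGraph

/-! ### The approximation ratio -/

namespace EdgeColoredGraph

open SimpleGraph

section Approximation

variable {V E : Type*} {k : ℕ} {G : EdgeColoredGraph V E k}

section Maximum

variable {A F : Finset E}

theorem IsMaximumForestWithBundlesIn.mem_of_insert [DecidableEq E]
    (h : G.IsMaximumForestWithBundlesIn A F) {e : E} (he : e ∈ A)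
    (hins : G.IsForestWithBundles (insert e F)) : e ∈ F := by
  by_contra heF
  have hcard := h.2.2 (insert e F) (Finset.insert_subset he h.1) hins
  rw [Finset.card_insert_of_notMem heF] at hcard
  omega

theorem supp_insert [DecidableEq E] (e : E) :
    G.supp (insert e F) = G.supp F ⊔ edge (G.fst e) (G.snd e) := by
  rw [Finset.insert_eq, Finset.union_comm]
  exact supp_union_of_bundle_eq (Finset.mem_singleton_self e) (by simp)

theorem IsMaximumForestWithBundlesIn.mem_of_adj (h : G.IsMaximumForestWithBundlesIn A F) {e : E}
    (he : e ∈ A) (hadj : (G.supp F).Adj (G.fst e) (G.snd e)) : e ∈ F := by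
  classical
  refine h.mem_of_insert he ?_
  rw [IsForestWithBundles, supp_insert, sup_eq_left.2 ((edge_le_iff _).2 (.inr hadj))]
  exact h.2.1

theorem IsMaximumForestWithBundlesIn.reachable (h : G.IsMaximumForestWithBundlesIn A F) {e : E}
    (he : e ∈ A) : (G.supp F).Reachable (G.fst e) (G.snd e) := by
  classical
  by_contra hr
  refine hr (reachable_of_mem (h.mem_of_insert he ?_))
  rw [IsForestWithBundles, supp_insert]
  exact h.2.1.sup_edge_of_not_reachable hr

end Maximum

section Components

variable {T : SimpleGraph V}

open Classical in
/-- The edges of `X` whose first endpoint lies in the component `c`. -/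
noncomputable def edgesAt (G : EdgeColoredGraph V E k) (X : Finset E) (c : T.ConnectedComponent) :
    Finset E :=
  X.filter fun e => T.connectedComponentMk (G.fst e) = c

theorem mem_edgesAt {X : Finset E} {c : T.ConnectedComponent} {e : E} :
    e ∈ G.edgesAt X c ↔ e ∈ X ∧ T.connectedComponentMk (G.fst e) = c := by
  simp [edgesAt]

theorem edgesAt_subset {X : Finset E} {c : T.ConnectedComponent} : G.edgesAt X c ⊆ X :=
  fun _ he => (mem_edgesAt.1 he).1

theorem sum_card_edgesAt [Fintype T.ConnectedComponent] (X : Finset E) :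
    ∑ c : T.ConnectedComponent, (G.edgesAt X c).card = X.card := by
  classical
  exact (Finset.card_eq_sum_card_fiberwise fun _ _ => Finset.mem_coe.2 (Finset.mem_univ _)).symm

theorem mem_supp_of_mem_edgesAt {X : Finset E} {c : T.ConnectedComponent} {e : E}
    (he : e ∈ G.edgesAt X c) (hT : ∀ e ∈ X, T.Reachable (G.fst e) (G.snd e)) :
    G.fst e ∈ c.supp ∧ G.snd e ∈ c.supp := by
  obtain ⟨heX, rfl⟩ := mem_edgesAt.1 he
  exact ⟨rfl, (ConnectedComponent.sound (hT e heX)).symm⟩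

theorem ncard_supp_le_card_edgesAt {F : Finset E} (c : (G.supp F).ConnectedComponent) :
    c.supp.ncard ≤ (G.edgesAt F c).card + 1 := by
  classical
  refine c.connected_toSimpleGraph.card_vert_le_card_edgeSet_add_one.trans
    (Nat.add_le_add_right ?_ 1)
  rw [Nat.card_coe_set_eq, ← Set.ncard_image_of_injective _
    (Sym2.map.injective (Subtype.val_injective (p := (· ∈ c.supp))))]
  refine (Set.ncard_le_ncard (t := G.bundle '' G.edgesAt F c) ?_ (Set.toFinite _)).trans
    ((Set.ncard_image_le (Finset.finite_toSet _)).trans (Set.ncard_coe_finset _).le)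
  rintro _ ⟨b, hb, rfl⟩
  induction b with
  | _ u v =>
  obtain ⟨e, he, hj⟩ := supp_adj.1 (show (G.supp F).Adj u v from hb)
  refine ⟨e, mem_edgesAt.2 ⟨he, ?_⟩, bundle_eq_mk.2 hj⟩
  rcases hj with ⟨hu, -⟩ | ⟨hv, -⟩
  exacts [hu ▸ u.2, hv ▸ v.2]

theorem IsMatching.two_mul_card_edgesAt_le [Finite V] {M : Finset E} (hM : G.IsMatching M)
    (hT : ∀ e ∈ M, T.Reachable (G.fst e) (G.snd e)) (c : T.ConnectedComponent) :
    2 * (G.edgesAt M c).card ≤ c.supp.ncard := by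
  classical
  rw [← (hM.mono edgesAt_subset).card_cover, ← Set.ncard_coe_finset]
  refine Set.ncard_le_ncard fun v hv => ?_
  obtain ⟨e, he, rfl | rfl⟩ := mem_cover.1 hv
  exacts [(mem_supp_of_mem_edgesAt he hT).1, (mem_supp_of_mem_edgesAt he hT).2]

theorem IsMaximumForestWithBundlesIn.edgesAt_subset {A F : Finset E}
    (h : G.IsMaximumForestWithBundlesIn A F) (c : (G.supp F).ConnectedComponent)
    (hc : c.supp.ncard = 2) : G.edgesAt A c ⊆ G.edgesAt F c := by
  intro e he
  obtain ⟨heA, hec⟩ := mem_edgesAt.1 he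
  obtain ⟨f, hf⟩ : (G.edgesAt F c).Nonempty := by
    have := ncard_supp_le_card_edgesAt c
    exact Finset.card_pos.1 (by omega)
  have hfF := (mem_edgesAt.1 hf).1
  obtain ⟨u, v, -, hcuv⟩ := Set.ncard_eq_two.1 hc
  obtain ⟨he₁, he₂⟩ := mem_supp_of_mem_edgesAt he fun _ => h.reachable
  obtain ⟨hf₁, hf₂⟩ := mem_supp_of_mem_edgesAt hf fun _ => reachable_of_mem
  -- With only two vertices available, `e` and `f` are parallel.
  have hj : G.Joins f (G.fst e) (G.snd e) := by
    have hne := G.fst_ne_snd e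
    have hnf := G.fst_ne_snd f
    simp only [hcuv, Set.mem_insert_iff, Set.mem_singleton_iff] at he₁ he₂ hf₁ hf₂
    unfold Joins
    grind
  exact mem_edgesAt.2 ⟨h.mem_of_adj heA (supp_adj.2 ⟨f, hfF, hj⟩), hec⟩

end Components

section Ratio

variable [Finite V] [DecidableEq E] {M : Fin k → Finset E} {F : Finset E}

theorem IsMaximumForestWithBundlesIn.card_edgesAt_biUnion_le (hM : ∀ i, G.IsMatching (M i))
    (h : G.IsMaximumForestWithBundlesIn (Finset.univ.biUnion M) F)
    (c : (G.supp F).ConnectedComponent) :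
    (G.edgesAt (Finset.univ.biUnion M) c).card ≤ k * (c.supp.ncard / 2) := by
  have hunion : G.edgesAt (Finset.univ.biUnion M) c =
      Finset.univ.biUnion fun i => G.edgesAt (M i) c := by
    ext e
    simp [mem_edgesAt]
  rw [hunion]
  refine (Finset.card_biUnion_le_card_mul _ _ (c.supp.ncard / 2) fun i _ => ?_).trans (by simp)
  rw [Nat.le_div_iff_mul_le two_pos, mul_comm]
  exact (hM i).two_mul_card_edgesAt_le
    (fun e he => h.reachable (Finset.mem_biUnion.2 ⟨i, Finset.mem_univ _, he⟩)) c

theorem IsMaximumForestWithBundlesIn.mul_card_le (hM : ∀ i, G.IsMatching (M i))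
    (h : G.IsMaximumForestWithBundlesIn (Finset.univ.biUnion M) F) {a b : ℕ} (hab : a ≤ b)
    (hk : ∀ c ≥ 3, a * (k * (c / 2)) ≤ b * (c - 1)) :
    a * (Finset.univ.biUnion M).card ≤ b * F.card := by
  have := Fintype.ofFinite (G.supp F).ConnectedComponent
  have hsum := sum_card_edgesAt (G := G) (T := G.supp F)
  rw [← hsum, ← hsum F, Finset.mul_sum, Finset.mul_sum]
  refine Finset.sum_le_sum fun c _ => ?_
  have hforest := ncard_supp_le_card_edgesAt c
  have hmatchings := h.card_edgesAt_biUnion_le hM c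
  obtain hc | hc | hc : c.supp.ncard < 2 ∨ c.supp.ncard = 2 ∨ 3 ≤ c.supp.ncard := by omega
  · rw [Nat.div_eq_of_lt hc, mul_zero] at hmatchings
    simp [Nat.le_zero.1 hmatchings]
  · exact Nat.mul_le_mul hab (Finset.card_le_card (h.edgesAt_subset c hc))
  · calc a * (G.edgesAt (Finset.univ.biUnion M) c).card
        ≤ a * (k * (c.supp.ncard / 2)) := Nat.mul_le_mul_left a hmatchings
      _ ≤ b * (c.supp.ncard - 1) := hk _ hc
      _ ≤ b * (G.edgesAt F c).card := Nat.mul_le_mul_left b (by omega)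

end Ratio

section ProperColoring

theorem IsProperlyColored.isMatching_filter {O : Finset E} (hO : G.IsProperlyColored O)
    (i : Fin k) : G.IsMatching (O.filter (G.color · = i)) := by
  intro v e he f hf hev hfv
  obtain ⟨he, hei⟩ := Finset.mem_filter.1 he
  obtain ⟨hf, hfi⟩ := Finset.mem_filter.1 hf
  by_contra hne
  exact hO e he f hf hne ⟨v, hev, hfv⟩ (hei.trans hfi.symm)

variable [Fintype E] {M : Fin k → Finset E}

theorem IsMaximumMatchingIn.color_eq {i : Fin k} {N : Finset E}
    (hN : G.IsMaximumMatchingIn (G.colorClass i) N) {e : E} (he : e ∈ N) : G.color e = i := by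
  simpa [colorClass] using hN.1 he

variable [DecidableEq E]

theorem IsProperlyColored.card_le (hM : ∀ i, G.IsMaximumMatchingIn (G.colorClass i) (M i))
    {O : Finset E} (hO : G.IsProperlyColored O) : O.card ≤ (Finset.univ.biUnion M).card := by
  rw [Finset.card_biUnion, Finset.card_eq_sum_card_fiberwise (f := G.color) (t := Finset.univ)
    (by simp)]
  · refine Finset.sum_le_sum fun i _ => (hM i).2.2 _ (fun e he => ?_) (hO.isMatching_filter i)
    simpa [colorClass] using (Finset.mem_filter.1 he).2
  · intro i _ j _ hij
    exact Finset.disjoint_left.2 fun e hei hej =>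
      hij (((hM i).color_eq hei).symm.trans ((hM j).color_eq hej))

theorem isProperlyColored_of_subset (hM : ∀ i, G.IsMaximumMatchingIn (G.colorClass i) (M i))
    {F : Finset E} (hF : F ⊆ Finset.univ.biUnion M) : G.IsProperlyColored F := by
  rintro e he f hf hne ⟨v, hev, hfv⟩ hc
  obtain ⟨i, -, hei⟩ := Finset.mem_biUnion.1 (hF he)
  obtain ⟨j, -, hfj⟩ := Finset.mem_biUnion.1 (hF hf)
  obtain rfl : i = j := by rw [← (hM i).color_eq hei, ← (hM j).color_eq hfj, hc]
  exact hne ((hM i).2.1 v e hei f hfj hev hfv)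

theorem IsMatchingUnionOutput.isApproxSolution [Finite V] {F : Finset E}
    (h : G.IsMatchingUnionOutput F) {a b : ℕ} (hab : a ≤ b) (hb : 0 < b)
    (hk : ∀ c ≥ 3, a * (k * (c / 2)) ≤ b * (c - 1)) : G.IsApproxSolution (a / b) F := by
  obtain ⟨M, hM, hF⟩ := h
  refine ⟨⟨isProperlyColored_of_subset hM hF.1, hF.2.1⟩, fun O hO _ => ?_⟩
  have hcard : a * O.card ≤ b * F.card :=
    (Nat.mul_le_mul_left a (hO.card_le hM)).trans (hF.mul_card_le (fun i => (hM i).2.1) hab hk)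
  rw [div_mul_eq_mul_div, div_le_iff₀ (by exact_mod_cast hb), mul_comm (F.card : ℚ)]
  exact_mod_cast hcard

theorem IsMatchingUnionOutput.isApproxSolution_of_two_colors [Finite V]
    {G : EdgeColoredGraph V E 2} {F : Finset E} (h : G.IsMatchingUnionOutput F) :
    G.IsApproxSolution (3 / 4) F :=
  mod_cast h.isApproxSolution (a := 3) (b := 4) (by omega) (by omega) (by omega)

theorem IsMatchingUnionOutput.isApproxSolution_of_three_colors [Finite V]
    {G : EdgeColoredGraph V E 3} {F : Finset E} (h : G.IsMatchingUnionOutput F) :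
    G.IsApproxSolution (1 / 2) F :=
  mod_cast h.isApproxSolution (a := 1) (b := 2) (by omega) (by omega) (by omega)

end ProperColoring

end Approximation

end EdgeColoredGraph

/-! ### The greedy program -/

namespace EdgeColoredGraph

variable {V W E : Type*} {k : ℕ}

/-- The graph with renamed vertices and the same edges and colors. -/
def mapVertices (G : EdgeColoredGraph V E k) (φ : V ↪ W) : EdgeColoredGraph W E k where
  fst e := φ (G.fst e)
  snd e := φ (G.snd e)
  fst_ne_snd e := φ.injective.ne (G.fst_ne_snd e)
  color := G.color

end EdgeColoredGraph

namespace Ram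

notation "OUT" => 4
notation "COMP" => 9
notation "MULT" => 21

notation "OLD" => 22
notation "NEW" => 23
notation "COUNT" => 24

notation "LEVEL" => 37
notation "CAND" => 38

/-- The endpoints of the edge `i` of the stored graph. -/
def Store.bundle (s : Store) (i : ℕ) : Sym2 ℕ := s(s FST i, s SND i)

theorem Encodes.bundle_eq_bundle_iff {n m k : ℕ} {G : EdgeColoredGraph (Fin n) (Fin m) k}
    {s : Store} (hG : Encodes (G.mapVertices Fin.valEmbedding) n s) {e f : Fin m} :
    s.bundle e = s.bundle f ↔ G.bundle e = G.bundle f := by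
  rw [Store.bundle, Store.bundle, hG.fst, hG.snd, hG.fst, hG.snd]
  exact (Sym2.map.injective Fin.val_injective).eq_iff (a := G.bundle e) (b := G.bundle f)

namespace Cmd

open EdgeColoredGraph

/-- The truth value of the edge `EDGE` of `UNION` being in the bundle of the edge `CAND`. -/
def inBundle : Expr :=
  .and (.read UNION (.var EDGE))
    (.add
      (.and (.eq (.read FST (.var EDGE)) (.read FST (.var CAND)))
        (.eq (.read SND (.var EDGE)) (.read SND (.var CAND))))
      (.and (.eq (.read FST (.var EDGE)) (.read SND (.var CAND)))
        (.eq (.read SND (.var EDGE)) (.read FST (.var CAND)))))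

/-- Start from the empty forest, with every vertex labelled by itself. -/
def initForest : Cmd :=
  .loop VTX VERTICES (.write COMP (.var VTX) (.var VTX)) ;;
  .loop EDGE EDGES (.write OUT (.var EDGE) (.const 0))

/-- Count the edges of `UNION` in the bundle of the edge `CAND`. -/
def countBundle : Cmd :=
  .write COUNT (.const 0) (.const 0) ;;
  .loop EDGE EDGES
    (.ite inBundle (.write COUNT (.const 0) (.add (.var COUNT) (.const 1))) .skip)

/-- Compute the multiplicities of all edges in `UNION`. -/
def countBundles : Cmd :=
  .loop CAND EDGES (countBundle ;; .write MULT (.var CAND) (.var COUNT))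

/-- Merge the components of the two endpoints of the edge `CAND`. -/
def mergeComponents : Cmd :=
  .write OLD (.const 0) (.read COMP (.read FST (.var CAND))) ;;
  .write NEW (.const 0) (.read COMP (.read SND (.var CAND))) ;;
  .loop VTX VERTICES
    (.ite (.eq (.read COMP (.var VTX)) (.var OLD)) (.write COMP (.var VTX) (.var NEW)) .skip)

/-- Add the bundle of the edge `CAND` to the forest. -/
def addBundle : Cmd :=
  .loop EDGE EDGES (.ite inBundle (.write OUT (.var EDGE) (.const 1)) .skip)

/-- Add the bundle of the edge `CAND` to the forest if its multiplicity is `m - LEVEL` and it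
joins two components. -/
def tryBundle : Cmd :=
  .ite
    (.and (.read UNION (.var CAND))
      (.and (.eq (.read MULT (.var CAND)) (.sub (.read 0 (.const EDGES)) (.var LEVEL)))
        (.not (.eq (.read COMP (.read FST (.var CAND))) (.read COMP (.read SND (.var CAND)))))))
    (mergeComponents ;; addBundle) .skip

/-- Compute a maximum-size forest with bundles in `UNION`. -/
def greedy : Cmd :=
  initForest ;; countBundles ;; .loop LEVEL EDGES (.loop CAND EDGES tryBundle)

variable {n m k : ℕ} {G : EdgeColoredGraph (Fin n) (Fin m) k} {s s' : Store}
  {A : Finset (Fin m)} {w : ℕ}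

theorem eval_inBundle (hs : ∀ a ∈ [FST, SND, UNION, CAND], s' a = s a) :
    inBundle.eval s' ≠ 0 ↔
      s UNION (s' EDGE 0) ≠ 0 ∧ s.bundle (s' EDGE 0) = s.bundle (s CAND 0) := by
  simp only [List.forall_mem_cons] at hs
  simp only [inBundle, Expr.eval, Expr.eval_eq, Expr.eval_and, Store.bundle, Sym2.eq_iff, hs]
  grind

theorem run_initForest (hG : Encodes (G.mapVertices Fin.valEmbedding) n s) :
    (∀ v : Fin n, initForest.run s COMP v = v) ∧ ∀ e : Fin m, initForest.run s OUT e = 0 := by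
  set s₁ := (loop VTX VERTICES (.write COMP (.var VTX) (.var VTX))).run s with hs₁
  have hG₁ : Encodes (G.mapVertices Fin.valEmbedding) n s₁ :=
    hG.congr (fun a ha => run_of_notMem ha s) (by decide)
  have hrun : initForest.run s = (loop EDGE EDGES (.write OUT (.var EDGE) (.const 0))).run s₁ := rfl
  refine ⟨fun v => ?_, fun e => ?_⟩
  · rw [hrun, run_of_notMem (by decide), hs₁,
      run_loop_apply id (by decide) (by simp [run]), hG.vertices, if_pos v.2, id]
  · rw [hrun, run_loop_apply (fun _ => 0) (by decide) (by simp [run]), hG₁.edges, if_pos e.2]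

theorem run_countBundle (hG : Encodes (G.mapVertices Fin.valEmbedding) n s) {e : Fin m}
    (hcand : s CAND 0 = e) :
    countBundle.run s COUNT 0 = G.multiplicity (marked m (s UNION)) (G.bundle e) := by
  have hcount := run_loop (c := EDGE) (b := EDGES) (s := s.write COUNT 0 0)
    (p := .ite inBundle (.write COUNT (.const 0) (.add (.var COUNT) (.const 1))) .skip)
    (fun i s' => s' COUNT 0 = Nat.count (fun f => s UNION f ≠ 0 ∧ s.bundle f = s.bundle e) i)
    (by simp) ?_
  · rw [Store.write_of_ne _ _ _ (by decide), hG.edges, Nat.count_eq_card_filter_range] at hcount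
    refine hcount.trans (Eq.trans (congrArg _ ?_) (Finset.card_map Fin.valEmbedding))
    ext f
    simp only [Finset.mem_filter, Finset.mem_range, Finset.mem_map, mem_marked,
      ← hG.bundle_eq_bundle_iff, Fin.valEmbedding_apply]
    exact ⟨fun ⟨hf, h⟩ => ⟨⟨f, hf⟩, h, rfl⟩, fun ⟨f', h, hf'⟩ => hf' ▸ ⟨f'.2, h⟩⟩
  · rintro i s' hi rfl hframe hI
    have hcond := eval_inBundle (s := s) (s' := s') fun a ha => by
      rw [hframe a (by revert a; decide), Store.write_of_ne _ _ _ (by revert a; decide)]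
    rw [hcand] at hcond
    rw [Store.write_of_ne _ _ _ (by decide), Nat.count_succ, ← hI]
    simp only [run, hcond]
    split_ifs <;> simp

theorem run_countBundles (hG : Encodes (G.mapVertices Fin.valEmbedding) n s) (e : Fin m) :
    countBundles.run s MULT e = G.multiplicity (marked m (s UNION)) (G.bundle e) := by
  refine run_loop (fun i s' => ∀ e : Fin m, e < i → s' MULT e =
    G.multiplicity (marked m (s UNION)) (G.bundle e)) (by simp) ?_ e (hG.edges.symm ▸ e.2)
  intro i s' _ hc hframe hI f hf
  have hcand : countBundle.run s' CAND = s' CAND := run_of_notMem (by decide) s'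
  have hmult : countBundle.run s' MULT = s' MULT := run_of_notMem (by decide) s'
  rw [Store.write_of_ne _ _ _ (by decide)]
  simp only [run, Expr.eval, hcand, hc, Store.write_self, Function.update_apply, hmult]
  split_ifs with hfi
  · rw [run_countBundle (hG.congr hframe (by decide)) (hc.trans hfi.symm), hframe _ (by decide)]
  · exact hI f (by omega)

theorem run_mergeComponents (hG : Encodes (G.mapVertices Fin.valEmbedding) n s) {e : Fin m}
    (hcand : s CAND 0 = e) (v : Fin n) :
    mergeComponents.run s COMP v =
      if s COMP v = s COMP (G.fst e) then s COMP (G.snd e) else s COMP v := by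
  set s₁ := (s.write OLD 0 (s COMP (G.fst e))).write NEW 0 (s COMP (G.snd e)) with hs₁
  have hrun : mergeComponents.run s = (loop VTX VERTICES
      (.ite (.eq (.read COMP (.var VTX)) (.var OLD))
        (.write COMP (.var VTX) (.var NEW)) .skip)).run s₁ := by
    simp only [mergeComponents, run, Expr.eval]
    simp [hcand, hG.fst, hG.snd, hs₁, mapVertices]
  have hcomp : s₁ COMP = s COMP := by simp [hs₁]
  have hvertices : s₁ 0 VERTICES = n := by simp [hs₁, hG.vertices]
  rw [hrun, run_loop_apply (fun v => if s COMP v = s COMP (G.fst e) then s COMP (G.snd e)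
    else s COMP v) (by decide) ?_, hvertices, if_pos v.2]
  intro s' _ hframe hcell
  have hold : s' OLD 0 = s COMP (G.fst e) := by simp [hframe, writes, hs₁]
  have hnew : s' NEW 0 = s COMP (G.snd e) := by simp [hframe, writes, hs₁]
  rw [hcomp] at hcell
  simp only [run, Expr.eval_eq, Expr.eval, hold, hnew, hcell]
  split_ifs <;> simp_all

theorem run_addBundle (hG : Encodes (G.mapVertices Fin.valEmbedding) n s) {e : Fin m}
    (hcand : s CAND 0 = e) (f : Fin m) :
    addBundle.run s OUT f =
      if s UNION f ≠ 0 ∧ G.bundle f = G.bundle e then 1 else s OUT f := by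
  rw [addBundle, run_loop_apply
    (fun i => if s UNION i ≠ 0 ∧ s.bundle i = s.bundle e then 1 else s OUT i) (by decide) ?_,
    hG.edges, if_pos f.2]
  · simp only [hG.bundle_eq_bundle_iff]
  · intro s' _ hframe hcell
    have hcond := eval_inBundle (s := s) (s' := s') fun a ha => hframe a (by revert a; decide)
    rw [hcand] at hcond
    simp only [run, hcond, ← hcell]
    split_ifs <;> simp

/-- The invariant of the greedy algorithm: all edges of multiplicity greater than `w` and the
first `j` edges of multiplicity `w` have been tried. -/
structure GreedyInvariant (G : EdgeColoredGraph (Fin n) (Fin m) k) (A : Finset (Fin m)) (w j : ℕ)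
    (s : Store) : Prop where
  forest : GreedyForest G A (marked m (s OUT)) (fun v : Fin n => s COMP v) w
  out_le : ∀ e : Fin m, s OUT e ≤ 1
  spanned : ∀ e ∈ A, w < G.multiplicity A (G.bundle e) ∨
    G.multiplicity A (G.bundle e) = w ∧ e < j → G.Spanned A (marked m (s OUT)) e

theorem GreedyInvariant.congr {j : ℕ} (h : GreedyInvariant G A w j s) (hout : s' OUT = s OUT)
    (hcomp : s' COMP = s COMP) : GreedyInvariant G A w j s' where
  forest := by rw [hout, hcomp]; exact h.forest
  out_le := by rw [hout]; exact h.out_le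
  spanned := by rw [hout]; exact h.spanned

theorem GreedyInvariant.of_forall_eq_zero (hout : ∀ e : Fin m, s OUT e = 0)
    (hcomp : ∀ v : Fin n, s COMP v = v) : GreedyInvariant G A m 0 s := by
  have hempty : marked m (s OUT) = ∅ := by
    refine Finset.eq_empty_of_forall_notMem fun e => ?_
    rw [mem_marked, hout, not_not]
  have hle : ∀ e, G.multiplicity A (G.bundle e) ≤ m := fun e =>
    (Finset.card_le_univ _).trans (Fintype.card_fin m).le
  refine ⟨?_, fun e => by simp [hout], fun e _ he => ?_⟩
  · simp only [hempty, hcomp]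
    exact greedyForest_empty Fin.val_injective
  · exact (he.elim (hle e).not_gt fun h => Nat.not_lt_zero _ h.2).elim

theorem GreedyInvariant.add (hG : Encodes (G.mapVertices Fin.valEmbedding) n s) {e : Fin m}
    (hcand : s CAND 0 = e) (h : GreedyInvariant G (marked m (s UNION)) w e s)
    (heA : e ∈ marked m (s UNION))
    (hmult : G.multiplicity (marked m (s UNION)) (G.bundle e) = w)
    (hcomp : s COMP (G.fst e) ≠ s COMP (G.snd e)) :
    GreedyInvariant G (marked m (s UNION)) w (e + 1) ((mergeComponents ;; addBundle).run s) := by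
  set s₁ := mergeComponents.run s with hs₁
  have hframe : ∀ a ∉ mergeComponents.writes, s₁ a = s a := fun a ha => run_of_notMem ha s
  have hrun : (mergeComponents ;; addBundle).run s = addBundle.run s₁ := rfl
  have hcomp' : addBundle.run s₁ COMP = s₁ COMP := run_of_notMem (by decide) s₁
  have hout : ∀ f : Fin m, addBundle.run s₁ OUT f =
      if s UNION f ≠ 0 ∧ G.bundle f = G.bundle e then 1 else s OUT f := fun f => by
    rw [run_addBundle (hG.congr hframe (by decide)) (by rw [hframe _ (by decide), hcand]),
      hframe OUT (by decide), hframe UNION (by decide)]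
  have hmem : ∀ f, f ∈ marked m (addBundle.run s₁ OUT) ↔
      f ∈ marked m (s OUT) ∨ f ∈ marked m (s UNION) ∧ G.bundle f = G.bundle e := fun f => by
    simp only [mem_marked, hout]
    grind
  have hforest := h.forest.add heA hmult hcomp hmem (comp' := fun v : Fin n => s₁ COMP v)
    (run_mergeComponents hG hcand)
  rw [hrun]
  refine ⟨hcomp' ▸ hforest, fun f => ?_, fun f hf hfw => ?_⟩
  · rw [hout]
    split_ifs
    exacts [le_rfl, h.out_le f]
  · by_cases hfe : f = e
    · subst hfe
      exact hforest.spanned hmult (by simp [hs₁, run_mergeComponents hG hcand])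
    · exact (h.spanned f hf (by grind)).mono fun g hg => (hmem g).2 (Or.inl hg)

theorem GreedyInvariant.skip {e : Fin m} (h : GreedyInvariant G A w e s)
    (hskip : ¬ (e ∈ A ∧ G.multiplicity A (G.bundle e) = w ∧ s COMP (G.fst e) ≠ s COMP (G.snd e))) :
    GreedyInvariant G A w (e + 1) s := by
  refine ⟨h.forest, h.out_le, fun f hf hfw => ?_⟩
  by_cases hfe : f = e ∧ G.multiplicity A (G.bundle e) = w
  · obtain ⟨rfl, hmult⟩ := hfe
    exact h.forest.spanned hmult (by simpa [hf, hmult] using hskip)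
  · exact h.spanned f hf (by grind)

theorem run_tryBundle (hG : Encodes (G.mapVertices Fin.valEmbedding) n s)
    (hmult : ∀ e : Fin m, s MULT e = G.multiplicity (marked m (s UNION)) (G.bundle e))
    {e : Fin m} (hcand : s CAND 0 = e)
    (h : GreedyInvariant G (marked m (s UNION)) (m - s LEVEL 0) e s) :
    GreedyInvariant G (marked m (s UNION)) (m - s LEVEL 0) (e + 1) (tryBundle.run s) := by
  have hrun : tryBundle.run s = if e ∈ marked m (s UNION) ∧
      G.multiplicity (marked m (s UNION)) (G.bundle e) = m - s LEVEL 0 ∧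
      s COMP (G.fst e) ≠ s COMP (G.snd e) then (mergeComponents ;; addBundle).run s else s := by
    simp [tryBundle, run, hcand, hmult, hG.fst, hG.snd, hG.edges, mem_marked, mapVertices]
  rw [hrun]
  split_ifs with hcond
  · exact h.add hG hcand hcond.1 hcond.2.1 hcond.2.2
  · exact h.skip hcond

theorem run_tryBundles (hG : Encodes (G.mapVertices Fin.valEmbedding) n s)
    (hmult : ∀ e : Fin m, s MULT e = G.multiplicity (marked m (s UNION)) (G.bundle e))
    (h : GreedyInvariant G (marked m (s UNION)) (m - s LEVEL 0) 0 s) :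
    GreedyInvariant G (marked m (s UNION)) (m - s LEVEL 0) m
      ((loop CAND EDGES tryBundle).run s) := by
  have := run_loop (c := CAND) (b := EDGES) (s := s) (p := tryBundle)
    (GreedyInvariant G (marked m (s UNION)) (m - s LEVEL 0)) (h.congr (by simp) (by simp)) ?_
  · rwa [hG.edges] at this
  · intro j s' hj hc hframe hI
    rw [hG.edges] at hj
    have hunion : s' UNION = s UNION := hframe _ (by decide)
    have hlevel : s' LEVEL = s LEVEL := hframe _ (by decide)
    have := run_tryBundle (hG.congr hframe (by decide)) (e := ⟨j, hj⟩)
      (by rw [hframe MULT (by decide), hunion]; exact hmult) hc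
    rw [hunion, hlevel] at this
    exact (this hI).congr (by simp) (by simp)

theorem run_greedy (hG : Encodes (G.mapVertices Fin.valEmbedding) n s) :
    G.IsMaximumForestWithBundlesIn (marked m (s UNION)) (marked m (greedy.run s OUT)) ∧
      ∀ e : Fin m, greedy.run s OUT e ≤ 1 := by
  set s₁ := initForest.run s with hs₁
  set s₂ := countBundles.run s₁
  have hrun : greedy.run s = (loop LEVEL EDGES (.loop CAND EDGES tryBundle)).run s₂ := rfl
  have hG₁ : Encodes (G.mapVertices Fin.valEmbedding) n s₁ :=
    hG.congr (fun a ha => run_of_notMem ha s) (by decide)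
  have hframe₂ : ∀ a ∉ countBundles.writes, s₂ a = s₁ a := fun a ha => run_of_notMem ha s₁
  have hG₂ : Encodes (G.mapVertices Fin.valEmbedding) n s₂ := hG₁.congr hframe₂ (by decide)
  have hunion₁ : s₁ UNION = s UNION := run_of_notMem (by decide) s
  have hunion₂ : s₂ UNION = s UNION := (hframe₂ _ (by decide)).trans hunion₁
  have hmult : ∀ e : Fin m, s₂ MULT e = G.multiplicity (marked m (s UNION)) (G.bundle e) :=
    hunion₁ ▸ run_countBundles hG₁
  obtain ⟨hcomp, hout⟩ := run_initForest hG
  rw [← hs₁, ← hframe₂ _ (by decide)] at hcomp hout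
  have hinv := run_loop (c := LEVEL) (b := EDGES) (s := s₂) (p := .loop CAND EDGES tryBundle)
    (fun i => GreedyInvariant G (marked m (s UNION)) (m - i) 0)
    ((GreedyInvariant.of_forall_eq_zero hout hcomp).congr (by simp) (by simp)) ?_
  · rw [← hrun, hG₂.edges, Nat.sub_self] at hinv
    refine ⟨isMaximumForestWithBundlesIn_of_spanned hinv.forest.subset hinv.forest.acyclic
      hinv.forest.closed fun e he => hinv.spanned e he (Or.inl ?_), hinv.out_le⟩
    exact Finset.card_pos.2 ⟨e, Finset.mem_filter.2 ⟨he, rfl⟩⟩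
  · rintro i s' hi rfl hframe hI
    have hunion : s' UNION = s UNION := (hframe _ (by decide)).trans hunion₂
    have := run_tryBundles (hG₂.congr hframe (by decide))
      (by rw [hframe MULT (by decide), hunion]; exact hmult) (hunion ▸ hI)
    rw [hunion] at this
    rw [hG₂.edges] at hi
    refine GreedyInvariant.congr ⟨this.forest.mono (by omega), this.out_le,
      fun e he hew => this.spanned e he (by grind)⟩ (by simp) (by simp)

end Cmd

end Ram

namespace EdgeColoredGraph

variable {V W E : Type*} {k : ℕ} {G : EdgeColoredGraph V E k} {φ : V ↪ W}

theorem isMatching_mapVertices {F : Finset E} :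
    (G.mapVertices φ).IsMatching F ↔ G.IsMatching F := by
  refine ⟨fun h v e he f hf hev hfv => h (φ v) e he f hf ?_ ?_, fun h w e he f hf hew hfw => ?_⟩
  · exact hev.imp (congrArg φ) (congrArg φ)
  · exact hfv.imp (congrArg φ) (congrArg φ)
  · obtain ⟨v, rfl⟩ : ∃ v, φ v = w := hew.elim (⟨_, ·⟩) (⟨_, ·⟩)
    exact h v e he f hf (hew.imp (φ.injective ·) (φ.injective ·))
      (hfw.imp (φ.injective ·) (φ.injective ·))

theorem isMaximumMatchingIn_mapVertices {A M : Finset E} :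
    (G.mapVertices φ).IsMaximumMatchingIn A M ↔ G.IsMaximumMatchingIn A M := by
  simp only [IsMaximumMatchingIn, isMatching_mapVertices]

end EdgeColoredGraph

namespace Ram

open EdgeColoredGraph

/-- Store the number of rounds of a search in place of the number of colors. -/
def setRounds : Program :=
  .write 0 (.const ROUNDS)
    (.add (.add (.read 0 (.const VERTICES)) (.read 0 (.const VERTICES))) (.const 1))

/-- Maximum matchings in all color classes, followed by a greedy forest with bundles in their
union. -/
def matchingUnion : Program := .seq setRounds (Cmd.compile (.collect ;; .greedy))

/-- A bound on the running time of `matchingUnion` in terms of `|V| + |E|`. -/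
noncomputable def matchingUnionTime : Polynomial ℕ :=
  9 + (Cmd.time (.collect ;; .greedy)).comp (2 * .X + 1)

variable {n m k : ℕ} {G : EdgeColoredGraph (Fin n) (Fin m) k} {s : Store}

theorem encodes_inputStore (G : EdgeColoredGraph (Fin n) (Fin m) k) :
    Encodes (G.mapVertices Fin.valEmbedding) n (G.inputStore.write 0 ROUNDS (n + n + 1)) where
  vertices := by simp [inputStore]
  edges := by simp [inputStore]
  rounds := by simp [two_mul]
  fst e := by simp [inputStore, mapVertices]
  snd e := by simp [inputStore, mapVertices]
  color e := by simp [inputStore, mapVertices]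
  fst_lt e := (G.fst e).2
  snd_lt e := (G.snd e).2

theorem isMatchingUnionOutput_run (hG : Encodes (G.mapVertices Fin.valEmbedding) n s) :
    G.IsMatchingUnionOutput (marked m ((Cmd.collect ;; Cmd.greedy).run s OUT)) ∧
      ∀ e : Fin m, (Cmd.collect ;; Cmd.greedy).run s OUT e ≤ 1 := by
  set M := marked m (Cmd.collect.run s UNION)
  have hunion : (Finset.univ.biUnion fun i => M.filter (G.color · = i)) = M := by
    ext e
    simp
  obtain ⟨hforest, hle⟩ := Cmd.run_greedy
    (hG.congr (fun a ha => Cmd.run_of_notMem (p := Cmd.collect) ha s) (by decide))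
  refine ⟨⟨fun i => M.filter (G.color · = i), fun i => ?_, ?_⟩, hle⟩
  · exact isMaximumMatchingIn_mapVertices.1 (Cmd.run_collect hG i)
  · rwa [hunion]

theorem exists_returnsWithin_matchingUnion (G : EdgeColoredGraph (Fin n) (Fin m) k) :
    ∃ F : Finset (Fin m), G.ReturnsWithin matchingUnion (matchingUnionTime.eval (n + m)) F ∧
      G.IsMatchingUnionOutput F := by
  have hwf : Cmd.WF (.collect ;; .greedy) := by decide
  obtain ⟨hF, hle⟩ := isMatchingUnionOutput_run (encodes_inputStore G)
  have hbound : ∀ b, (G.inputStore.write 0 ROUNDS (n + n + 1)) 0 b ≤ 2 * (n + m) + 1 := fun b => by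
    simp only [Store.write_self, Function.update_apply, inputStore]
    split_ifs <;> omega
  obtain ⟨t, ht, hexec⟩ := Cmd.exec hwf hbound
  refine ⟨_, ⟨_, _, ?_, .seq (.write _ _ _ _) hexec, fun e => ?_⟩, hF⟩
  · simp only [Expr.cost, matchingUnionTime, Polynomial.eval_add, Polynomial.eval_comp,
      Polynomial.eval_mul, Polynomial.eval_X, Polynomial.eval_ofNat, Polynomial.eval_one]
    omega
  · have := hle e
    simp only [mem_marked]
    split_ifs <;> omega

end Ram

/-- First part: a single polynomial-time algorithm returns, for every edge-colored graph, a
maximum-size forest with bundles in a union of maximum matchings of the color classes, and this is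
a `3/4`-approximation for two colors and a `1/2`-approximation for three colors.  Second part: the
two guarantees do not depend on which maximum matchings and which forest are chosen. -/
theorem mainTheorem5 :
    (∃ (P : Ram.Program) (p : Polynomial ℕ),
      ∀ (n m k : ℕ) (G : EdgeColoredGraph (Fin n) (Fin m) k),
        ∃ F : Finset (Fin m),
          EdgeColoredGraph.ReturnsWithin P G (p.eval (n + m)) F ∧
          G.IsMatchingUnionOutput F ∧
          (k = 2 → G.IsApproxSolution (3 / 4) F) ∧
          (k = 3 → G.IsApproxSolution (1 / 2) F)) ∧
    (∀ (V E : Type) [Fintype V] [Fintype E] [DecidableEq E],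
      (∀ (G : EdgeColoredGraph V E 2) (F : Finset E),
        G.IsMatchingUnionOutput F → G.IsApproxSolution (3 / 4) F) ∧
      (∀ (G : EdgeColoredGraph V E 3) (F : Finset E),
        G.IsMatchingUnionOutput F → G.IsApproxSolution (1 / 2) F)) := by
  refine ⟨⟨Ram.matchingUnion, Ram.matchingUnionTime, fun n m k G => ?_⟩, fun V E _ _ _ =>
    ⟨fun G F h => h.isApproxSolution_of_two_colors,
      fun G F h => h.isApproxSolution_of_three_colors⟩⟩
  obtain ⟨F, hF, h⟩ := Ram.exists_returnsWithin_matchingUnion G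
  refine ⟨F, hF, h, ?_, ?_⟩
  · rintro rfl
    exact h.isApproxSolution_of_two_colors
  · rintro rfl
    exact h.isApproxSolution_of_three_colors
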